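/- **Conventions.** Manifolds are smooth, Hausdorff and second countable. Let $B$ be a manifold of dimension $n$. A *Lagrangian fibration* over $B$ is a smooth map $f:X\to B$ from a symplectic manifold $(X,\omega)$ of dimension $2n$ such that the set $X^\#\subseteq X$ of points where $f$ is a submersion is dense and the fibres of $X^\#\to B$ are Lagrangian (so $f$ may have singular fibres). It has *local sections* if every point of $B$ has an open neighbourhood over which $f$ has a smooth section. Isomorphisms of Lagrangian fibrations over an open set of $B$ are symplectomorphisms that commute with the projections; $f:X\to B$ and $g:Y\to B$ are *locally isomorphic* if every point of $B$ has an open neighbourhood $U$ such that $f^{-1}(U)\cong g^{-1}(U)$ over $U$. A Lagrangian fibration $j:J\to B$ is called the *Jacobian* of $f$ if it is locally isomorphic to $f$ and has a (global) Lagrangian section. A covector $\beta\in T_b^*B$ acts on the fibre over $b$ by $T_\beta$, the time-one flow of the vector field $v_\beta$ along the fibre with $\iota(v_\beta)\omega=f^*\beta$. If $s$ is a Lagrangian section of $j:J\to B$, then $\Lambda(J^\#)$ denotes the sheaf of Lagrangian sections of $J^\#\to B$, with the fibrewise addition $T_\alpha(s(b))+T_\beta(s(b))=T_{\alpha+\beta}(s(b))$.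 **Theorem 2.6.** Let $f:X\to B$ be a proper Lagrangian fibration with connected fibres, with connected regular parts $f^{-1}(b)\cap X^\#$ of the fibres, and with local sections. 1. There is a proper Lagrangian fibration $j:J\to B$ that is locally isomorphic to $f$ and has a Lagrangian section, that is, $f$ has a Jacobian; and the Jacobian is unique up to isomorphism over $B$. 2. Let $j:J\to B$ be the Jacobian of $f$ and $s$ a Lagrangian section of $j$. For every open $U\subseteq B$ the Lagrangian sections of $J^\#$ over $U$ form an abelian group under fibrewise addition, with zero element $s|_U$, and there is a bijection between the set of isomorphism classes over $B$ of Lagrangian fibrations $g:Y\to B$ with local sections and with Jacobian $J$, and the set $H^1(B,\Lambda(J^\#))$. Under it the class of $Y$ corresponds to the class of a Čech 1-cocycle $(\sigma_{ij})$ on an open covering $\{U_i\}$ if and only if $Y$ is obtained from $J$ by regluing along $(\sigma_{ij})$: there are isomorphisms $\varphi_i:j^{-1}(U_i)\to g^{-1}(U_i)$ over $U_i$ such that $\varphi_i^{-1}\circ\varphi_j$ is the translation by $\sigma_{ij}$ over $U_i\cap U_j$. -/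

import Mathlib

open Set TopologicalSpace
open scoped Manifold ContDiff

universe u v

namespace LagrangianFib

/-- The model space of manifolds of dimension `m`. -/
abbrev E (m : ℕ) : Type := EuclideanSpace ℝ (Fin m)

section Symplectic

variable {m : ℕ} {M : Type v} [TopologicalSpace M] [ChartedSpace (E m) M]

/-- The expression of a (not necessarily continuous) 2-form `η` on `M` in a chart `e`: the pull-back
of `η` under `e.symm`, a 2-form on the model space (meaningful on `e.target`). -/
noncomputable def chartForm (η : ∀ x : M, (TangentSpace 𝓘(ℝ, E m) x) [⋀^Fin 2]→L[ℝ] ℝ)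
    (e : OpenPartialHomeomorph M (E m)) (y : E m) : (E m) [⋀^Fin 2]→L[ℝ] ℝ :=
  (η (e.symm y)).compContinuousLinearMap (mfderiv 𝓘(ℝ, E m) 𝓘(ℝ, E m) e.symm y)

/-- `η` is a symplectic form: a smooth, closed, nondegenerate 2-form. -/
structure IsSymplectic (η : ∀ x : M, (TangentSpace 𝓘(ℝ, E m) x) [⋀^Fin 2]→L[ℝ] ℝ) : Prop where
  smooth : ∀ e ∈ atlas (E m) M, ContDiffOn ℝ ∞ (chartForm η e) e.target
  closed : ∀ e ∈ atlas (E m) M, ∀ y ∈ e.target, extDeriv (chartForm η e) y = 0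
  nondegenerate : ∀ (x : M) (a : TangentSpace 𝓘(ℝ, E m) x),
    (∀ b : TangentSpace 𝓘(ℝ, E m) x, η x ![a, b] = 0) → a = 0

end Symplectic

/-- A smooth Lagrangian fibration `proj : carrier → B` over the `n`-dimensional manifold `B`, possibly
with singular fibres: `carrier` is a symplectic manifold of dimension `2n`, `proj` is smooth, the
points at which `proj` is a submersion are dense, and at each of them the (`n`-dimensional) tangent
space of the fibre is isotropic, hence Lagrangian. -/
structure LagrangianFibration (n : ℕ) (B : Type u) [TopologicalSpace B] [ChartedSpace (E n) B] where
  carrier : Type v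
  [topology : TopologicalSpace carrier]
  [t2 : T2Space carrier]
  [secondCountable : SecondCountableTopology carrier]
  [charted : ChartedSpace (E (2 * n)) carrier]
  [isManifold : IsManifold 𝓘(ℝ, E (2 * n)) ∞ carrier]
  form : ∀ x : carrier, (TangentSpace 𝓘(ℝ, E (2 * n)) x) [⋀^Fin 2]→L[ℝ] ℝ
  symplectic : IsSymplectic form
  proj : carrier → B
  smooth_proj : ContMDiff 𝓘(ℝ, E (2 * n)) 𝓘(ℝ, E n) ∞ proj
  dense_regular : Dense
    {x : carrier | Function.Surjective (mfderiv 𝓘(ℝ, E (2 * n)) 𝓘(ℝ, E n) proj x)}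
  lagrangian : ∀ x : carrier,
    Function.Surjective (mfderiv 𝓘(ℝ, E (2 * n)) 𝓘(ℝ, E n) proj x) →
    ∀ a b : TangentSpace 𝓘(ℝ, E (2 * n)) x,
      mfderiv 𝓘(ℝ, E (2 * n)) 𝓘(ℝ, E n) proj x a = 0 →
      mfderiv 𝓘(ℝ, E (2 * n)) 𝓘(ℝ, E n) proj x b = 0 → form x ![a, b] = 0

attribute [instance] LagrangianFibration.topology LagrangianFibration.t2
  LagrangianFibration.secondCountable LagrangianFibration.charted LagrangianFibration.isManifold

namespace LagrangianFibration

variable {n : ℕ} {B : Type u} [TopologicalSpace B] [ChartedSpace (E n) B]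

/-- `X^#`, the complement of the critical locus of the projection. -/
def regularLocus (F : LagrangianFibration.{u, v} n B) : Set F.carrier :=
  {x | Function.Surjective (mfderiv 𝓘(ℝ, E (2 * n)) 𝓘(ℝ, E n) F.proj x)}

def IsProper (F : LagrangianFibration.{u, v} n B) : Prop := IsProperMap F.proj

def HasConnectedFibres (F : LagrangianFibration.{u, v} n B) : Prop :=
  ∀ b : B, IsConnected (F.proj ⁻¹' {b})

/-- The regular part of every fibre is connected. For a submersion this is the connectedness of the
fibres. -/
def HasConnectedRegularFibres (F : LagrangianFibration.{u, v} n B) : Prop :=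
  ∀ b : B, IsConnected (F.proj ⁻¹' {b} ∩ F.regularLocus)

/-- A smooth section of the fibration over the open set `U`. -/
structure LocalSection (F : LagrangianFibration.{u, v} n B) (U : Opens B) where
  toFun : U → F.carrier
  smooth : ContMDiff 𝓘(ℝ, E n) 𝓘(ℝ, E (2 * n)) ∞ toFun
  proj_eq : ∀ b : U, F.proj (toFun b) = b

/-- Every point of the base has an open neighbourhood with a smooth section. -/
def HasLocalSections (F : LagrangianFibration.{u, v} n B) : Prop :=
  ∀ b : B, ∃ U : Opens B, b ∈ U ∧ Nonempty (F.LocalSection U)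

/-- `Λ(X^#)(U)`: the sections of `X^#` over `U` that pull the symplectic form back to `0`. -/
structure LagrangianSection (F : LagrangianFibration.{u, v} n B) (U : Opens B) extends
    LocalSection F U where
  mem_regularLocus : ∀ b : U, toFun b ∈ F.regularLocus
  isotropic : ∀ (b : U) (a c : TangentSpace 𝓘(ℝ, E n) b),
    F.form (toFun b) ![mfderiv 𝓘(ℝ, E n) 𝓘(ℝ, E (2 * n)) toFun b a,
      mfderiv 𝓘(ℝ, E n) 𝓘(ℝ, E (2 * n)) toFun b c] = 0

instance (F : LagrangianFibration.{u, v} n B) (U : Opens B) :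
    CoeFun (F.LagrangianSection U) fun _ => U → F.carrier := ⟨fun σ => σ.toFun⟩

/-- An isomorphism of Lagrangian fibrations over the open set `U`: a diffeomorphism from
`F.proj ⁻¹' U` onto `G.proj ⁻¹' U` that commutes with the projections to `U` and pulls the symplectic
form of `G` back to that of `F`. -/
structure IsoOver (F G : LagrangianFibration.{u, v} n B) (U : Opens B) where
  map : PartialDiffeomorph 𝓘(ℝ, E (2 * n)) 𝓘(ℝ, E (2 * n)) F.carrier G.carrier ∞
  source_eq : map.source = F.proj ⁻¹' U
  target_eq : map.target = G.proj ⁻¹' U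
  proj_map : ∀ x ∈ F.proj ⁻¹' (U : Set B), G.proj (map x) = F.proj x
  form_map : ∀ x ∈ F.proj ⁻¹' (U : Set B), ∀ a c : TangentSpace 𝓘(ℝ, E (2 * n)) x,
    G.form (map x) ![mfderiv 𝓘(ℝ, E (2 * n)) 𝓘(ℝ, E (2 * n)) map x a,
      mfderiv 𝓘(ℝ, E (2 * n)) 𝓘(ℝ, E (2 * n)) map x c] = F.form x ![a, c]

/-- Global isomorphism over `B`. -/
def Isomorphic (F G : LagrangianFibration.{u, v} n B) : Prop := Nonempty (F.IsoOver G ⊤)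

def LocallyIsomorphic (F G : LagrangianFibration.{u, v} n B) : Prop :=
  ∀ b : B, ∃ U : Opens B, b ∈ U ∧ Nonempty (F.IsoOver G U)

/-- `J` is the Jacobian of `F`: it is locally isomorphic to `F` over `B` and has a global Lagrangian
section. -/
def IsJacobianOf (J F : LagrangianFibration.{u, v} n B) : Prop :=
  J.LocallyIsomorphic F ∧ Nonempty (J.LagrangianSection ⊤)

/-- The action of a covector `β ∈ T_b^*B` on the fibre over `b`: `F.Translate b β x y` says that
`y = T_β(x)`, that is, `x` and `y` lie over `b` and the time-one flow line that starts at `x`, for the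
vector field `V` along the fibre with `ι(V)η = proj^*β` (`η` the symplectic form), ends at `y`. -/
def Translate (F : LagrangianFibration.{u, v} n B) (b : B)
    (β : TangentSpace 𝓘(ℝ, E n) b →L[ℝ] ℝ) (x y : F.carrier) : Prop :=
  ∃ γ : ℝ → F.carrier, γ 0 = x ∧ γ 1 = y ∧ ∀ t : ℝ, F.proj (γ t) = b ∧
    ∃ V : TangentSpace 𝓘(ℝ, E (2 * n)) (γ t),
      HasMFDerivAt 𝓘(ℝ, ℝ) 𝓘(ℝ, E (2 * n)) γ t ((1 : ℝ →L[ℝ] ℝ).smulRight V) ∧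
      ∀ w : TangentSpace 𝓘(ℝ, E (2 * n)) (γ t),
        F.form (γ t) ![V, w] = β (mfderiv 𝓘(ℝ, E (2 * n)) 𝓘(ℝ, E n) F.proj (γ t) w)

/-- Fibrewise addition with zero section `s`: `J.FibreAdd s b x y z` says that `x + y = z` in the
fibre over `b`, where `T_α(s(b)) + T_β(s(b)) = T_{α+β}(s(b))`. More generally `x` may be any point of
the fibre and `y = T_β(s(b))`, and then `z = T_β(x)` is the translate of `x` by `y`. -/
def FibreAdd (J : LagrangianFibration.{u, v} n B) (s : J.LagrangianSection ⊤) (b : B)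
    (x y z : J.carrier) : Prop :=
  ∃ β : TangentSpace 𝓘(ℝ, E n) b →L[ℝ] ℝ,
    J.Translate b β (s ⟨b, trivial⟩) y ∧ J.Translate b β x z

/-- A Čech 1-cocycle of the sheaf `Λ(J^#)` of Lagrangian sections of `J^#`, with respect to an open
covering of `B`: `σ_ij + σ_jk = σ_ik` on triple intersections. -/
structure OneCocycle (J : LagrangianFibration.{u, v} n B) (s : J.LagrangianSection ⊤) where
  ι : Type u
  U : ι → Opens B
  covers : ∀ b : B, ∃ i, b ∈ U i
  sec : ∀ i j, J.LagrangianSection (U i ⊓ U j)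
  cocycle : ∀ (i j k : ι) (b : B) (hi : b ∈ U i) (hj : b ∈ U j) (hk : b ∈ U k),
    J.FibreAdd s b (sec i j ⟨b, hi, hj⟩) (sec j k ⟨b, hj, hk⟩) (sec i k ⟨b, hi, hk⟩)

/-- Two Čech 1-cocycles are cohomologous: on a common refinement `V` of their coverings there is a
0-cochain `τ` of Lagrangian sections with `σ_kl + τ_l = τ_k + σ'_kl` on `V_k ∩ V_l`. -/
def Cohomologous (J : LagrangianFibration.{u, v} n B) (s : J.LagrangianSection ⊤)
    (c c' : J.OneCocycle s) : Prop :=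
  ∃ (κ : Type u) (V : κ → Opens B) (_ : ∀ b : B, ∃ k, b ∈ V k)
    (r : κ → c.ι) (r' : κ → c'.ι) (hr : ∀ k, V k ≤ c.U (r k)) (hr' : ∀ k, V k ≤ c'.U (r' k))
    (τ : ∀ k, J.LagrangianSection (V k)),
    ∀ (k l : κ) (b : B) (hk : b ∈ V k) (hl : b ∈ V l), ∃ z : J.carrier,
      J.FibreAdd s b (c.sec (r k) (r l) ⟨b, hr k hk, hr l hl⟩) (τ l ⟨b, hl⟩) z ∧
      J.FibreAdd s b (τ k ⟨b, hk⟩) (c'.sec (r' k) (r' l) ⟨b, hr' k hk, hr' l hl⟩) z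

/-- `H¹(B, Λ(J^#))`: Čech 1-cocycles modulo coboundaries, in the limit over all open coverings (in
degree one this is the sheaf cohomology). -/
def H1 (J : LagrangianFibration.{u, v} n B) (s : J.LagrangianSection ⊤) : Type (max (u + 1) v) :=
  Quot (J.Cohomologous s)

/-- The Lagrangian fibrations over `B` with local sections and with Jacobian `J`. -/
def WithJacobian (J : LagrangianFibration.{u, v} n B) : Type (max u (v + 1)) :=
  {Y : LagrangianFibration.{u, v} n B // Y.HasLocalSections ∧ J.IsJacobianOf Y}

/-- Isomorphism classes over `B` of Lagrangian fibrations with local sections and Jacobian `J`. -/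
def ClassesWithJacobian (J : LagrangianFibration.{u, v} n B) : Type (max u (v + 1)) :=
  Quot fun Y Y' : J.WithJacobian => Y.1.Isomorphic Y'.1

/-- `Y` is obtained from `J` by regluing along the 1-cocycle `c`: there are isomorphisms
`φ_i : J|U_i ≅ Y|U_i` such that `φ_i⁻¹ ∘ φ_j` is the translation by `σ_ij` over `U_i ∩ U_j`. -/
def IsRegluing (J : LagrangianFibration.{u, v} n B) (s : J.LagrangianSection ⊤)
    (c : J.OneCocycle s) (Y : LagrangianFibration.{u, v} n B) : Prop :=
  ∃ φ : ∀ i, J.IsoOver Y (c.U i), ∀ (i j : c.ι) (b : B) (hi : b ∈ c.U i) (hj : b ∈ c.U j)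
    (x : J.carrier), J.proj x = b →
      ∃ y : J.carrier, J.FibreAdd s b x (c.sec i j ⟨b, hi, hj⟩) y ∧ (φ j).map x = (φ i).map y

end LagrangianFibration

end LagrangianFib

/-!
# Lagrangian fibrations and their Jacobians

In coordinates, a covector on the base gives a vector field along the fibres which is Hamiltonian
for the form (`IsLagrangianModel.hamVec`). Its local flow is smooth and preserves the form, and
since the fibration is proper the flow is complete (`IsProper.isComplete`). The time-one maps
`flow β` are therefore defined for all covectors `β`, they are additive in `β` (`flow_add`), and for a
covector with constant coefficients in a chart they are symplectic (`smooth_chartFlow`).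

Translating a local section by covectors gives, by the inverse function theorem, all points near the
section (`exists_smooth_covector`). So the orbits are open in the regular part of a fibre, and where
that part is connected the covectors act transitively on it (`IsTame.exists_flow_eq`). A covector
that fixes one regular point acts trivially on the whole fibre, singular points included
(`IsTame.flow_eq_self`): it extends to a field of covectors which fixes a section through the point,
so on the nearby fibres it fixes the regular points, and these are dense in the total space. Hence
two points `p`, `q` of the regular part of a fibre define a translation `shift p q` of that whole
fibre. The translation by a field of covectors `α` changes the form by the pull-back of `dα`;
applied to a section that is moved to another one, this shows that translating by the difference of
two Lagrangian sections is symplectic (`IsTame.isMorphismAt_shift`). For the same reason a smooth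
local section becomes Lagrangian when it is translated by a suitable primitive of the pull-back of
the form, which the Poincaré lemma provides (`exists_isLagrangianAt`).

It follows that an isomorphism over an open set can be normalised to take a given Lagrangian section
to another given one (`IsTame.exists_isIsoOn`), and that it is then unique
(`IsTame.eq_of_eq_section`): it commutes with the action, so it is determined on regular points,
which are dense. Uniqueness of the Jacobian and triviality of a fibration with a Lagrangian section
are immediate (`IsTame.isomorphic_of_sections`). The Jacobian itself is glued from the pieces
`f⁻¹(U)` over open sets `U` with a Lagrangian section, along the translations that match these
sections (`IsTame.exists_jacobian`); the same gluing construction, `GluingData.total`, realises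
every cocycle of Lagrangian sections (`exists_regluing`). Conversely, local isomorphisms between `J`
and `Y`, normalised by local Lagrangian sections of `Y`, differ by translations, which form a
cocycle (`exists_isRegluing`); cohomologous cocycles give isomorphic regluings and only they do
(`isomorphic_of_cohomologous`, `cohomologous_of_isRegluing`).
-/


set_option autoImplicit false

namespace LagrangianFib

open Filter Topology

/-! ### Smooth dependence of solutions of ordinary differential equations -/

section ODE

variable {K : Type} [TopologicalSpace K] [CompactSpace K]
variable {V W : Type} [NormedAddCommGroup V] [NormedSpace ℝ V] [NormedAddCommGroup W]
  [NormedSpace ℝ W]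

/-- Pointwise evaluation of a continuous family of continuous linear maps at a continuous family of
vectors, as a continuous bilinear map. -/
noncomputable def evalFamily : C(K, V →L[ℝ] W) →L[ℝ] C(K, V) →L[ℝ] C(K, W) :=
  LinearMap.mkContinuous₂
    (LinearMap.mk₂ ℝ (fun (a : C(K, V →L[ℝ] W)) (h : C(K, V)) =>
      (⟨fun t => a t (h t), a.continuous.clm_apply h.continuous⟩ : C(K, W)))
      (fun a a' h => by ext t; simp) (fun r a h => by ext t; simp)
      (fun a h h' => by ext t; simp) (fun r a h => by ext t; simp)) 1 (by
    intro a h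
    rw [ContinuousMap.norm_le _ (by positivity)]
    intro t
    simp only [one_mul, LinearMap.mk₂_apply, ContinuousMap.coe_mk]
    exact (ContinuousLinearMap.le_opNorm _ _).trans
      (mul_le_mul (a.norm_coe_le_norm t) (h.norm_coe_le_norm t) (norm_nonneg (h t)) (norm_nonneg a)))

@[simp] lemma evalFamily_apply (a : C(K, V →L[ℝ] W)) (h : C(K, V)) (t : K) :
    evalFamily a h t = a t (h t) := rfl

/-- Composition with a `C¹` map is differentiable on the space of continuous maps on a compact
space. -/
lemma hasFDerivAt_postcomp {f : V → W} (hf : ContDiff ℝ 1 f) (γ : C(K, V)) :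
    HasFDerivAt (fun γ : C(K, V) => (⟨f, hf.continuous⟩ : C(V, W)).comp γ)
      (evalFamily ((⟨fderiv ℝ f, hf.continuous_fderiv one_ne_zero⟩ : C(V, V →L[ℝ] W)).comp γ)) γ := by
  set D : C(V, V →L[ℝ] W) := ⟨fderiv ℝ f, hf.continuous_fderiv one_ne_zero⟩ with hD
  rw [hasFDerivAt_iff_isLittleO_nhds_zero, Asymptotics.isLittleO_iff]
  intro ε hε
  have hc : ContinuousAt (fun γ : C(K, V) => D.comp γ) γ :=
    (ContinuousMap.continuous_postcomp D).continuousAt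
  obtain ⟨δ, hδ, hc⟩ := (Metric.continuousAt_iff (α := C(K, V)) (β := C(K, V →L[ℝ] W))).1 hc ε hε
  filter_upwards [Metric.ball_mem_nhds (0 : C(K, V)) hδ] with h hh
  rw [ContinuousMap.norm_le _ (by positivity)]
  intro t
  have hmv := Convex.norm_image_sub_le_of_norm_hasFDerivWithin_le' (f := f) (f' := fderiv ℝ f)
    (φ := fderiv ℝ f (γ t)) (s := segment ℝ (γ t) (γ t + h t)) (C := ε) (x := γ t) (y := γ t + h t)
    (fun x _ => ((hf.differentiable one_ne_zero) x).hasFDerivAt.hasFDerivWithinAt) ?_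
    (convex_segment _ _) (left_mem_segment _ _ _) (right_mem_segment _ _ _)
  · refine le_trans ?_ (hmv.trans ?_)
    · simp [hD]
    · simpa using mul_le_mul_of_nonneg_left (h.norm_coe_le_norm t) hε.le
  · intro x hx
    rw [segment_eq_image'] at hx
    obtain ⟨s, hs, rfl⟩ := hx
    have h1 : dist (γ + s • h) γ < δ := by
      rw [dist_eq_norm, add_sub_cancel_left, norm_smul, Real.norm_of_nonneg hs.1]
      exact (mul_le_of_le_one_left (norm_nonneg _) hs.2).trans_lt (by simpa using hh)
    have h2 := (ContinuousMap.dist_apply_le_dist t).trans (hc h1).le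
    simpa [dist_eq_norm, hD] using h2

/-- Composition with a smooth map is a smooth operation on the space of continuous maps on a compact
space. -/
lemma contDiff_postcomp {f : V → W} (hf : ContDiff ℝ ∞ f) :
    ContDiff ℝ ∞ (fun γ : C(K, V) => (⟨f, hf.continuous⟩ : C(V, W)).comp γ) := by
  have key : ∀ m : ℕ, ∀ (W : Type) [NormedAddCommGroup W] [NormedSpace ℝ W] (f : V → W)
      (hf : ContDiff ℝ ∞ f),
      ContDiff ℝ m (fun γ : C(K, V) => (⟨f, hf.continuous⟩ : C(V, W)).comp γ) := by
    intro m
    induction m with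
    | zero =>
      intro W _ _ f hf
      exact contDiff_zero.2 (ContinuousMap.continuous_postcomp _)
    | succ m ih =>
      intro W _ _ f hf
      rw [Nat.cast_succ, contDiff_succ_iff_hasFDerivAt]
      have hf1 : ContDiff ℝ 1 f := hf.of_le (by exact_mod_cast le_top)
      have hf' : ContDiff ℝ ∞ (fderiv ℝ f) := hf.fderiv_right (by simp)
      exact ⟨fun γ => evalFamily ((⟨fderiv ℝ f, hf'.continuous⟩ : C(V, V →L[ℝ] W)).comp γ),
        ContDiff.comp (g := evalFamily (K := K) (V := V) (W := W))
          (ContinuousLinearMap.contDiff _) (ih _ _ hf'),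
        fun γ => hasFDerivAt_postcomp hf1 γ⟩
  exact contDiff_infty.2 fun m => key m W f hf

/-- A map that is smooth on a neighbourhood of a point of a finite-dimensional space agrees near that
point with a globally smooth map. -/
lemma exists_contDiff_eventuallyEq [FiniteDimensional ℝ V] {f : V → W} {O : Set V} (hO : IsOpen O)
    (hf : ContDiffOn ℝ ∞ f O) {x : V} (hx : x ∈ O) :
    ∃ g : V → W, ContDiff ℝ ∞ g ∧ g =ᶠ[𝓝 x] f := by
  obtain ⟨r, hr, hrO⟩ := Metric.nhds_basis_closedBall.mem_iff.1 (hO.mem_nhds hx)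
  let ρ : ContDiffBump x := ⟨r / 2, r, by positivity, by linarith⟩
  refine ⟨fun y => ρ y • f y, ?_, ?_⟩
  · rw [contDiff_iff_contDiffAt]
    intro y
    by_cases hy : y ∈ O
    · exact ρ.contDiff.contDiffAt.smul ((hf y hy).contDiffAt (hO.mem_nhds hy))
    · have h1 : y ∉ tsupport ρ := fun h => hy (hrO (by rwa [ρ.tsupport_eq] at h))
      have h2 : (fun y => ρ y • f y) =ᶠ[𝓝 y] fun _ => (0 : W) := by
        filter_upwards [(isClosed_tsupport ρ).isOpen_compl.mem_nhds h1] with z hz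
        rw [image_eq_zero_of_notMem_tsupport hz, zero_smul]
      exact contDiffAt_const.congr_of_eventuallyEq h2
  · filter_upwards [ρ.eventuallyEq_one] with y hy
    simp [hy]

/-- The interval on which integral curves are constructed. -/
abbrev TimeInterval : Type := Icc (-2 : ℝ) 2

/-- The projection of the real line onto the time interval. -/
noncomputable def clampTime (t : ℝ) : TimeInterval := projIcc (-2) 2 (by norm_num) t

lemma continuous_clampTime : Continuous clampTime :=
  continuous_projIcc (h := by norm_num)

lemma clampTime_of_mem {t : ℝ} (ht : t ∈ Icc (-2 : ℝ) 2) : clampTime t = ⟨t, ht⟩ :=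
  projIcc_of_mem _ ht

/-- Integration from `0`, as a continuous linear map on continuous functions. -/
noncomputable def primitive : C(TimeInterval, V) →L[ℝ] C(TimeInterval, V) :=
  LinearMap.mkContinuous
    { toFun := fun g => ⟨fun t => ∫ s in (0 : ℝ)..t, g (clampTime s), by
        have h : Continuous fun s => g (clampTime s) := g.continuous.comp continuous_clampTime
        have h2 : Continuous fun t : ℝ => ∫ s in (0 : ℝ)..t, g (clampTime s) :=
          intervalIntegral.continuous_primitive (fun a b => h.intervalIntegrable a b) 0
        exact h2.comp continuous_subtype_val⟩
      map_add' := fun g g' => by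
        ext t
        exact intervalIntegral.integral_add
          ((g.continuous.comp continuous_clampTime).intervalIntegrable _ _)
          ((g'.continuous.comp continuous_clampTime).intervalIntegrable _ _)
      map_smul' := fun r g => by
        ext t
        exact intervalIntegral.integral_smul r (fun s => g (clampTime s)) } 2 (by
    intro g
    rw [ContinuousMap.norm_le _ (by positivity)]
    intro t
    refine (intervalIntegral.norm_integral_le_of_norm_le_const (C := ‖g‖)
      fun s _ => g.norm_coe_le_norm _).trans ?_
    rw [mul_comm]
    refine mul_le_mul_of_nonneg_right ?_ (norm_nonneg _)
    rw [sub_zero]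
    exact abs_le.2 t.2)

lemma primitive_apply (g : C(TimeInterval, V)) (t : TimeInterval) :
    primitive g t = ∫ s in (0 : ℝ)..t, g (clampTime s) := rfl

/-- Constant maps, as a continuous linear map. -/
noncomputable def constMap : V →L[ℝ] C(TimeInterval, V) :=
  LinearMap.mkContinuous
    { toFun := fun x => ContinuousMap.const _ x
      map_add' := fun _ _ => rfl
      map_smul' := fun _ _ => rfl } 1 (by
    intro x
    rw [ContinuousMap.norm_le _ (by positivity)]
    intro t
    exact (one_mul ‖x‖).ge)

@[simp] lemma constMap_apply (x : V) (t : TimeInterval) : constMap x t = x := rfl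

variable {P : Type} [NormedAddCommGroup P] [NormedSpace ℝ P]

/-- The integral equation of the parameter-dependent equation `y' = A(y) c`: a curve `γ` solves the
initial value problem with parameter `c` and initial value `x` if and only if
`integralEquation A ((c, x), γ) = ((c, x), 0)`. -/
noncomputable def integralEquation (A : C(V, P →L[ℝ] V))
    (q : (P × V) × C(TimeInterval, V)) : (P × V) × C(TimeInterval, V) :=
  (q.1, q.2 - constMap q.1.2 - primitive (evalFamily (A.comp q.2) (constMap q.1.1)))

lemma contDiff_integralEquation {A : V → P →L[ℝ] V} (hA : ContDiff ℝ ∞ A) :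
    ContDiff ℝ ∞ (integralEquation ⟨A, hA.continuous⟩) := by
  have h1 : ContDiff ℝ ∞ fun q : (P × V) × C(TimeInterval, V) =>
      (⟨A, hA.continuous⟩ : C(V, P →L[ℝ] V)).comp q.2 :=
    (contDiff_postcomp hA).comp contDiff_snd
  have h2 : ContDiff ℝ ∞ fun q : (P × V) × C(TimeInterval, V) =>
      (constMap (V := P)) q.1.1 :=
    ContDiff.comp (g := constMap (V := P)) (ContinuousLinearMap.contDiff _)
      (contDiff_fst.comp contDiff_fst)
  have h3 : ContDiff ℝ ∞ fun q : (P × V) × C(TimeInterval, V) =>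
      (constMap (V := V)) q.1.2 :=
    ContDiff.comp (g := constMap (V := V)) (ContinuousLinearMap.contDiff _)
      (contDiff_snd.comp contDiff_fst)
  exact contDiff_fst.prodMk ((contDiff_snd.sub h3).sub
    (ContDiff.comp (g := primitive (V := V)) (ContinuousLinearMap.contDiff _)
      ((ContDiff.comp (g := evalFamily (K := TimeInterval) (V := P) (W := V))
        (ContinuousLinearMap.contDiff _) h1).clm_apply h2)))

/-- At the parameter `0` the integral equation has an invertible derivative. -/
lemma hasFDerivAt_integralEquation {A : V → P →L[ℝ] V} (hA : ContDiff ℝ ∞ A) (x : V) :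
    ∃ L : ((P × V) × C(TimeInterval, V)) ≃L[ℝ] ((P × V) × C(TimeInterval, V)),
      HasFDerivAt (integralEquation ⟨A, hA.continuous⟩)
        (L : ((P × V) × C(TimeInterval, V)) →L[ℝ] ((P × V) × C(TimeInterval, V)))
        ((0, x), constMap x) := by
  set A' : C(V, P →L[ℝ] V) := ⟨A, hA.continuous⟩
  have hd := ((contDiff_integralEquation hA).differentiable (by simp)
    ((0, x), constMap x)).hasFDerivAt
  let S : P →L[ℝ] C(TimeInterval, V) :=
    primitive ∘L (evalFamily (A'.comp (constMap x))) ∘L constMap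
  let T : (P × V) →L[ℝ] C(TimeInterval, V) :=
    -(constMap ∘L ContinuousLinearMap.snd ℝ P V + S ∘L ContinuousLinearMap.fst ℝ P V)
  refine ⟨ContinuousLinearEquiv.skewProd (.refl ℝ _) (.refl ℝ _) T, ?_⟩
  have h1 : HasFDerivAt (fun q : (P × V) × C(TimeInterval, V) => A'.comp q.2)
      _ ((0, x), constMap x) :=
    HasFDerivAt.comp (g := fun γ : C(TimeInterval, V) => A'.comp γ) _
      (hasFDerivAt_postcomp (hA.of_le (by exact_mod_cast le_top)) _) hasFDerivAt_snd
  have h2 : HasFDerivAt (fun q : (P × V) × C(TimeInterval, V) => (constMap (V := P)) q.1.1)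
      _ ((0, x), constMap x) :=
    HasFDerivAt.comp (g := constMap (V := P)) _ (ContinuousLinearMap.hasFDerivAt _)
      (hasFDerivAt_fst.comp _ hasFDerivAt_fst)
  have h3 : HasFDerivAt (fun q : (P × V) × C(TimeInterval, V) => (constMap (V := V)) q.1.2)
      _ ((0, x), constMap x) :=
    HasFDerivAt.comp (g := constMap (V := V)) _ (ContinuousLinearMap.hasFDerivAt _)
      (hasFDerivAt_snd.comp _ hasFDerivAt_fst)
  have h4 := HasFDerivAt.comp (g := primitive (V := V)) _ (ContinuousLinearMap.hasFDerivAt _)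
    ((evalFamily (K := TimeInterval) (V := P) (W := V)).hasFDerivAt_of_bilinear h1 h2)
  have h5 := hasFDerivAt_fst.prodMk ((hasFDerivAt_snd.sub h3).sub h4)
  refine HasFDerivAt.congr_fderiv h5 ?_
  ext q
  all_goals simp [T, S]

end ODE

section InverseFunction

/-- The inverse function theorem for smooth maps on an open set, with a smooth inverse on the whole
target. -/
theorem exists_smooth_localInverse {X Y : Type} [NormedAddCommGroup X] [NormedSpace ℝ X]
    [CompleteSpace X] [NormedAddCommGroup Y] [NormedSpace ℝ Y] {G : X → Y} {O : Set X}
    (hO : IsOpen O) (hG : ContDiffOn ℝ ∞ G O) {a : X} (ha : a ∈ O) {L : X ≃L[ℝ] Y}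
    (hL : HasFDerivAt G (L : X →L[ℝ] Y) a) :
    ∃ e : OpenPartialHomeomorph X Y, a ∈ e.source ∧ e.source ⊆ O ∧ (∀ x, e x = G x) ∧
      ContDiffOn ℝ ∞ e.symm e.target := by
  have hGa : ContDiffAt ℝ ∞ G a := (hG a ha).contDiffAt (hO.mem_nhds ha)
  let e₀ := hGa.toOpenPartialHomeomorph G hL (by simp)
  have he₀ : ∀ x, e₀ x = G x := fun x => rfl
  have hcont : ContinuousAt (fderiv ℝ G) a :=
    ((hG.continuousOn_fderiv_of_isOpen hO (by simp)) a ha).continuousAt (hO.mem_nhds ha)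
  have hev : ∀ᶠ x in 𝓝 a, x ∈ O ∧
      fderiv ℝ G x ∈ range ((↑) : (X ≃L[ℝ] Y) → X →L[ℝ] Y) := by
    have h1 : ∀ᶠ f in 𝓝 (fderiv ℝ G a), f ∈ range ((↑) : (X ≃L[ℝ] Y) → X →L[ℝ] Y) := by
      rw [hL.fderiv]
      exact ContinuousLinearEquiv.nhds L
    filter_upwards [hO.mem_nhds ha, hcont.eventually h1] with x hx hx' using ⟨hx, hx'⟩
  obtain ⟨S, hS, hSo, haS⟩ := eventually_nhds_iff.1 hev
  refine ⟨e₀.restrOpen S hSo, ⟨hGa.mem_toOpenPartialHomeomorph_source hL (by simp), haS⟩,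
    fun x hx => (hS x hx.2).1, he₀, ?_⟩
  intro y hy
  have hx := (e₀.restrOpen S hSo).map_target hy
  obtain ⟨hxO, L', hL'⟩ := hS _ hx.2
  have hd : ContDiffAt ℝ ∞ G ((e₀.restrOpen S hSo).symm y) :=
    (hG _ hxO).contDiffAt (hO.mem_nhds hxO)
  refine (OpenPartialHomeomorph.contDiffAt_symm _ (f₀' := L') hy ?_ hd).contDiffWithinAt
  rw [hL']
  exact (hd.differentiableAt (by simp)).hasFDerivAt

end InverseFunction

section ODE

variable {V P : Type} [NormedAddCommGroup V] [NormedSpace ℝ V] [NormedAddCommGroup P]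
  [NormedSpace ℝ P]

lemma exists_isIntegralCurve_of_integralEquation [CompleteSpace V] (A : C(V, P →L[ℝ] V))
    {p : P × V} {γ : C(TimeInterval, V)} (h : integralEquation A (p, γ) = (p, 0)) :
    ∃ g : ℝ → V, g 0 = p.2 ∧ (∀ t (ht : t ∈ Icc (-2 : ℝ) 2), g t = γ ⟨t, ht⟩) ∧
      ∀ t ∈ Icc (-2 : ℝ) 2, HasDerivAt g (A (g t) p.1) t := by
  let φ : ℝ → V := fun s => A (γ (clampTime s)) p.1
  have hφ : Continuous φ :=
    ((A.continuous.comp (γ.continuous.comp continuous_clampTime))).clm_apply continuous_const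
  have h2 : ∀ t (ht : t ∈ Icc (-2 : ℝ) 2), p.2 + ∫ s in (0 : ℝ)..t, φ s = γ ⟨t, ht⟩ := by
    intro t ht
    have h3 := congrArg (fun q : (P × V) × C(TimeInterval, V) => q.2 ⟨t, ht⟩) h
    simp only [integralEquation, ContinuousMap.sub_apply, ContinuousMap.zero_apply, constMap_apply,
      primitive_apply, evalFamily_apply, ContinuousMap.comp_apply] at h3
    rw [sub_sub, sub_eq_zero] at h3
    exact h3.symm
  refine ⟨fun t => p.2 + ∫ s in (0 : ℝ)..t, φ s, by simp, h2, fun t ht => ?_⟩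
  have h4 : HasDerivAt (fun t => ∫ s in (0 : ℝ)..t, φ s) (φ t) t :=
    intervalIntegral.integral_hasDerivAt_right (hφ.intervalIntegrable _ _)
      hφ.stronglyMeasurable.stronglyMeasurableAtFilter hφ.continuousAt
  have h5 : φ t = A (p.2 + ∫ s in (0 : ℝ)..t, φ s) p.1 := by
    rw [h2 t ht]
    simp only [φ, clampTime_of_mem ht]
  rw [h5] at h4
  exact h4.const_add p.2

/-- Smooth dependence on parameters and initial values: near the parameter `0`, the equation
`y' = A(y) c` has a time-one map that is smooth in `(c, x)` jointly. -/
theorem exists_smooth_timeOne_map [CompleteSpace P] [FiniteDimensional ℝ V]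
    {A : V → P →L[ℝ] V} {O : Set V} (hO : IsOpen O) (hA : ContDiffOn ℝ ∞ A O) {x : V} (hx : x ∈ O) :
    ∃ (Φ : P × V → V) (N : Set (P × V)), IsOpen N ∧ (0, x) ∈ N ∧ ContDiffOn ℝ ∞ Φ N ∧
      ∀ p ∈ N, ∃ γ : ℝ → V, γ 0 = p.2 ∧ γ 1 = Φ p ∧
        ∀ t ∈ Icc (-2 : ℝ) 2, γ t ∈ O ∧ HasDerivAt γ (A (γ t) p.1) t := by
  have : CompleteSpace V := FiniteDimensional.complete ℝ V
  obtain ⟨g, hg, hgA⟩ := exists_contDiff_eventuallyEq hO hA hx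
  obtain ⟨O', hO', hO'o, hxO'⟩ := eventually_nhds_iff.1 (hgA.and (hO.mem_nhds hx))
  set g' : C(V, P →L[ℝ] V) := ⟨g, hg.continuous⟩
  obtain ⟨L, hL⟩ := hasFDerivAt_integralEquation hg x
  let S : Set ((P × V) × C(TimeInterval, V)) := {q | MapsTo q.2 univ O'}
  have hS : IsOpen S := (ContinuousMap.isOpen_setOfPred_mapsTo isCompact_univ hO'o).preimage
    continuous_snd
  obtain ⟨e, hae, heS, heG, hsymm⟩ := exists_smooth_localInverse hS
    (contDiff_integralEquation hg).contDiffOn (a := ((0, x), constMap x)) (fun t _ => hxO') hL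
  let j : P × V → (P × V) × C(TimeInterval, V) := fun p => (p, 0)
  have hj : ContDiff ℝ ∞ j := contDiff_id.prodMk contDiff_const
  have ha : integralEquation g' ((0, x), constMap x) = ((0, x), 0) := by
    refine Prod.ext rfl ?_
    ext t
    simp [integralEquation]
  let ev : C(TimeInterval, V) →L[ℝ] V :=
    ContinuousMap.evalCLM ℝ (⟨1, by norm_num, by norm_num⟩ : TimeInterval)
  refine ⟨fun p => ev (e.symm (j p)).2, j ⁻¹' e.target, e.open_target.preimage hj.continuous, ?_,
    ?_, ?_⟩
  · rw [mem_preimage]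
    have h1 := e.map_source hae
    rwa [heG, ha] at h1
  · exact ev.contDiff.comp_contDiffOn
      (contDiff_snd.comp_contDiffOn (hsymm.comp hj.contDiffOn fun p hp => hp))
  · intro p hp
    have h1 : integralEquation g' (e.symm (j p)) = (p, 0) := by
      rw [← heG]
      exact e.right_inv hp
    have h2 : (e.symm (j p)).1 = p := congrArg Prod.fst h1
    have h3 : integralEquation g' (p, (e.symm (j p)).2) = (p, 0) := by
      rw [← h1]
      exact congrArg _ (Prod.ext h2.symm rfl)
    obtain ⟨γ, hγ0, hγ, hγd⟩ := exists_isIntegralCurve_of_integralEquation g' h3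
    have hmem : ∀ t ∈ Icc (-2 : ℝ) 2, γ t ∈ O' := by
      intro t ht
      rw [hγ t ht]
      exact heS (e.map_target hp) (mem_univ _)
    refine ⟨γ, hγ0, hγ 1 (by norm_num), fun t ht => ⟨(hO' _ (hmem t ht)).2, ?_⟩⟩
    have h4 := hγd t ht
    have h5 : g' (γ t) = A (γ t) := (hO' _ (hmem t ht)).1
    rwa [h5] at h4

/-- Smooth dependence on parameters and initial values, with the time absorbed in the parameter:
`t ↦ Φ (t • c, y)` is the integral curve of `y' = A(y) c` that starts at `y`. -/
theorem exists_smooth_local_flow [CompleteSpace P] [FiniteDimensional ℝ V] {A : V → P →L[ℝ] V}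
    {O : Set V} (hO : IsOpen O) (hA : ContDiffOn ℝ ∞ A O) {x : V} (hx : x ∈ O) :
    ∃ (Φ : P × V → V) (δ : ℝ), 0 < δ ∧
      ContDiffOn ℝ ∞ Φ (Metric.ball 0 δ ×ˢ Metric.ball x δ) ∧
      ∀ c : P, ∀ y ∈ Metric.ball x δ, Φ (0, y) = y ∧ ∀ t : ℝ, t • c ∈ Metric.ball (0 : P) δ →
        Φ (t • c, y) ∈ O ∧
        HasDerivAt (fun t : ℝ => Φ (t • c, y)) (A (Φ (t • c, y)) c) t := by
  obtain ⟨K, O₁, hO₁, hLip⟩ := (((hA x hx).contDiffAt (hO.mem_nhds hx)).of_le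
    (by exact_mod_cast le_top : (1 : WithTop ℕ∞) ≤ ∞)).exists_lipschitzOnWith
  obtain ⟨O', hO'1, hO'o, hxO'⟩ := mem_nhds_iff.1 (Filter.inter_mem hO₁ (hO.mem_nhds hx))
  obtain ⟨Φ, N, hNo, hxN, hΦ, hN⟩ := exists_smooth_timeOne_map hO'o
    (hA.mono fun y hy => (hO'1 hy).2) hxO'
  obtain ⟨δ, hδ, hδN⟩ := Metric.mem_nhds_iff.1 (hNo.mem_nhds hxN)
  rw [← ball_prod_same] at hδN
  have hLipc : ∀ c : P, LipschitzOnWith (‖c‖₊ * K) (fun y => A y c) O' := by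
    intro c
    refine LipschitzOnWith.of_dist_le_mul fun y hy z hz => ?_
    rw [dist_eq_norm, ← sub_apply]
    refine (ContinuousLinearMap.le_opNorm _ _).trans ?_
    have h := hLip.dist_le_mul y (hO'1 hy).1 z (hO'1 hz).1
    rw [dist_eq_norm] at h
    calc ‖A y - A z‖ * ‖c‖ ≤ (K * dist y z) * ‖c‖ := by gcongr
      _ = _ := by rw [NNReal.coe_mul, coe_nnnorm]; ring
  -- the time-one map for the parameter `s • c` is the time-`s` point of the curve for `c`.
  have hscale : ∀ (c : P) (y : V) (γ γ' : ℝ → V) (s : ℝ), s ∈ Icc (-1 : ℝ) 1 → γ 0 = γ' 0 →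
      (∀ t ∈ Icc (-2 : ℝ) 2, γ t ∈ O' ∧ HasDerivAt γ (A (γ t) c) t) →
      (∀ t ∈ Icc (-2 : ℝ) 2, γ' t ∈ O' ∧ HasDerivAt γ' (A (γ' t) (s • c)) t) →
      γ' 1 = γ s := by
    intro c y γ γ' s hs h0 hγ hγ'
    have hst : ∀ t ∈ Icc (0 : ℝ) 1, s * t ∈ Icc (-2 : ℝ) 2 := by
      intro t ht
      obtain ⟨h1, h2⟩ := hs
      obtain ⟨h3, h4⟩ := ht
      constructor <;> nlinarith
    have hγs : ∀ t ∈ Icc (0 : ℝ) 1,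
        HasDerivAt (fun t => γ (s * t)) (A (γ (s * t)) (s • c)) t := by
      intro t ht
      have h1 := (hγ _ (hst t ht)).2.scomp t ((hasDerivAt_id t).const_mul s)
      simpa [Function.comp_def] using h1
    have hI : ∀ t ∈ Icc (0 : ℝ) 1, t ∈ Icc (-2 : ℝ) 2 := fun t ht =>
      ⟨by linarith [ht.1], by linarith [ht.2]⟩
    have h := ODE_solution_unique_of_mem_Icc_right (v := fun _ y => A y (s • c))
      (s := fun _ => O') (K := ‖s • c‖₊ * K) (f := γ') (g := fun t => γ (s * t)) (a := 0) (b := 1)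
      (fun t _ => hLipc _)
      (fun t ht => (hγ' t (hI t ht)).2.continuousAt.continuousWithinAt)
      (fun t ht => (hγ' t (hI t (Ico_subset_Icc_self ht))).2.hasDerivWithinAt)
      (fun t ht => (hγ' t (hI t (Ico_subset_Icc_self ht))).1)
      (fun t ht => (hγs t ht).continuousAt.continuousWithinAt)
      (fun t ht => (hγs t (Ico_subset_Icc_self ht)).hasDerivWithinAt)
      (fun t ht => (hγ _ (hst t (Ico_subset_Icc_self ht))).1)
      (by simp [h0])
    simpa using h (right_mem_Icc.2 zero_le_one)
  refine ⟨Φ, δ, hδ, hΦ.mono hδN, fun c y hy => ?_⟩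
  have key : ∀ t₀ : ℝ, t₀ • c ∈ Metric.ball (0 : P) δ → ∃ (l : ℝ) (γ : ℝ → V), |t₀| < l ∧
      γ 0 = y ∧ (∀ t ∈ Icc (-2 : ℝ) 2, γ t ∈ O' ∧ HasDerivAt γ (A (γ t) (l • c)) t) ∧
      ∀ t : ℝ, |t| < l → Φ (t • c, y) = γ (t / l) := by
    intro t₀ ht₀
    obtain ⟨l, hl, hlc⟩ : ∃ l : ℝ, |t₀| < l ∧ ‖l • c‖ < δ := by
      have h1 : ∀ᶠ l in 𝓝[>] |t₀|, ‖l • c‖ < δ := by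
        have hcont : Continuous fun l : ℝ => ‖l • c‖ := by fun_prop
        refine nhdsWithin_le_nhds (hcont.continuousAt.eventually (gt_mem_nhds ?_))
        simpa [norm_smul] using ht₀
      obtain ⟨l, h2, h3⟩ := (h1.and self_mem_nhdsWithin).exists
      exact ⟨l, h3, h2⟩
    have hl0 : 0 < l := (abs_nonneg _).trans_lt hl
    obtain ⟨γ, hγ0, -, hγ⟩ := hN (l • c, y) (hδN ⟨by simpa using hlc, hy⟩)
    refine ⟨l, γ, hl, hγ0, hγ, fun t ht => ?_⟩
    have htc : t • c ∈ Metric.ball (0 : P) δ := by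
      rw [mem_ball_zero_iff]
      refine lt_of_le_of_lt ?_ hlc
      rw [norm_smul, norm_smul, Real.norm_of_nonneg hl0.le]
      exact mul_le_mul_of_nonneg_right ht.le (norm_nonneg _)
    obtain ⟨γ', hγ'0, hγ'1, hγ'⟩ := hN (t • c, y) (hδN ⟨htc, hy⟩)
    have htl : t / l ∈ Icc (-1 : ℝ) 1 := by
      rw [mem_Icc, ← abs_le, abs_div, abs_of_pos hl0]
      exact (div_le_one hl0).2 ht.le
    rw [← hγ'1]
    refine hscale (l • c) y γ γ' (t / l) htl (by rw [hγ0, hγ'0]) hγ ?_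
    rwa [smul_smul, div_mul_cancel₀ _ hl0.ne']
  constructor
  · obtain ⟨l, γ, hl, hγ0, -, h⟩ := key 0 (by simpa using hδ)
    have h1 := h 0 hl
    rwa [zero_smul, zero_div, hγ0] at h1
  · intro t ht
    obtain ⟨l, γ, hl, -, hγ, h⟩ := key t ht
    have hl0 : 0 < l := (abs_nonneg _).trans_lt hl
    have htl : t / l ∈ Icc (-2 : ℝ) 2 := by
      rw [mem_Icc, ← abs_le, abs_div, abs_of_pos hl0]
      exact ((div_le_one hl0).2 hl.le).trans one_le_two
    rw [h t hl]
    refine ⟨(hO'1 (hγ _ htl).1).2, ?_⟩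
    have h1 := (hγ _ htl).2.scomp t ((hasDerivAt_id t).div_const l)
    rw [map_smul, smul_smul, one_div_mul_cancel hl0.ne', one_smul] at h1
    refine h1.congr_of_eventuallyEq ?_
    filter_upwards [(continuous_abs.tendsto t).eventually (gt_mem_nhds hl)] with s hs using h s hs

end ODE

/-! ### Lagrangian fibrations in coordinates -/

section Bilinear

variable {V : Type} [NormedAddCommGroup V] [NormedSpace ℝ V]

/-- An alternating 2-form as a bilinear form. -/
noncomputable def toBilin : (V [⋀^Fin 2]→L[ℝ] ℝ) →L[ℝ] V →L[ℝ] V →L[ℝ] ℝ :=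
  have upd₀ : ∀ x y z : V, Function.update ![x, y] 0 z = ![z, y] := fun x y z => by
    ext i; fin_cases i <;> simp
  have upd₁ : ∀ x y z : V, Function.update ![x, y] 1 z = ![x, z] := fun x y z => by
    ext i; fin_cases i <;> simp
  LinearMap.mkContinuous (E := V [⋀^Fin 2]→L[ℝ] ℝ) (F := V →L[ℝ] V →L[ℝ] ℝ)
    { toFun := fun η : V [⋀^Fin 2]→L[ℝ] ℝ => LinearMap.mkContinuous₂
        (LinearMap.mk₂ ℝ (fun a b => η ![a, b])
          (fun a a' b => by
            have := η.map_update_add ![a, b] 0 a a'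
            rwa [upd₀, upd₀, upd₀] at this)
          (fun r a b => by
            have := η.map_update_smul ![a, b] 0 r a
            rwa [upd₀, upd₀] at this)
          (fun a b b' => by
            have := η.map_update_add ![a, b] 1 b b'
            rwa [upd₁, upd₁, upd₁] at this)
          (fun r a b => by
            have := η.map_update_smul ![a, b] 1 r b
            rwa [upd₁, upd₁] at this)) ‖η‖ (fun a b => by
          have := η.le_opNorm ![a, b]
          simpa [Fin.prod_univ_two, mul_assoc] using this)
      map_add' := fun η η' => by ext a b; simp
      map_smul' := fun r η => by ext a b; simp } 1 (fun η => by
    rw [one_mul]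
    refine ContinuousLinearMap.opNorm_le_bound₂ _ (norm_nonneg η) fun a b => ?_
    have := η.le_opNorm ![a, b]
    simpa [Fin.prod_univ_two, mul_assoc] using this)

lemma hasFDerivAt_toBilin {U : Type} [NormedAddCommGroup U] [NormedSpace ℝ U]
    {θ : U → V [⋀^Fin 2]→L[ℝ] ℝ} {θ' : U →L[ℝ] V [⋀^Fin 2]→L[ℝ] ℝ} {x : U}
    (hθ : HasFDerivAt θ θ' x) : HasFDerivAt (fun y => toBilin (θ y)) (toBilin ∘L θ') x :=
  HasFDerivAt.comp (g := toBilin (V := V)) x (ContinuousLinearMap.hasFDerivAt _) hθ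

lemma contDiffAt_toBilin {U : Type} [NormedAddCommGroup U] [NormedSpace ℝ U]
    {θ : U → V [⋀^Fin 2]→L[ℝ] ℝ} {x : U}
    (hθ : ContDiffAt ℝ ∞ θ x) : ContDiffAt ℝ ∞ (fun y => toBilin (θ y)) x :=
  ContDiffAt.comp (g := toBilin (V := V)) x (ContinuousLinearMap.contDiff _).contDiffAt hθ

@[simp] lemma toBilin_apply (η : V [⋀^Fin 2]→L[ℝ] ℝ) (a b : V) : toBilin η a b = η ![a, b] := rfl

lemma minSmoothness_le_infty : minSmoothness ℝ 2 ≤ ∞ := by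
  rw [minSmoothness_of_isRCLikeNormedField]
  exact ENat.LEInfty.out

lemma form_self (η : V [⋀^Fin 2]→L[ℝ] ℝ) (a : V) : η ![a, a] = 0 :=
  η.map_eq_zero_of_eq ![a, a] (i := 0) (j := 1) (by simp) (by simp)

lemma form_swap (η : V [⋀^Fin 2]→L[ℝ] ℝ) (a b : V) : η ![a, b] = -η ![b, a] := by
  have h := form_self η (a + b)
  simp only [← toBilin_apply, map_add, add_apply] at h ⊢
  simp only [toBilin_apply, form_self] at h ⊢
  linarith

/-- The cocycle identity for the derivative of a closed 2-form. -/
lemma fderiv_closed {θ : V → V [⋀^Fin 2]→L[ℝ] ℝ} {x : V} (hθ : DifferentiableAt ℝ θ x)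
    (hd : extDeriv θ x = 0) (p q r : V) :
    fderiv ℝ θ x p ![q, r] - fderiv ℝ θ x q ![p, r] + fderiv ℝ θ x r ![p, q] = 0 := by
  have h := extDeriv_apply hθ ![p, q, r]
  rw [hd] at h
  have h2 : ∀ (a b u : V), fderiv ℝ (fun y => θ y ![a, b]) x u = fderiv ℝ θ x u ![a, b] := by
    intro a b u
    have h3 : HasFDerivAt (fun y => toBilin (θ y) a b) _ x :=
      ((hasFDerivAt_toBilin hθ.hasFDerivAt).clm_apply (hasFDerivAt_const a x)).clm_apply
        (hasFDerivAt_const b x)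
    have h4 := h3.fderiv
    simp only [toBilin_apply] at h4
    rw [h4]
    simp [toBilin_apply]
  have e0 : (0 : Fin 3).removeNth ![p, q, r] = ![q, r] := by ext i; fin_cases i <;> rfl
  have e1 : (1 : Fin 3).removeNth ![p, q, r] = ![p, r] := by ext i; fin_cases i <;> rfl
  have e2 : (2 : Fin 3).removeNth ![p, q, r] = ![p, q] := by ext i; fin_cases i <;> rfl
  rw [Fin.sum_univ_three, e0, e1, e2] at h
  simp only [h2] at h
  simp at h
  linarith

end Bilinear

/-- The expression in coordinates of a Lagrangian fibration: a symplectic form `θ` on an open subset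
`W` of the model space and a map `h` with isotropic kernel at the points, dense in `W`, where it is
a submersion. -/
structure IsLagrangianModel {n : ℕ} (W : Set (E (2 * n)))
    (θ : E (2 * n) → (E (2 * n)) [⋀^Fin 2]→L[ℝ] ℝ) (h : E (2 * n) → E n) : Prop where
  isOpen : IsOpen W
  smooth_form : ContDiffOn ℝ ∞ θ W
  closed : ∀ y ∈ W, extDeriv θ y = 0
  nondegenerate : ∀ y ∈ W, ∀ a, (∀ b, θ y ![a, b] = 0) → a = 0
  smooth_proj : ContDiffOn ℝ ∞ h W
  dense : ∀ y ∈ W, ∃ᶠ z in 𝓝 y, Function.Surjective (fderiv ℝ h z)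
  lagrangian : ∀ y ∈ W, Function.Surjective (fderiv ℝ h y) → ∀ a b, fderiv ℝ h y a = 0 →
    fderiv ℝ h y b = 0 → θ y ![a, b] = 0

/-- The Hamiltonian vector field, in coordinates, of the function `c ∘ h`, as a linear function of
the covector `c`. -/
noncomputable def hamVec {n : ℕ} (θ : E (2 * n) → (E (2 * n)) [⋀^Fin 2]→L[ℝ] ℝ)
    (h : E (2 * n) → E n) (y : E (2 * n)) : (E n →L[ℝ] ℝ) →L[ℝ] E (2 * n) :=
  (toBilin (θ y)).inverse ∘L
    (ContinuousLinearMap.compL ℝ (E (2 * n)) (E n) ℝ).flip (fderiv ℝ h y)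

/-- The kernel of a surjection from a symplectic vector space onto a space of half the dimension is
its own orthogonal if it is isotropic. -/
lemma mem_ker_of_orthogonal {n : ℕ} {η : (E (2 * n)) [⋀^Fin 2]→L[ℝ] ℝ}
    (hη : ∀ a, (∀ b, η ![a, b] = 0) → a = 0) {D : E (2 * n) →L[ℝ] E n}
    (hD : Function.Surjective D) (hiso : ∀ a b, D a = 0 → D b = 0 → η ![a, b] = 0)
    {v : E (2 * n)} (hv : ∀ w, D w = 0 → η ![v, w] = 0) : D v = 0 := by
  let Bf : LinearMap.BilinForm ℝ (E (2 * n)) :=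
    LinearMap.mk₂ ℝ (fun a b => toBilin η a b) (fun a a' b => by simp only [map_add, add_apply])
      (fun r a b => by simp only [map_smul, smul_apply])
      (fun a b b' => by simp only [map_add]) (fun r a b => by simp only [map_smul])
  have hBf : ∀ a b, Bf a b = η ![a, b] := fun a b => rfl
  have hnd : Bf.Nondegenerate := by
    constructor
    · intro a ha
      exact hη a ha
    · intro a ha
      refine hη a fun b => ?_
      rw [form_swap, ← hBf, ha b, neg_zero]
  let N : Submodule ℝ (E (2 * n)) := LinearMap.ker D.toLinearMap
  have hle : N ≤ Bf.orthogonal N := fun a ha b hb => hiso b a hb ha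
  have hN : Module.finrank ℝ N + n = 2 * n := by
    have h1 := LinearMap.finrank_range_add_finrank_ker D.toLinearMap
    rw [LinearMap.range_eq_top.2 hD, finrank_top] at h1
    simp only [finrank_euclideanSpace_fin] at h1
    change Module.finrank ℝ (LinearMap.ker D.toLinearMap) + n = 2 * n
    omega
  have hfin : Module.finrank ℝ N = Module.finrank ℝ (Bf.orthogonal N) := by
    rw [LinearMap.BilinForm.finrank_orthogonal hnd, finrank_euclideanSpace_fin]
    omega
  have heq := Submodule.eq_of_le_of_finrank_eq hle hfin
  have hmem : v ∈ N := by
    rw [heq]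
    intro b hb
    change Bf b v = 0
    rw [hBf, form_swap, hv b hb, neg_zero]
  exact hmem

namespace IsLagrangianModel

variable {n : ℕ} {W : Set (E (2 * n))} {θ : E (2 * n) → (E (2 * n)) [⋀^Fin 2]→L[ℝ] ℝ}
  {h : E (2 * n) → E n} (M : IsLagrangianModel W θ h)

include M

lemma exists_equiv {y : E (2 * n)} (hy : y ∈ W) :
    ∃ L : E (2 * n) ≃L[ℝ] (E (2 * n) →L[ℝ] ℝ),
      (L : E (2 * n) →L[ℝ] (E (2 * n) →L[ℝ] ℝ)) = toBilin (θ y) := by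
  have hinj : Function.Injective (toBilin (θ y)).toLinearMap := by
    rw [← LinearMap.ker_eq_bot, LinearMap.ker_eq_bot']
    intro a ha
    exact M.nondegenerate y hy a fun b => congrArg (fun l : E (2 * n) →L[ℝ] ℝ => l b) ha
  have hdim : Module.finrank ℝ (E (2 * n)) = Module.finrank ℝ (E (2 * n) →L[ℝ] ℝ) :=
    (InnerProductSpace.toDual ℝ (E (2 * n))).toLinearEquiv.finrank_eq
  refine ⟨(LinearEquiv.ofInjectiveOfFinrankEq _ hinj hdim).toContinuousLinearEquiv, ?_⟩
  ext a b
  rfl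

lemma hamVec_spec {y : E (2 * n)} (hy : y ∈ W) (c : E n →L[ℝ] ℝ) (w : E (2 * n)) :
    θ y ![hamVec θ h y c, w] = c (fderiv ℝ h y w) := by
  obtain ⟨L, hL⟩ := M.exists_equiv hy
  have h1 : hamVec θ h y c = L.symm (c ∘L fderiv ℝ h y) := by
    simp [hamVec, ← hL]
  rw [← toBilin_apply, ← hL, h1]
  simp

lemma eq_hamVec {y : E (2 * n)} (hy : y ∈ W) {c : E n →L[ℝ] ℝ} {v : E (2 * n)}
    (hv : ∀ w, θ y ![v, w] = c (fderiv ℝ h y w)) : v = hamVec θ h y c := by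
  rw [← sub_eq_zero]
  refine M.nondegenerate y hy _ fun b => ?_
  rw [← toBilin_apply, map_sub, sub_apply, toBilin_apply, toBilin_apply, hv, M.hamVec_spec hy,
    sub_self]

lemma contDiffOn_hamVec : ContDiffOn ℝ ∞ (hamVec θ h) W := by
  intro y hy
  obtain ⟨L, hL⟩ := M.exists_equiv hy
  have h1 : ContDiffAt ℝ ∞ (fun y => toBilin (θ y)) y :=
    contDiffAt_toBilin ((M.smooth_form y hy).contDiffAt (M.isOpen.mem_nhds hy))
  have h2 : ContDiffAt ℝ ∞ (fun y => (toBilin (θ y)).inverse) y := by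
    refine ContDiffAt.comp y (g := ContinuousLinearMap.inverse) ?_ h1
    rw [← hL]
    exact contDiffAt_map_inverse L
  have h3 : ContDiffAt ℝ ∞ (fderiv ℝ h) y :=
    ((M.smooth_proj y hy).contDiffAt (M.isOpen.mem_nhds hy)).fderiv_right (by simp)
  exact (h2.clm_comp (contDiffAt_const.clm_apply h3)).contDiffWithinAt

/-- The Hamiltonian vector fields of functions pulled back from the base are tangent to the fibres:
on the dense set of regular points because the fibres are Lagrangian, elsewhere by continuity. -/
lemma fderiv_hamVec {y : E (2 * n)} (hy : y ∈ W) (c : E n →L[ℝ] ℝ) :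
    fderiv ℝ h y (hamVec θ h y c) = 0 := by
  by_contra hne
  have hcont : ContinuousAt (fun z => fderiv ℝ h z (hamVec θ h z c)) y := by
    have h1 : ContDiffAt ℝ ∞ (fderiv ℝ h) y :=
      ((M.smooth_proj y hy).contDiffAt (M.isOpen.mem_nhds hy)).fderiv_right (by simp)
    have h2 := (M.contDiffOn_hamVec y hy).contDiffAt (M.isOpen.mem_nhds hy)
    exact h1.continuousAt.clm_apply (h2.continuousAt.clm_apply continuousAt_const)
  have hev := (hcont.eventually_ne hne).and (M.isOpen.mem_nhds hy)
  obtain ⟨z, hz1, hz2, hz3⟩ := ((M.dense y hy).and_eventually hev).exists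
  refine hz2 (mem_ker_of_orthogonal (M.nondegenerate z hz3) hz1 (M.lagrangian z hz3 hz1) ?_)
  intro w hw
  rw [M.hamVec_spec hz3, hw, map_zero]

/-- The Lie derivative of `θ` along the Hamiltonian vector field vanishes. -/
lemma lieDeriv_hamVec {y : E (2 * n)} (hy : y ∈ W) (c : E n →L[ℝ] ℝ) (u w : E (2 * n)) :
    fderiv ℝ θ y (hamVec θ h y c) ![u, w] +
      θ y ![fderiv ℝ (fun z => hamVec θ h z c) y u, w] +
      θ y ![u, fderiv ℝ (fun z => hamVec θ h z c) y w] = 0 := by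
  have hθ : DifferentiableAt ℝ θ y :=
    ((M.smooth_form y hy).contDiffAt (M.isOpen.mem_nhds hy)).differentiableAt (by simp)
  have hh : ContDiffAt ℝ ∞ h y := (M.smooth_proj y hy).contDiffAt (M.isOpen.mem_nhds hy)
  have hh' : DifferentiableAt ℝ (fderiv ℝ h) y :=
    (hh.fderiv_right (m := ∞) (by simp)).differentiableAt (by simp)
  have hX : DifferentiableAt ℝ (fun z => hamVec θ h z c) y :=
    (((M.contDiffOn_hamVec y hy).contDiffAt (M.isOpen.mem_nhds hy)).clm_apply
      contDiffAt_const).differentiableAt (by simp)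
  -- differentiate the defining identity of the Hamiltonian vector field.
  have key : ∀ p q, fderiv ℝ θ y p ![hamVec θ h y c, q] +
      θ y ![fderiv ℝ (fun z => hamVec θ h z c) y p, q] = c (fderiv ℝ (fderiv ℝ h) y p q) := by
    intro p q
    have h1 : HasFDerivAt (fun z => toBilin (θ z) (hamVec θ h z c) q) _ y :=
      ((hasFDerivAt_toBilin hθ.hasFDerivAt).clm_apply hX.hasFDerivAt).clm_apply
        (hasFDerivAt_const q y)
    have h2 : HasFDerivAt (fun z => c (fderiv ℝ h z q)) _ y :=
      c.hasFDerivAt.comp y (hh'.hasFDerivAt.clm_apply (hasFDerivAt_const q y))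
    have h3 : (fun z => toBilin (θ z) (hamVec θ h z c) q) =ᶠ[𝓝 y]
        fun z => c (fderiv ℝ h z q) := by
      filter_upwards [M.isOpen.mem_nhds hy] with z hz using M.hamVec_spec hz c q
    have h4 := congrArg (fun l : E (2 * n) →L[ℝ] ℝ => l p) (h1.unique (h2.congr_of_eventuallyEq h3))
    simp at h4
    linarith
  have hsymm : fderiv ℝ (fderiv ℝ h) y u w = fderiv ℝ (fderiv ℝ h) y w u :=
    (hh.isSymmSndFDerivAt minSmoothness_le_infty) u w
  have h1 := key u w
  have h2 := key w u
  have h3 := fderiv_closed hθ (M.closed y hy) (hamVec θ h y c) u w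
  rw [hsymm] at h1
  rw [form_swap (θ y) u]
  linarith

end IsLagrangianModel

section Variation

variable {V : Type} [NormedAddCommGroup V] [NormedSpace ℝ V]

lemma hasFDerivAt_apply_const {U U' : Type} [NormedAddCommGroup U] [NormedSpace ℝ U]
    [NormedAddCommGroup U'] [NormedSpace ℝ U'] {G : U → U' →L[ℝ] V} {G' : U →L[ℝ] U' →L[ℝ] V}
    {x : U} (hG : HasFDerivAt G G' x) (w : U') : HasFDerivAt (fun q => G q w) (G'.flip w) x :=
  HasFDerivAt.comp (g := ContinuousLinearMap.apply ℝ V w) x (ContinuousLinearMap.hasFDerivAt _) hG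

/-- The variational equation of a flow, by symmetry of the second derivative. -/
lemma hasDerivAt_variation {ψ : ℝ × V → V} {X : V → V} {t : ℝ} {y : V}
    (hψ : ContDiffAt ℝ ∞ ψ (t, y)) (hX : DifferentiableAt ℝ X (ψ (t, y)))
    (htime : (fun q => fderiv ℝ ψ q (1, 0)) =ᶠ[𝓝 (t, y)] fun q => X (ψ q)) (v : V) :
    HasDerivAt (fun t : ℝ => fderiv ℝ ψ (t, y) (0, v))
      (fderiv ℝ X (ψ (t, y)) (fderiv ℝ ψ (t, y) (0, v))) t := by
  set ψ'' := fderiv ℝ (fderiv ℝ ψ) (t, y) with hψ''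
  have hd : HasFDerivAt (fderiv ℝ ψ) ψ'' (t, y) :=
    ((hψ.fderiv_right (m := ∞) (by simp)).differentiableAt (by simp)).hasFDerivAt
  have happ : ∀ w : ℝ × V, HasFDerivAt (fun q => fderiv ℝ ψ q w) (ψ''.flip w) (t, y) :=
    fun w => hasFDerivAt_apply_const hd w
  have h1 : HasDerivAt (fun t : ℝ => fderiv ℝ ψ (t, y) (0, v)) (ψ''.flip (0, v) (1, 0)) t :=
    HasFDerivAt.comp_hasDerivAt (l := fun q => fderiv ℝ ψ q (0, v)) (f := fun t => (t, y)) t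
      (happ (0, v)) ((hasDerivAt_id t).prodMk (hasDerivAt_const t y))
  have hsymm : ψ'' (1, 0) (0, v) = ψ'' (0, v) (1, 0) :=
    (hψ.isSymmSndFDerivAt minSmoothness_le_infty) _ _
  have h3 : HasFDerivAt (fun q => X (ψ q)) (fderiv ℝ X (ψ (t, y)) ∘L fderiv ℝ ψ (t, y)) (t, y) :=
    hX.hasFDerivAt.comp (t, y) (hψ.differentiableAt (by simp)).hasFDerivAt
  have h4 := (happ (1, 0)).unique (h3.congr_of_eventuallyEq htime)
  have h5 : ψ'' (0, v) (1, 0) = fderiv ℝ X (ψ (t, y)) (fderiv ℝ ψ (t, y) (0, v)) :=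
    congrArg (fun l : ℝ × V →L[ℝ] V => l (0, v)) h4
  rw [← h5, ← hsymm]
  exact h1

lemma hasDerivAt_form_zero {θ : V → V [⋀^Fin 2]→L[ℝ] ℝ} {g a b : ℝ → V} {t : ℝ} {g' a' b' : V}
    (hθ : DifferentiableAt ℝ θ (g t)) (hg : HasDerivAt g g' t) (ha : HasDerivAt a a' t)
    (hb : HasDerivAt b b' t)
    (h0 : fderiv ℝ θ (g t) g' ![a t, b t] + θ (g t) ![a', b t] + θ (g t) ![a t, b'] = 0) :
    HasDerivAt (fun t => toBilin (θ (g t)) (a t) (b t)) 0 t := by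
  have h1 : HasDerivAt (fun t => toBilin (θ (g t))) (toBilin (fderiv ℝ θ (g t) g')) t :=
    HasFDerivAt.comp_hasDerivAt (l := fun y => toBilin (θ y)) t
      (hasFDerivAt_toBilin hθ.hasFDerivAt) hg
  have h2 := (h1.clm_apply ha).clm_apply hb
  rw [← h0]
  exact h2

end Variation

namespace IsLagrangianModel

variable {n : ℕ} {W : Set (E (2 * n))} {θ : E (2 * n) → (E (2 * n)) [⋀^Fin 2]→L[ℝ] ℝ}
  {h : E (2 * n) → E n} (M : IsLagrangianModel W θ h)

/-- A function on the real line with vanishing derivative on the unit interval takes the same value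
at its end points. -/
lemma _root_.LagrangianFib.eq_of_hasDerivAt_zero {V : Type} [NormedAddCommGroup V]
    [NormedSpace ℝ V] {g : ℝ → V} (hg : ∀ t ∈ Icc (0 : ℝ) 1, HasDerivAt g 0 t) : g 1 = g 0 :=
  constant_of_has_deriv_right_zero (fun t ht => (hg t ht).continuousAt.continuousWithinAt)
    (fun t ht => (hg t (Ico_subset_Icc_self ht)).hasDerivWithinAt) 1
    (right_mem_Icc.2 zero_le_one)

lemma _root_.LagrangianFib.smul_mem_ball {P : Type} [NormedAddCommGroup P] [NormedSpace ℝ P]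
    {c : P} {δ : ℝ} (hc : c ∈ Metric.ball (0 : P) δ) {t : ℝ} (ht : t ∈ Icc (0 : ℝ) 1) :
    t • c ∈ Metric.ball (0 : P) δ := by
  rw [mem_ball_zero_iff] at hc ⊢
  rw [norm_smul, Real.norm_of_nonneg ht.1]
  exact (mul_le_of_le_one_left (norm_nonneg _) ht.2).trans_lt hc

include M

variable {Φ : (E n →L[ℝ] ℝ) × E (2 * n) → E (2 * n)} {δ : ℝ} {x : E (2 * n)}
  (hΦ : ContDiffOn ℝ ∞ Φ (Metric.ball 0 δ ×ˢ Metric.ball x δ))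
  (hflow : ∀ c : E n →L[ℝ] ℝ, ∀ y ∈ Metric.ball x δ, Φ (0, y) = y ∧ ∀ t : ℝ,
    t • c ∈ Metric.ball (0 : E n →L[ℝ] ℝ) δ → Φ (t • c, y) ∈ W ∧
      HasDerivAt (fun t : ℝ => Φ (t • c, y)) (hamVec θ h (Φ (t • c, y)) c) t)

include hflow in
lemma proj_flow {c : E n →L[ℝ] ℝ} (hc : c ∈ Metric.ball (0 : E n →L[ℝ] ℝ) δ) {y : E (2 * n)}
    (hy : y ∈ Metric.ball x δ) : h (Φ (c, y)) = h y := by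
  have h1 : ∀ t ∈ Icc (0 : ℝ) 1, HasDerivAt (fun t : ℝ => h (Φ (t • c, y))) 0 t := by
    intro t ht
    obtain ⟨h2, h3⟩ := (hflow c y hy).2 t (smul_mem_ball hc ht)
    have h4 : HasFDerivAt h (fderiv ℝ h (Φ (t • c, y))) (Φ (t • c, y)) :=
      (((M.smooth_proj _ h2).contDiffAt (M.isOpen.mem_nhds h2)).differentiableAt
        (by simp)).hasFDerivAt
    have h5 := h4.comp_hasDerivAt t h3
    rwa [M.fderiv_hamVec h2] at h5
  have h6 := eq_of_hasDerivAt_zero h1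
  simpa [(hflow c y hy).1] using h6

include hΦ hflow in
/-- The flow of a Hamiltonian vector field preserves the symplectic form. -/
lemma form_flow {c : E n →L[ℝ] ℝ} (hc : c ∈ Metric.ball (0 : E n →L[ℝ] ℝ) δ) {y : E (2 * n)}
    (hy : y ∈ Metric.ball x δ) (u w : E (2 * n)) :
    θ (Φ (c, y)) ![fderiv ℝ (fun z => Φ (c, z)) y u, fderiv ℝ (fun z => Φ (c, z)) y w] =
      θ y ![u, w] := by
  let ψ : ℝ × E (2 * n) → E (2 * n) := fun q => Φ (q.1 • c, q.2)
  let S : Set (ℝ × E (2 * n)) := (fun q => (q.1 • c, q.2)) ⁻¹' (Metric.ball 0 δ ×ˢ Metric.ball x δ)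
  have hj : ContDiff ℝ ∞ (fun q : ℝ × E (2 * n) => (q.1 • c, q.2)) := by
    fun_prop
  have hS : IsOpen S := (Metric.isOpen_ball.prod Metric.isOpen_ball).preimage hj.continuous
  have hψ : ContDiffOn ℝ ∞ ψ S := hΦ.comp hj.contDiffOn fun q hq => hq
  have hψat : ∀ q ∈ S, ContDiffAt ℝ ∞ ψ q := fun q hq => (hψ q hq).contDiffAt (hS.mem_nhds hq)
  have hmem : ∀ t ∈ Icc (0 : ℝ) 1, (t, y) ∈ S := fun t ht => ⟨smul_mem_ball hc ht, hy⟩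
  have htime : ∀ q ∈ S, ψ q ∈ W ∧ fderiv ℝ ψ q (1, 0) = hamVec θ h (ψ q) c := by
    intro q hq
    obtain ⟨h2, h3⟩ := (hflow c q.2 hq.2).2 q.1 hq.1
    refine ⟨h2, ?_⟩
    have h4 : HasFDerivAt ψ (fderiv ℝ ψ q) (q.1, q.2) :=
      ((hψat q hq).differentiableAt (by simp)).hasFDerivAt
    have h5 := h4.comp_hasDerivAt q.1 ((hasDerivAt_id q.1).prodMk (hasDerivAt_const q.1 q.2))
    exact h5.unique h3
  have hspace : ∀ q ∈ S, ∀ v, fderiv ℝ (fun z => Φ (q.1 • c, z)) q.2 v = fderiv ℝ ψ q (0, v) := by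
    intro q hq v
    have h4 : HasFDerivAt ψ (fderiv ℝ ψ q) (q.1, q.2) :=
      ((hψat q hq).differentiableAt (by simp)).hasFDerivAt
    have h5 := h4.comp q.2 ((hasFDerivAt_const q.1 q.2).prodMk (hasFDerivAt_id q.2))
    have h6 : fderiv ℝ (fun z => Φ (q.1 • c, z)) q.2 = _ := h5.fderiv
    rw [h6]
    simp
  have hvar : ∀ t ∈ Icc (0 : ℝ) 1, ∀ v, HasDerivAt (fun t : ℝ => fderiv ℝ ψ (t, y) (0, v))
      (fderiv ℝ (fun z => hamVec θ h z c) (ψ (t, y)) (fderiv ℝ ψ (t, y) (0, v))) t := by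
    intro t ht v
    have hq := hmem t ht
    have hX : DifferentiableAt ℝ (fun z => hamVec θ h z c) (ψ (t, y)) := by
      have hw := (htime _ hq).1
      exact (((M.contDiffOn_hamVec _ hw).contDiffAt (M.isOpen.mem_nhds hw)).clm_apply
        contDiffAt_const).differentiableAt (by simp)
    refine hasDerivAt_variation (hψat _ hq) hX ?_ v
    filter_upwards [hS.mem_nhds hq] with q hq using (htime q hq).2
  have hconst : ∀ t ∈ Icc (0 : ℝ) 1, HasDerivAt (fun t : ℝ =>
      toBilin (θ (ψ (t, y))) (fderiv ℝ ψ (t, y) (0, u)) (fderiv ℝ ψ (t, y) (0, w))) 0 t := by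
    intro t ht
    have hq := hmem t ht
    obtain ⟨h2, h3⟩ := (hflow c y hy).2 t (smul_mem_ball hc ht)
    exact hasDerivAt_form_zero (((M.smooth_form _ h2).contDiffAt
      (M.isOpen.mem_nhds h2)).differentiableAt (by simp)) h3 (hvar t ht u) (hvar t ht w)
      (M.lieDeriv_hamVec h2 c (fderiv ℝ ψ (t, y) (0, u)) (fderiv ℝ ψ (t, y) (0, w)))
  have hfin := eq_of_hasDerivAt_zero hconst
  have h0 : ((0 : ℝ), y) ∈ S := hmem 0 (left_mem_Icc.2 zero_le_one)
  have h1 : ((1 : ℝ), y) ∈ S := hmem 1 (right_mem_Icc.2 zero_le_one)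
  have hid : fderiv ℝ (fun z => Φ ((0 : ℝ) • c, z)) y = ContinuousLinearMap.id ℝ _ := by
    have h7 : (fun z => Φ ((0 : ℝ) • c, z)) =ᶠ[𝓝 y] id := by
      filter_upwards [Metric.isOpen_ball.mem_nhds hy] with z hz
      rw [zero_smul]
      exact (hflow c z hz).1
    rw [h7.fderiv_eq, fderiv_id]
  rw [← hspace _ h1, ← hspace _ h1, ← hspace _ h0, ← hspace _ h0] at hfin
  simp only [hid] at hfin
  simpa [ψ, (hflow c y hy).1] using hfin

end IsLagrangianModel

/-! ### Derivatives of maps of manifolds -/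

section Derivative

variable {V₁ V₂ V₃ : Type} [NormedAddCommGroup V₁] [NormedSpace ℝ V₁] [NormedAddCommGroup V₂]
  [NormedSpace ℝ V₂] [NormedAddCommGroup V₃] [NormedSpace ℝ V₃]
  {M₁ M₂ M₃ : Type*} [TopologicalSpace M₁] [ChartedSpace V₁ M₁] [TopologicalSpace M₂]
  [ChartedSpace V₂ M₂] [TopologicalSpace M₃] [ChartedSpace V₃ M₃]

/-- The manifold derivative, as a linear map of the model spaces. -/
noncomputable def D (f : M₁ → M₂) (x : M₁) : V₁ →L[ℝ] V₂ := mfderiv 𝓘(ℝ, V₁) 𝓘(ℝ, V₂) f x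

/-- Smoothness at a point, for manifolds modelled on vector spaces. -/
abbrev SmoothAt (f : M₁ → M₂) (x : M₁) : Prop := ContMDiffAt 𝓘(ℝ, V₁) 𝓘(ℝ, V₂) ∞ f x

lemma SmoothAt.mdiff {f : M₁ → M₂} {x : M₁} (hf : SmoothAt (V₁ := V₁) (V₂ := V₂) f x) :
    MDifferentiableAt 𝓘(ℝ, V₁) 𝓘(ℝ, V₂) f x := hf.mdifferentiableAt (by simp)

lemma D_comp {g : M₂ → M₃} {f : M₁ → M₂} {x : M₁}
    (hg : MDifferentiableAt 𝓘(ℝ, V₂) 𝓘(ℝ, V₃) g (f x))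
    (hf : MDifferentiableAt 𝓘(ℝ, V₁) 𝓘(ℝ, V₂) f x) :
    (D (fun y => g (f y)) x : V₁ →L[ℝ] V₃) = (D g (f x) : V₂ →L[ℝ] V₃) ∘L (D f x : V₁ →L[ℝ] V₂) :=
  mfderiv_comp x hg hf

lemma D_comp_apply {g : M₂ → M₃} {f : M₁ → M₂} {x : M₁}
    (hg : MDifferentiableAt 𝓘(ℝ, V₂) 𝓘(ℝ, V₃) g (f x))
    (hf : MDifferentiableAt 𝓘(ℝ, V₁) 𝓘(ℝ, V₂) f x) (u : V₁) :
    (D (fun y => g (f y)) x : V₁ →L[ℝ] V₃) u =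
      (D g (f x) : V₂ →L[ℝ] V₃) ((D f x : V₁ →L[ℝ] V₂) u) := by
  rw [D_comp hg hf]; rfl

lemma D_congr {f g : M₁ → M₂} {x : M₁} (h : f =ᶠ[𝓝 x] g) :
    (D f x : V₁ →L[ℝ] V₂) = D g x := h.mfderiv_eq

lemma D_eq_fderiv (f : V₁ → V₂) (x : V₁) : (D f x : V₁ →L[ℝ] V₂) = fderiv ℝ f x := mfderiv_eq_fderiv

lemma D_id (x : M₁) : (D (fun y : M₁ => y) x : V₁ →L[ℝ] V₁) = ContinuousLinearMap.id ℝ V₁ :=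
  mfderiv_id

lemma D_id_apply {f : M₁ → M₁} {x : M₁} (h : ∀ᶠ y in 𝓝 x, f y = y) (u : V₁) :
    (D f x : V₁ →L[ℝ] V₁) u = u := by
  rw [D_congr (g := fun y => y) h, D_id]; rfl

/-- The curve `γ` has the velocity vector `V` at the time `t`. -/
def HasVelocity (γ : ℝ → M₁) (t : ℝ) (V : V₁) : Prop :=
  HasMFDerivAt 𝓘(ℝ, ℝ) 𝓘(ℝ, V₁) γ t ((1 : ℝ →L[ℝ] ℝ).smulRight V)

lemma HasVelocity.continuousAt {γ : ℝ → M₁} {t : ℝ} {V : V₁} (h : HasVelocity γ t V) :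
    ContinuousAt γ t := HasMFDerivAt.continuousAt h

lemma hasVelocity_iff {g : ℝ → V₁} {t : ℝ} {V : V₁} : HasVelocity g t V ↔ HasDerivAt g V t := by
  have h : (1 : ℝ →L[ℝ] ℝ).smulRight V = ContinuousLinearMap.toSpanSingleton ℝ V := by
    ext; simp
  unfold HasVelocity
  rw [hasDerivAt_iff_hasFDerivAt, ← h]
  exact hasMFDerivAt_iff_hasFDerivAt

lemma HasVelocity.congr {γ γ' : ℝ → M₁} {t : ℝ} {V : V₁} (h : HasVelocity γ t V)
    (h' : γ' =ᶠ[𝓝 t] γ) : HasVelocity γ' t V := by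
  have h1 := HasMFDerivAt.congr_of_eventuallyEq (f := γ) (f₁ := γ') (x := t) h h'
  exact h1

lemma HasVelocity.map {γ : ℝ → M₁} {t : ℝ} {V : V₁} (h : HasVelocity γ t V) {φ : M₁ → M₂}
    (hφ : MDifferentiableAt 𝓘(ℝ, V₁) 𝓘(ℝ, V₂) φ (γ t)) :
    HasVelocity (fun t => φ (γ t)) t ((D φ (γ t) : V₁ →L[ℝ] V₂) V) := by
  have h1 := HasMFDerivAt.comp (g := φ) t hφ.hasMFDerivAt h
  have h2 : (1 : ℝ →L[ℝ] ℝ).smulRight ((D φ (γ t) : V₁ →L[ℝ] V₂) V) =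
      (D φ (γ t) : V₁ →L[ℝ] V₂) ∘L (1 : ℝ →L[ℝ] ℝ).smulRight V := by
    ext; simp
  exact (congrArg (fun L : ℝ →L[ℝ] V₂ => HasMFDerivAt 𝓘(ℝ, ℝ) 𝓘(ℝ, V₂) (fun t => φ (γ t)) t L)
    h2).mpr h1

lemma HasVelocity.scomp {γ : ℝ → M₁} {f : ℝ → ℝ} {t r : ℝ} {V : V₁} (h : HasVelocity γ (f t) V)
    (hf : HasDerivAt f r t) : HasVelocity (fun t => γ (f t)) t (r • V) := by
  have h1 := HasMFDerivAt.comp (g := γ) t h hf.hasFDerivAt.hasMFDerivAt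
  have h2 : (1 : ℝ →L[ℝ] ℝ).smulRight (r • V) =
      (1 : ℝ →L[ℝ] ℝ).smulRight V ∘L ContinuousLinearMap.toSpanSingleton ℝ r := by
    ext; simp
  exact (congrArg (fun L : ℝ →L[ℝ] V₁ => HasMFDerivAt 𝓘(ℝ, ℝ) 𝓘(ℝ, V₁) (fun t => γ (f t)) t L)
    h2).mpr h1

/-- Smoothness in a parameter and a point, read off in a chart. -/
lemma contMDiffAt_prod_of_chart {P : Type} [NormedAddCommGroup P] [NormedSpace ℝ P]
    {ε : M₁ → V₂} {Φ : P × V₂ → V₂} {ε' : V₂ → M₃} {c : P} {x : M₁}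
    (hε : SmoothAt (V₁ := V₁) (V₂ := V₂) ε x) (hΦ : ContDiffAt ℝ ∞ Φ (c, ε x))
    (hε' : SmoothAt (V₁ := V₂) (V₂ := V₃) ε' (Φ (c, ε x))) :
    ContMDiffAt (𝓘(ℝ, P).prod 𝓘(ℝ, V₁)) 𝓘(ℝ, V₃) ∞
      (fun p : P × M₁ => ε' (Φ (p.1, ε p.2))) (c, x) := by
  have h0 : ContMDiffAt (𝓘(ℝ, P).prod 𝓘(ℝ, V₁)) 𝓘(ℝ, V₂) ∞ (fun p : P × M₁ => ε p.2) (c, x) :=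
    ContMDiffAt.comp (g := ε) (f := Prod.snd) (c, x) hε contMDiffAt_snd
  have h1 : ContMDiffAt (𝓘(ℝ, P).prod 𝓘(ℝ, V₁)) 𝓘(ℝ, P × V₂) ∞
      (fun p : P × M₁ => (p.1, ε p.2)) (c, x) := contMDiffAt_fst.prodMk_space h0
  have h2 : ContMDiffAt 𝓘(ℝ, P × V₂) 𝓘(ℝ, V₂) ∞ Φ (c, ε x) := hΦ.contMDiffAt
  have h3 := ContMDiffAt.comp (g := Φ) (f := fun p : P × M₁ => (p.1, ε p.2)) (c, x) h2 h1
  exact ContMDiffAt.comp (g := ε') (f := Φ ∘ (fun p : P × M₁ => (p.1, ε p.2))) (c, x) hε' h3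

variable [IsManifold 𝓘(ℝ, V₁) ∞ M₁] {ε : OpenPartialHomeomorph M₁ V₁}

lemma smoothAt_chart (hε : ε ∈ atlas V₁ M₁) {x : M₁} (hx : x ∈ ε.source) :
    SmoothAt (V₁ := V₁) (V₂ := V₁) ε x :=
  (contMDiffOn_of_mem_maximalAtlas (IsManifold.subset_maximalAtlas hε) x hx).contMDiffAt
    (ε.open_source.mem_nhds hx)

lemma smoothAt_chart_symm (hε : ε ∈ atlas V₁ M₁) {y : V₁} (hy : y ∈ ε.target) :
    SmoothAt (V₁ := V₁) (V₂ := V₁) ε.symm y :=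
  (contMDiffOn_symm_of_mem_maximalAtlas (IsManifold.subset_maximalAtlas hε) y hy).contMDiffAt
    (ε.open_target.mem_nhds hy)

lemma D_chart_symm (hε : ε ∈ atlas V₁ M₁) {y : V₁} (hy : y ∈ ε.target) (u : V₁) :
    (D ε (ε.symm y) : V₁ →L[ℝ] V₁) ((D ε.symm y : V₁ →L[ℝ] V₁) u) = u := by
  rw [← D_comp_apply (smoothAt_chart hε (ε.map_target hy)).mdiff (smoothAt_chart_symm hε hy).mdiff]
  refine D_id_apply (M₁ := V₁) ?_ u
  filter_upwards [ε.open_target.mem_nhds hy] with z hz using ε.right_inv hz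

lemma D_symm_chart (hε : ε ∈ atlas V₁ M₁) {x : M₁} (hx : x ∈ ε.source) (u : V₁) :
    (D ε.symm (ε x) : V₁ →L[ℝ] V₁) ((D ε x : V₁ →L[ℝ] V₁) u) = u := by
  have h1 : SmoothAt (V₁ := V₁) (V₂ := V₁) ε.symm (ε x) := smoothAt_chart_symm hε (ε.map_source hx)
  rw [← D_comp_apply h1.mdiff (smoothAt_chart hε hx).mdiff]
  refine D_id_apply ?_ u
  filter_upwards [ε.open_source.mem_nhds hx] with z hz using ε.left_inv hz

end Derivative

namespace LagrangianFibration

variable {n : ℕ} {B : Type u} [TopologicalSpace B] [ChartedSpace (E n) B]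

/-- The symplectic form at a point, as a form on the model space. -/
def ω₂ (F : LagrangianFibration.{u, v} n B) (x : F.carrier) : (E (2 * n)) [⋀^Fin 2]→L[ℝ] ℝ :=
  F.form x

/-- The derivative of the projection. -/
noncomputable def dproj (F : LagrangianFibration.{u, v} n B) (x : F.carrier) :
    E (2 * n) →L[ℝ] E n := D F.proj x

/-- The time derivative of the curve `γ` at `t` is the vector that corresponds under the symplectic
form to the pull-back of the covector `β`. -/
def IsFlowLineAt (F : LagrangianFibration.{u, v} n B) (β : E n →L[ℝ] ℝ) (γ : ℝ → F.carrier)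
    (t : ℝ) : Prop :=
  ∃ V : E (2 * n), HasVelocity γ t V ∧
    ∀ w, F.ω₂ (γ t) ![V, w] = β (F.dproj (γ t) w)

variable (F : LagrangianFibration.{u, v} n B)

lemma translate_iff {b : B} {β : E n →L[ℝ] ℝ} {x y : F.carrier} :
    F.Translate b β x y ↔
      ∃ γ : ℝ → F.carrier, γ 0 = x ∧ γ 1 = y ∧ ∀ t, F.proj (γ t) = b ∧ F.IsFlowLineAt β γ t :=
  Iff.rfl

lemma mem_regularLocus {x : F.carrier} :
    x ∈ F.regularLocus ↔ Function.Surjective (F.dproj x) := Iff.rfl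

lemma smoothAt_proj (x : F.carrier) : SmoothAt (V₁ := E (2 * n)) (V₂ := E n) F.proj x :=
  F.smooth_proj x

lemma continuous_proj : Continuous F.proj := F.smooth_proj.continuous

lemma chartForm_apply (ε : OpenPartialHomeomorph F.carrier (E (2 * n))) (y : E (2 * n))
    (a b : E (2 * n)) : chartForm F.form ε y ![a, b] =
      F.ω₂ (ε.symm y) ![(D ε.symm y : E (2 * n) →L[ℝ] E (2 * n)) a,
        (D ε.symm y : E (2 * n) →L[ℝ] E (2 * n)) b] := by
  refine congrArg (F.ω₂ (ε.symm y)) (funext fun i => ?_)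
  fin_cases i <;> rfl

/-- The part of a chart of the total space that lies over a chart of the base. -/
def chartDomain (ε : OpenPartialHomeomorph F.carrier (E (2 * n)))
    (e : OpenPartialHomeomorph B (E n)) : Set (E (2 * n)) :=
  ε.target ∩ ε.symm ⁻¹' (F.proj ⁻¹' e.source)

/-- The projection in coordinates. -/
def chartProj (ε : OpenPartialHomeomorph F.carrier (E (2 * n)))
    (e : OpenPartialHomeomorph B (E n)) (y : E (2 * n)) : E n :=
  e (F.proj (ε.symm y))

lemma nondegenerate {x : F.carrier} {a : E (2 * n)} (h : ∀ b, F.ω₂ x ![a, b] = 0) : a = 0 :=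
  F.symplectic.nondegenerate x a h

variable {ε : OpenPartialHomeomorph F.carrier (E (2 * n))} {e : OpenPartialHomeomorph B (E n)}

lemma isOpen_chartDomain : IsOpen (F.chartDomain ε e) :=
  ε.isOpen_inter_preimage_symm (e.open_source.preimage F.continuous_proj)

variable [IsManifold 𝓘(ℝ, E n) ∞ B]

lemma smoothAt_chartProj (hε : ε ∈ atlas _ F.carrier) (he : e ∈ atlas _ B) {y : E (2 * n)}
    (hy : y ∈ F.chartDomain ε e) :
    SmoothAt (V₁ := E (2 * n)) (V₂ := E n) (F.chartProj ε e) y :=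
  ContMDiffAt.comp (g := e) y (smoothAt_chart he hy.2)
    (ContMDiffAt.comp (g := F.proj) y (F.smoothAt_proj _) (smoothAt_chart_symm hε hy.1))

lemma fderiv_chartProj (hε : ε ∈ atlas _ F.carrier) (he : e ∈ atlas _ B) {y : E (2 * n)}
    (hy : y ∈ F.chartDomain ε e) (w : E (2 * n)) :
    fderiv ℝ (F.chartProj ε e) y w = (D e (F.proj (ε.symm y)) : E n →L[ℝ] E n)
      (F.dproj (ε.symm y) ((D ε.symm y : E (2 * n) →L[ℝ] E (2 * n)) w)) := by
  have h1 : SmoothAt (V₁ := E (2 * n)) (V₂ := E n) (fun y => F.proj (ε.symm y)) y :=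
    ContMDiffAt.comp (g := F.proj) y (F.smoothAt_proj _) (smoothAt_chart_symm hε hy.1)
  rw [← D_eq_fderiv]
  unfold chartProj dproj
  rw [← D_comp_apply (F.smoothAt_proj _).mdiff (smoothAt_chart_symm hε hy.1).mdiff,
    D_comp_apply (f := fun y => F.proj (ε.symm y)) (smoothAt_chart he hy.2).mdiff h1.mdiff]

lemma D_chart_injective (he : e ∈ atlas _ B) {b : B} (hb : b ∈ e.source) :
    Function.Injective (D e b : E n →L[ℝ] E n) := by
  intro a a' h
  rw [← D_symm_chart he hb a, h, D_symm_chart he hb a']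

lemma isLagrangianModel (hε : ε ∈ atlas _ F.carrier) (he : e ∈ atlas _ B) :
    IsLagrangianModel (F.chartDomain ε e) (chartForm F.form ε) (F.chartProj ε e) := by
  have hsurj : ∀ y ∈ F.chartDomain ε e, Function.Surjective (fderiv ℝ (F.chartProj ε e) y) ↔
      Function.Surjective (F.dproj (ε.symm y)) := by
    intro y hy
    constructor
    · intro h v
      obtain ⟨w, hw⟩ := h ((D e (F.proj (ε.symm y)) : E n →L[ℝ] E n) v)
      rw [F.fderiv_chartProj hε he hy] at hw
      exact ⟨_, D_chart_injective he hy.2 hw⟩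
    · intro h v
      obtain ⟨w, hw⟩ := h ((D e.symm (e (F.proj (ε.symm y))) : E n →L[ℝ] E n) v)
      refine ⟨(D ε (ε.symm y) : E (2 * n) →L[ℝ] E (2 * n)) w, ?_⟩
      have h1 := D_symm_chart hε (ε.map_target hy.1) w
      rw [ε.right_inv hy.1] at h1
      rw [F.fderiv_chartProj hε he hy, h1, hw]
      have h2 := D_chart_symm he (e.map_source hy.2) v
      rwa [e.left_inv hy.2] at h2
  refine ⟨F.isOpen_chartDomain, (F.symplectic.smooth ε hε).mono inter_subset_left,
    fun y hy => F.symplectic.closed ε hε y hy.1, ?_, ?_, ?_, ?_⟩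
  · intro y hy a ha
    have h1 : (D ε.symm y : E (2 * n) →L[ℝ] E (2 * n)) a = 0 := by
      refine F.symplectic.nondegenerate (ε.symm y) _ fun b => ?_
      have h2 := ha ((D ε (ε.symm y) : E (2 * n) →L[ℝ] E (2 * n)) b)
      rw [chartForm_apply] at h2
      have h1 := D_symm_chart hε (ε.map_target hy.1) b
      rw [ε.right_inv hy.1] at h1
      rw [h1] at h2
      exact h2
    rw [← D_chart_symm hε hy.1 a, h1, map_zero]
  · intro y hy
    exact (contMDiffAt_iff_contDiffAt.1 (F.smoothAt_chartProj hε he hy)).contDiffWithinAt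
  · intro y hy
    rw [frequently_iff]
    intro U hU
    obtain ⟨U', hU', hU'o, hyU'⟩ := mem_nhds_iff.1 (inter_mem hU (F.isOpen_chartDomain.mem_nhds hy))
    obtain ⟨x, ⟨hx1, hx2⟩, hx3⟩ := F.dense_regular.inter_open_nonempty
      (ε.source ∩ ε ⁻¹' U') (ε.isOpen_inter_preimage hU'o)
      ⟨ε.symm y, ε.map_target hy.1, by rw [mem_preimage, ε.right_inv hy.1]; exact hyU'⟩
    refine ⟨ε x, (hU' hx2).1, (hsurj _ (hU' hx2).2).2 ?_⟩
    rw [ε.left_inv hx1]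
    exact hx3
  · intro y hy hs a b ha hb
    rw [F.fderiv_chartProj hε he hy] at ha hb
    rw [chartForm_apply]
    exact F.lagrangian _ ((hsurj y hy).1 hs) _ _
      (D_chart_injective he hy.2 (ha.trans (map_zero _).symm))
      (D_chart_injective he hy.2 (hb.trans (map_zero _).symm))

end LagrangianFibration

/-! ### Local flows and uniqueness of flow lines -/

/-- Constant covectors on the model space of the base. -/
abbrev Cov (n : ℕ) : Type := E n →L[ℝ] ℝ

namespace LagrangianFibration

variable {n : ℕ} {B : Type u} [TopologicalSpace B] [ChartedSpace (E n) B]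
  (F : LagrangianFibration.{u, v} n B)
  {ε : OpenPartialHomeomorph F.carrier (E (2 * n))} {e : OpenPartialHomeomorph B (E n)}

/-- Joint smoothness in a covector and a point of the total space. -/
abbrev JointSmoothAt (Φ : Cov n × F.carrier → F.carrier) (p : Cov n × F.carrier) : Prop :=
  ContMDiffAt (𝓘(ℝ, Cov n).prod 𝓘(ℝ, E (2 * n))) 𝓘(ℝ, E (2 * n)) ∞ Φ p

/-- The map preserves the symplectic form at the point `x`. -/
def PreservesFormAt (φ : F.carrier → F.carrier) (x : F.carrier) : Prop :=
  ∀ u w, F.ω₂ (φ x) ![(D φ x : E (2 * n) →L[ℝ] E (2 * n)) u,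
    (D φ x : E (2 * n) →L[ℝ] E (2 * n)) w] = F.ω₂ x ![u, w]

variable {F} in
lemma IsFlowLineAt.continuousAt {β : Cov n} {γ : ℝ → F.carrier} {t : ℝ}
    (h : F.IsFlowLineAt β γ t) : ContinuousAt γ t := by
  obtain ⟨V, hV, -⟩ := h
  exact hV.continuousAt

variable {F} in
lemma IsFlowLineAt.congr {β : Cov n} {γ γ' : ℝ → F.carrier} {t : ℝ}
    (h : F.IsFlowLineAt β γ t) (h' : γ' =ᶠ[𝓝 t] γ) : F.IsFlowLineAt β γ' t := by
  obtain ⟨V, hV, hw⟩ := h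
  refine ⟨V, hV.congr h', ?_⟩
  rw [h'.self_of_nhds]
  exact hw

variable {F} in
/-- Affine reparametrization of a flow line. -/
lemma IsFlowLineAt.comp_affine {β : Cov n} {γ : ℝ → F.carrier} {a r t : ℝ}
    (h : F.IsFlowLineAt β γ (a + r * t)) :
    F.IsFlowLineAt (r • β) (fun t => γ (a + r * t)) t := by
  obtain ⟨V, hV, hw⟩ := h
  refine ⟨r • V, ?_, fun w => ?_⟩
  · have h1 : HasDerivAt (fun t => a + r * t) r t := by
      simpa using ((hasDerivAt_id t).const_mul r).const_add a
    exact HasVelocity.scomp (f := fun t => a + r * t) hV h1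
  · have h3 := hw w
    rw [← toBilin_apply] at h3 ⊢
    rw [map_smul, smul_apply, h3]
    rfl

variable [IsManifold 𝓘(ℝ, E n) ∞ B]

variable {F} in
lemma IsFlowLineAt.hasDerivAt_chart (hε : ε ∈ atlas _ F.carrier) (he : e ∈ atlas _ B)
    {γ : ℝ → F.carrier} {t : ℝ} {c : Cov n}
    (hγ : F.IsFlowLineAt (c ∘L (D e (F.proj (γ t)) : E n →L[ℝ] E n)) γ t)
    (hs : γ t ∈ ε.source) (hb : F.proj (γ t) ∈ e.source) :
    HasDerivAt (fun t => ε (γ t))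
      (hamVec (chartForm F.form ε) (F.chartProj ε e) (ε (γ t)) c) t := by
  obtain ⟨V, hV, hw⟩ := hγ
  have hmem : ε (γ t) ∈ F.chartDomain ε e :=
    ⟨ε.map_source hs, by rw [mem_preimage, ε.left_inv hs]; exact hb⟩
  have h1 := hasVelocity_iff.1 (hV.map (smoothAt_chart hε hs).mdiff)
  rwa [← (F.isLagrangianModel hε he).eq_hamVec hmem fun w => ?_]
  rw [chartForm_apply, ε.left_inv hs, D_symm_chart hε hs, hw, F.fderiv_chartProj hε he hmem,
    ε.left_inv hs]
  rfl

lemma isFlowLineAt_of_chart (hε : ε ∈ atlas _ F.carrier) (he : e ∈ atlas _ B)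
    {g : ℝ → E (2 * n)} {t : ℝ} {c : Cov n} (hmem : g t ∈ F.chartDomain ε e)
    (hg : HasDerivAt g (hamVec (chartForm F.form ε) (F.chartProj ε e) (g t) c) t) :
    F.IsFlowLineAt (c ∘L (D e (F.proj (ε.symm (g t))) : E n →L[ℝ] E n))
      (fun t => ε.symm (g t)) t := by
  refine ⟨(D ε.symm (g t) : E (2 * n) →L[ℝ] E (2 * n))
    (hamVec (chartForm F.form ε) (F.chartProj ε e) (g t) c),
    (hasVelocity_iff.2 hg).map (smoothAt_chart_symm hε hmem.1).mdiff, fun w => ?_⟩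
  · have h1 := D_symm_chart hε (ε.map_target hmem.1) w
    rw [ε.right_inv hmem.1] at h1
    have h2 := (F.isLagrangianModel hε he).hamVec_spec hmem c
      ((D ε (ε.symm (g t)) : E (2 * n) →L[ℝ] E (2 * n)) w)
    rw [chartForm_apply, h1, F.fderiv_chartProj hε he hmem, h1] at h2
    exact h2

lemma exists_covector (he : e ∈ atlas _ B) {b : B} (hb : b ∈ e.source) (β : Cov n) :
    β = (β ∘L (D e.symm (e b) : E n →L[ℝ] E n)) ∘L (D e b : E n →L[ℝ] E n) := by
  ext w
  simp [D_symm_chart he hb w]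

/-- Flow lines are locally determined by an initial value. -/
lemma eventuallyEq_of_isFlowLineAt {β : Cov n} {b : B} {γ γ' : ℝ → F.carrier} {t₀ : ℝ}
    (hγ : ∀ᶠ t in 𝓝 t₀, F.proj (γ t) = b ∧ F.IsFlowLineAt β γ t)
    (hγ' : ∀ᶠ t in 𝓝 t₀, F.proj (γ' t) = b ∧ F.IsFlowLineAt β γ' t)
    (h0 : γ t₀ = γ' t₀) : γ =ᶠ[𝓝 t₀] γ' := by
  let ε := chartAt (E (2 * n)) (γ t₀)
  let e := chartAt (E n) b
  have hε : ε ∈ atlas _ F.carrier := chart_mem_atlas _ _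
  have he : e ∈ atlas _ B := chart_mem_atlas _ _
  have hb : b ∈ e.source := mem_chart_source _ _
  set c : Cov n := β ∘L (D e.symm (e b) : E n →L[ℝ] E n) with hc
  have hβ : β = c ∘L (D e b : E n →L[ℝ] E n) := exists_covector he hb β
  have hs : γ t₀ ∈ ε.source := mem_chart_source _ _
  have hmem : ε (γ t₀) ∈ F.chartDomain ε e :=
    ⟨ε.map_source hs, by
      rw [mem_preimage, ε.left_inv hs, mem_preimage, hγ.self_of_nhds.1]; exact hb⟩
  have M := F.isLagrangianModel hε he
  have hX : ContDiffAt ℝ 1 (fun y => hamVec (chartForm F.form ε) (F.chartProj ε e) y c)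
      (ε (γ t₀)) :=
    (((M.contDiffOn_hamVec _ hmem).contDiffAt (M.isOpen.mem_nhds hmem)).clm_apply
      contDiffAt_const).of_le (by exact_mod_cast le_top)
  obtain ⟨K, O, hO, hLip⟩ := hX.exists_lipschitzOnWith
  have key : ∀ γ₁ : ℝ → F.carrier, γ₁ t₀ = γ t₀ →
      (∀ᶠ t in 𝓝 t₀, F.proj (γ₁ t) = b ∧ F.IsFlowLineAt β γ₁ t) →
      ∀ᶠ t in 𝓝 t₀, γ₁ t ∈ ε.source ∧ HasDerivAt (fun t => ε (γ₁ t))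
        (hamVec (chartForm F.form ε) (F.chartProj ε e) (ε (γ₁ t)) c) t ∧ ε (γ₁ t) ∈ O := by
    intro γ₁ h1 hγ₁
    have hcont : ContinuousAt γ₁ t₀ := hγ₁.self_of_nhds.2.continuousAt
    have h2 : ∀ᶠ t in 𝓝 t₀, γ₁ t ∈ ε.source :=
      hcont.eventually (ε.open_source.mem_nhds (by rw [h1]; exact hs))
    have h3 : ∀ᶠ t in 𝓝 t₀, ε (γ₁ t) ∈ O := by
      have h4 : ContinuousAt (fun t => ε (γ₁ t)) t₀ :=
        ContinuousAt.comp (g := ε) (ε.continuousAt (by rw [h1]; exact hs)) hcont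
      refine h4.eventually ?_
      change O ∈ 𝓝 (ε (γ₁ t₀))
      rwa [h1]
    filter_upwards [hγ₁, h2, h3] with t ht1 ht2 ht3
    refine ⟨ht2, IsFlowLineAt.hasDerivAt_chart hε he ?_ ht2 (by rw [ht1.1]; exact hb), ht3⟩
    rw [ht1.1, ← hβ]
    exact ht1.2
  have h1 := key γ rfl hγ
  have h2 := key γ' h0.symm hγ'
  have h3 := ODE_solution_unique_of_eventually
    (v := fun _ y => hamVec (chartForm F.form ε) (F.chartProj ε e) y c) (s := fun _ => O) (K := K)
    (f := fun t => ε (γ t)) (g := fun t => ε (γ' t)) (t₀ := t₀) (Eventually.of_forall fun _ => hLip)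
    (h1.mono fun t ht => ht.2) (h2.mono fun t ht => ht.2) (by rw [h0])
  filter_upwards [h1, h2, h3] with t ht1 ht2 ht3
  exact ε.injOn ht1.1 ht2.1 ht3

/-- Flow lines on an open interval are determined by an initial value. -/
lemma eqOn_of_isFlowLineAt {β : Cov n} {b : B} {γ γ' : ℝ → F.carrier} {J : Set ℝ} (hJ : IsOpen J)
    (hJc : IsPreconnected J)
    (hγ : ∀ t ∈ J, F.proj (γ t) = b ∧ F.IsFlowLineAt β γ t)
    (hγ' : ∀ t ∈ J, F.proj (γ' t) = b ∧ F.IsFlowLineAt β γ' t)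
    {t₀ : ℝ} (ht₀ : t₀ ∈ J) (h0 : γ t₀ = γ' t₀) : EqOn γ γ' J := by
  let S : Set ℝ := {t | γ =ᶠ[𝓝 t] γ'}
  let S' : Set ℝ := {t | t ∈ J ∧ γ t ≠ γ' t}
  have hS : IsOpen S := isOpen_setOfPred_eventually_nhds
  have hS' : IsOpen S' := by
    rw [isOpen_iff_mem_nhds]
    rintro t ⟨ht, hne⟩
    have h1 := (hγ t ht).2.continuousAt.prodMk (hγ' t ht).2.continuousAt
    have h2 : ∀ᶠ s in 𝓝 t, (γ s, γ' s) ∈ (diagonal F.carrier)ᶜ :=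
      h1.eventually (isClosed_diagonal.isOpen_compl.mem_nhds hne)
    filter_upwards [h2, hJ.mem_nhds ht] with s hs hs' using ⟨hs', hs⟩
  have hev : ∀ t ∈ J, γ t = γ' t → t ∈ S := fun t ht h =>
    F.eventuallyEq_of_isFlowLineAt (by filter_upwards [hJ.mem_nhds ht] with s hs using hγ s hs)
      (by filter_upwards [hJ.mem_nhds ht] with s hs using hγ' s hs) h
  intro t ht
  by_contra hne
  obtain ⟨s, -, hs, hs'⟩ := hJc S S' hS hS'
    (fun s hs => (em (γ s = γ' s)).imp (hev s hs) fun h => ⟨hs, h⟩) ⟨t₀, ht₀, hev t₀ ht₀ h0⟩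
    ⟨t, ht, ht, hne⟩
  exact hs'.2 hs.self_of_nhds

/-- Near every point of the total space there is a smooth local flow for small constant covectors in
a chart of the base. It preserves the projection and the symplectic form. -/
theorem exists_local_flow (he : e ∈ atlas _ B) (x₀ : F.carrier) (hx₀ : F.proj x₀ ∈ e.source) :
    ∃ (Φ : Cov n × F.carrier → F.carrier) (N : Set F.carrier) (δ : ℝ), IsOpen N ∧ x₀ ∈ N ∧ 0 < δ ∧
      ∀ x ∈ N, F.proj x ∈ e.source ∧ Φ (0, x) = x ∧
        (∀ c ∈ Metric.ball (0 : Cov n) δ, F.proj (Φ (c, x)) = F.proj x ∧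
          F.JointSmoothAt Φ (c, x) ∧ F.PreservesFormAt (fun x => Φ (c, x)) x) ∧
        ∀ (c : Cov n) (t : ℝ), t • c ∈ Metric.ball (0 : Cov n) δ →
          F.IsFlowLineAt (c ∘L (D e (F.proj x) : E n →L[ℝ] E n)) (fun t => Φ (t • c, x)) t := by
  let ε := chartAt (E (2 * n)) x₀
  have hε : ε ∈ atlas _ F.carrier := chart_mem_atlas _ _
  have hs : x₀ ∈ ε.source := mem_chart_source _ _
  have M := F.isLagrangianModel hε he
  have hmem : ∀ x ∈ ε.source, F.proj x ∈ e.source → ε x ∈ F.chartDomain ε e := fun x hx hxe =>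
    ⟨ε.map_source hx, by rw [mem_preimage, ε.left_inv hx]; exact hxe⟩
  obtain ⟨Φ, δ, hδ, hΦ, hflow⟩ := exists_smooth_local_flow M.isOpen M.contDiffOn_hamVec
    (hmem x₀ hs hx₀)
  refine ⟨fun p => ε.symm (Φ (p.1, ε p.2)),
    (ε.source ∩ ε ⁻¹' Metric.ball (ε x₀) δ) ∩ F.proj ⁻¹' e.source, δ,
    (ε.isOpen_inter_preimage Metric.isOpen_ball).inter (e.open_source.preimage F.continuous_proj),
    ⟨⟨hs, Metric.mem_ball_self hδ⟩, hx₀⟩, hδ, ?_⟩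
  rintro x ⟨⟨hx, hxb⟩, hxe⟩
  have hW : ∀ c ∈ Metric.ball (0 : Cov n) δ, Φ (c, ε x) ∈ F.chartDomain ε e := by
    intro c hc
    have h1 := ((hflow c _ hxb).2 1 (by rwa [one_smul])).1
    rwa [one_smul] at h1
  have hproj : ∀ c ∈ Metric.ball (0 : Cov n) δ, F.proj (ε.symm (Φ (c, ε x))) = F.proj x := by
    intro c hc
    have h1 : F.chartProj ε e (Φ (c, ε x)) = F.chartProj ε e (ε x) := M.proj_flow hflow hc hxb
    unfold chartProj at h1
    rw [ε.left_inv hx] at h1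
    exact e.injOn (hW c hc).2 hxe h1
  refine ⟨hxe, ?_, fun c hc => ⟨hproj c hc, ?_, ?_⟩, fun c t ht => ?_⟩
  · change ε.symm (Φ (0, ε x)) = x
    rw [(hflow 0 _ hxb).1, ε.left_inv hx]
  · exact contMDiffAt_prod_of_chart (smoothAt_chart hε hx)
      (hΦ.contDiffAt ((Metric.isOpen_ball.prod Metric.isOpen_ball).mem_nhds ⟨hc, hxb⟩))
      (smoothAt_chart_symm hε (hW c hc).1)
  · intro u w
    have h1 : SmoothAt (V₁ := E (2 * n)) (V₂ := E (2 * n)) (fun y => Φ (c, y)) (ε x) := by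
      have h2 : ContDiffAt ℝ ∞ Φ (c, ε x) :=
        hΦ.contDiffAt ((Metric.isOpen_ball.prod Metric.isOpen_ball).mem_nhds ⟨hc, hxb⟩)
      exact (h2.comp (ε x) (contDiffAt_const.prodMk contDiffAt_id)).contMDiffAt
    have hεx := smoothAt_chart hε hx
    have h3 : SmoothAt (V₁ := E (2 * n)) (V₂ := E (2 * n)) (fun y => Φ (c, ε y)) x :=
      ContMDiffAt.comp (g := fun y => Φ (c, y)) x h1 hεx
    have h4 : ∀ u, (D (fun x => ε.symm (Φ (c, ε x))) x : E (2 * n) →L[ℝ] E (2 * n)) u =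
        (D ε.symm (Φ (c, ε x)) : E (2 * n) →L[ℝ] E (2 * n)) (fderiv ℝ (fun y => Φ (c, y)) (ε x)
          ((D ε x : E (2 * n) →L[ℝ] E (2 * n)) u)) := by
      intro u
      rw [D_comp_apply (g := ε.symm) (f := fun x => Φ (c, ε x))
        (smoothAt_chart_symm hε (hW c hc).1).mdiff h3.mdiff,
        D_comp_apply (g := fun y => Φ (c, y)) h1.mdiff hεx.mdiff, D_eq_fderiv]
    have h5 := M.form_flow hΦ hflow hc hxb ((D ε x : E (2 * n) →L[ℝ] E (2 * n)) u)
      ((D ε x : E (2 * n) →L[ℝ] E (2 * n)) w)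
    rw [chartForm_apply, chartForm_apply, D_symm_chart hε hx, D_symm_chart hε hx,
      ε.left_inv hx] at h5
    simp only [h4]
    exact h5
  · have h1 := F.isFlowLineAt_of_chart hε he (hW _ ht) ((hflow c _ hxb).2 t ht).2
    rwa [hproj _ ht] at h1

end LagrangianFibration

/-! ### Completeness and the global flow -/

namespace LagrangianFibration

variable {n : ℕ} {B : Type u} [TopologicalSpace B] [ChartedSpace (E n) B]
  (F : LagrangianFibration.{u, v} n B) {e : OpenPartialHomeomorph B (E n)}

/-- A smooth local flow on `N`, for constant covectors of norm less than `δ` in the chart `e`. -/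
structure IsLocalFlow (e : OpenPartialHomeomorph B (E n)) (Φ : Cov n × F.carrier → F.carrier)
    (N : Set F.carrier) (δ : ℝ) : Prop where
  proj_mem : ∀ x ∈ N, F.proj x ∈ e.source
  zero : ∀ x ∈ N, Φ (0, x) = x
  proj_eq : ∀ x ∈ N, ∀ c ∈ Metric.ball (0 : Cov n) δ, F.proj (Φ (c, x)) = F.proj x
  smooth : ∀ x ∈ N, ∀ c ∈ Metric.ball (0 : Cov n) δ, F.JointSmoothAt Φ (c, x)
  form : ∀ x ∈ N, ∀ c ∈ Metric.ball (0 : Cov n) δ, F.PreservesFormAt (fun x => Φ (c, x)) x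
  flowLine : ∀ x ∈ N, ∀ (c : Cov n) (t : ℝ), t • c ∈ Metric.ball (0 : Cov n) δ →
    F.IsFlowLineAt (c ∘L (D e (F.proj x) : E n →L[ℝ] E n)) (fun t => Φ (t • c, x)) t

variable {F} in
lemma IsLocalFlow.mono {Φ : Cov n × F.carrier → F.carrier} {N : Set F.carrier} {δ δ' : ℝ}
    (h : F.IsLocalFlow e Φ N δ) (hδ : δ' ≤ δ) : F.IsLocalFlow e Φ N δ' :=
  have hb := Metric.ball_subset_ball (x := (0 : Cov n)) hδ
  ⟨h.proj_mem, h.zero, fun x hx c hc => h.proj_eq x hx c (hb hc),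
    fun x hx c hc => h.smooth x hx c (hb hc), fun x hx c hc => h.form x hx c (hb hc),
    fun x hx c t hc => h.flowLine x hx c t (hb hc)⟩

/-- Every covector acts on the total space: its flow lines exist for all times. -/
def IsComplete : Prop :=
  ∀ (b : B) (β : Cov n) (x : F.carrier), F.proj x = b → ∃ y, F.Translate b β x y

variable [IsManifold 𝓘(ℝ, E n) ∞ B]

/-- On a compact fibre the local flows exist for covectors of a uniform size. -/
lemma exists_uniform_localFlow (hF : F.IsProper) (he : e ∈ atlas _ B) {b : B} (hb : b ∈ e.source) :
    ∃ δ : ℝ, 0 < δ ∧ ∀ x, F.proj x = b →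
      ∃ (Φ : Cov n × F.carrier → F.carrier) (N : Set F.carrier),
        IsOpen N ∧ x ∈ N ∧ F.IsLocalFlow e Φ N δ := by
  have hK : IsCompact (F.proj ⁻¹' {b}) := hF.isCompact_preimage isCompact_singleton
  have key : ∃ δ : ℝ, 0 < δ ∧ ∀ x ∈ F.proj ⁻¹' {b},
      ∃ (Φ : Cov n × F.carrier → F.carrier) (N : Set F.carrier),
        IsOpen N ∧ x ∈ N ∧ F.IsLocalFlow e Φ N δ := by
    refine hK.induction_on (p := fun K => ∃ δ : ℝ, 0 < δ ∧ ∀ x ∈ K,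
      ∃ (Φ : Cov n × F.carrier → F.carrier) (N : Set F.carrier),
        IsOpen N ∧ x ∈ N ∧ F.IsLocalFlow e Φ N δ) ⟨1, one_pos, fun x hx => hx.elim⟩ ?_ ?_ ?_
    · rintro K K' hKK' ⟨δ, hδ, h⟩
      exact ⟨δ, hδ, fun x hx => h x (hKK' hx)⟩
    · rintro K K' ⟨δ, hδ, h⟩ ⟨δ', hδ', h'⟩
      refine ⟨min δ δ', lt_min hδ hδ', ?_⟩
      rintro x (hx | hx)
      · obtain ⟨Φ, N, hN, hxN, hΦ⟩ := h x hx
        exact ⟨Φ, N, hN, hxN, hΦ.mono (min_le_left _ _)⟩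
      · obtain ⟨Φ, N, hN, hxN, hΦ⟩ := h' x hx
        exact ⟨Φ, N, hN, hxN, hΦ.mono (min_le_right _ _)⟩
    · intro x hx
      obtain ⟨Φ, N, δ, hN, hxN, hδ, h⟩ := F.exists_local_flow he x (by rw [hx]; exact hb)
      exact ⟨N, mem_nhdsWithin_of_mem_nhds (hN.mem_nhds hxN), δ, hδ, fun y hy => ⟨Φ, N, hN, hy,
        fun z hz => (h z hz).1, fun z hz => (h z hz).2.1, fun z hz c hc => ((h z hz).2.2.1 c hc).1,
        fun z hz c hc => ((h z hz).2.2.1 c hc).2.1, fun z hz c hc => ((h z hz).2.2.1 c hc).2.2,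
        fun z hz => (h z hz).2.2.2⟩⟩
  exact key

section Extension

variable {b : B} {β : Cov n}

/-- Flow lines that exist for times in `(-2, 2)`, whatever the starting point, can be continued to
all positive times. -/
lemma exists_flowLine_forward (h : ∀ x, F.proj x = b → ∃ γ : ℝ → F.carrier, γ 0 = x ∧
      ∀ t ∈ Ioo (-2 : ℝ) 2, F.proj (γ t) = b ∧ F.IsFlowLineAt β γ t)
    (x : F.carrier) (hx : F.proj x = b) : ∃ γ : ℝ → F.carrier, γ 0 = x ∧
      ∀ t ∈ Ioi (-1 : ℝ), F.proj (γ t) = b ∧ F.IsFlowLineAt β γ t := by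
  choose! S hS0 hS using h
  -- `p k` is the point at the integral time `k`
  let p : ℕ → F.carrier := fun k => Nat.rec x (fun _ y => S y 1) k
  have hp : ∀ k, F.proj (p k) = b := by
    intro k
    induction k with
    | zero => exact hx
    | succ k ih => exact (hS _ ih 1 (by norm_num)).1
  have hshift : ∀ (y : F.carrier), F.proj y = b → ∀ (a t : ℝ), t - a ∈ Ioo (-2 : ℝ) 2 →
      F.proj (S y (t - a)) = b ∧ F.IsFlowLineAt β (fun t => S y (t - a)) t := by
    intro y hy a t ht
    obtain ⟨h1, h2⟩ := hS y hy _ ht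
    refine ⟨h1, ?_⟩
    have h3 := IsFlowLineAt.comp_affine (a := -a) (r := 1) (t := t) (β := β) (γ := S y)
      (by rwa [one_mul, neg_add_eq_sub])
    simpa [neg_add_eq_sub] using h3
  have hglue : ∀ k : ℕ, ∀ t ∈ Ioo (k : ℝ) (k + 1),
      S (p k) (t - k) = S (p (k + 1)) (t - (k + 1 : ℕ)) := by
    intro k t ht
    refine F.eqOn_of_isFlowLineAt (b := b) (β := β) (J := Ioo (k - 1 : ℝ) (k + 2)) isOpen_Ioo
      isPreconnected_Ioo (fun s hs => hshift _ (hp k) _ s ?_)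
      (fun s hs => hshift _ (hp (k + 1)) _ s ?_) (t₀ := k + 1) ?_ ?_ ?_
    · exact ⟨by linarith [hs.1], by linarith [hs.2]⟩
    · push_cast
      exact ⟨by linarith [hs.1], by linarith [hs.2]⟩
    · exact ⟨by linarith, by linarith⟩
    · have h0 : S (p (k + 1)) 0 = p (k + 1) := hS0 _ (hp (k + 1))
      simp only [add_sub_cancel_left, Nat.cast_add, Nat.cast_one, sub_self]
      rw [h0]
    · exact ⟨by linarith [ht.1], by linarith [ht.2]⟩
  let γ : ℝ → F.carrier := fun t => S (p ⌊t⌋₊) (t - ⌊t⌋₊)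
  refine ⟨γ, by simpa [γ, p] using hS0 x hx, fun t₀ ht₀ => ?_⟩
  set k := ⌊t₀⌋₊ with hk
  have hkt : t₀ ∈ Ioo (k - 1 : ℝ) (k + 1) := by
    refine ⟨?_, Nat.lt_floor_add_one t₀⟩
    rcases le_or_gt 0 t₀ with h0 | h0
    · linarith [Nat.floor_le h0]
    · have : k = 0 := Nat.floor_of_nonpos h0.le
      rw [this]
      simpa using ht₀
  have hev : γ =ᶠ[𝓝 t₀] fun t => S (p k) (t - k) := by
    filter_upwards [isOpen_Ioo.mem_nhds hkt] with t ht
    rcases le_or_gt (k : ℝ) t with h1 | h1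
    · have h2 : ⌊t⌋₊ = k := (Nat.floor_eq_iff ((Nat.cast_nonneg k).trans h1)).2 ⟨h1, ht.2⟩
      simp only [γ, h2]
    · rcases Nat.eq_zero_or_pos k with h0 | h0
      · have h2 : ⌊t⌋₊ = k := by
          rw [h0] at h1 ⊢
          exact Nat.floor_of_nonpos (by simpa using h1.le)
        simp only [γ, h2]
      · obtain ⟨j, hj⟩ := Nat.exists_eq_succ_of_ne_zero h0.ne'
        have hj' : (k : ℝ) = j + 1 := by rw [hj]; push_cast; ring
        have ht' : (j : ℝ) < t := by linarith [ht.1]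
        have h2 : ⌊t⌋₊ = j :=
          (Nat.floor_eq_iff ((Nat.cast_nonneg j).trans ht'.le)).2 ⟨ht'.le, by linarith⟩
        have h3 := hglue j t ⟨ht', by linarith⟩
        simp only [γ, h2]
        rw [h3, hj]
  have h1 := hshift (p k) (hp k) k t₀ ⟨by linarith [hkt.1], by linarith [hkt.2]⟩
  rw [hev.self_of_nhds]
  exact ⟨h1.1, h1.2.congr hev⟩

/-- Flow lines for `β` and `-β` that exist for all positive times fit together. -/
lemma exists_flowLine_of_forward {x : F.carrier} {γ₁ γ₂ : ℝ → F.carrier} (h₁ : γ₁ 0 = x)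
    (h₂ : γ₂ 0 = x) (hγ₁ : ∀ t ∈ Ioi (-1 : ℝ), F.proj (γ₁ t) = b ∧ F.IsFlowLineAt β γ₁ t)
    (hγ₂ : ∀ t ∈ Ioi (-1 : ℝ), F.proj (γ₂ t) = b ∧ F.IsFlowLineAt (-β) γ₂ t) :
    ∃ γ : ℝ → F.carrier, γ 0 = x ∧ ∀ t, F.proj (γ t) = b ∧ F.IsFlowLineAt β γ t := by
  have hneg : ∀ t < (1 : ℝ), F.proj (γ₂ (-t)) = b ∧ F.IsFlowLineAt β (fun t => γ₂ (-t)) t := by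
    intro t ht
    obtain ⟨h1, h2⟩ := hγ₂ (-t) (by simpa using ht)
    refine ⟨h1, ?_⟩
    have h3 := IsFlowLineAt.comp_affine (a := 0) (r := -1) (t := t) (β := -β) (γ := γ₂)
      (by simpa using h2)
    simpa using h3
  have heq : EqOn γ₁ (fun t => γ₂ (-t)) (Ioo (-1) 1) :=
    F.eqOn_of_isFlowLineAt isOpen_Ioo isPreconnected_Ioo (fun t ht => hγ₁ t ht.1)
      (fun t ht => hneg t ht.2) (t₀ := 0) (by norm_num) (by simp [h₁, h₂])
  let γ : ℝ → F.carrier := fun t => if 0 ≤ t then γ₁ t else γ₂ (-t)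
  have hγ1 : ∀ t > (-1 : ℝ), γ t = γ₁ t := by
    intro t ht
    by_cases h0 : 0 ≤ t
    · simp [γ, h0]
    · simp only [γ, h0, if_false]
      exact (heq ⟨ht, by linarith⟩).symm
  have hγ2 : ∀ t < (0 : ℝ), γ t = γ₂ (-t) := fun t ht => by simp [γ, not_le.2 ht]
  refine ⟨γ, by rw [hγ1 0 (by norm_num), h₁], fun t => ?_⟩
  rcases lt_or_ge t 0 with ht | ht
  · rw [hγ2 t ht]
    refine ⟨(hneg t (by linarith)).1, (hneg t (by linarith)).2.congr ?_⟩
    filter_upwards [isOpen_Iio.mem_nhds ht] with s hs using hγ2 s hs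
  · have ht' : t > -1 := by linarith
    rw [hγ1 t ht']
    refine ⟨(hγ₁ t ht').1, (hγ₁ t ht').2.congr ?_⟩
    filter_upwards [isOpen_Ioi.mem_nhds ht'] with s hs using hγ1 s hs

end Extension

/-- A proper Lagrangian fibration is complete. -/
theorem IsProper.isComplete {F : LagrangianFibration.{u, v} n B} (hF : F.IsProper) :
    F.IsComplete := by
  intro b β x hx
  let e := chartAt (E n) b
  have he : e ∈ atlas _ B := chart_mem_atlas _ _
  have hb : b ∈ e.source := mem_chart_source _ _
  obtain ⟨δ, hδ, hloc⟩ := F.exists_uniform_localFlow hF he hb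
  have hsmall : ∀ c : Cov n, 2 * ‖c‖ < δ → ∀ x, F.proj x = b → ∃ γ : ℝ → F.carrier, γ 0 = x ∧
      ∀ t ∈ Ioo (-2 : ℝ) 2, F.proj (γ t) = b ∧
        F.IsFlowLineAt (c ∘L (D e b : E n →L[ℝ] E n)) γ t := by
    intro c hc x hx
    obtain ⟨Φ, N, -, hxN, hΦ⟩ := hloc x hx
    have hmem : ∀ t ∈ Ioo (-2 : ℝ) 2, t • c ∈ Metric.ball (0 : Cov n) δ := by
      intro t ht
      rw [mem_ball_zero_iff, norm_smul]
      exact (mul_le_mul_of_nonneg_right (abs_le.2 ⟨ht.1.le, ht.2.le⟩) (norm_nonneg _)).trans_lt hc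
    refine ⟨fun t => Φ (t • c, x), by simpa using hΦ.zero x hxN, fun t ht => ?_⟩
    have h1 := hΦ.flowLine x hxN c t (hmem t ht)
    rw [hx] at h1
    exact ⟨(hΦ.proj_eq x hxN _ (hmem t ht)).trans hx, h1⟩
  set c : Cov n := β ∘L (D e.symm (e b) : E n →L[ℝ] E n) with hc
  obtain ⟨N, hN⟩ := exists_nat_gt (2 * ‖c‖ / δ)
  have hN0 : (0 : ℝ) < N := lt_of_le_of_lt (by positivity) hN
  have hNc : 2 * ‖(N : ℝ)⁻¹ • c‖ < δ := by
    rw [norm_smul, norm_inv, Real.norm_of_nonneg hN0.le]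
    rw [div_lt_iff₀ hδ] at hN
    calc 2 * ((N : ℝ)⁻¹ * ‖c‖) = (2 * ‖c‖) / N := by ring
      _ < δ := by rw [div_lt_iff₀ hN0]; linarith
  obtain ⟨γ₁, h₁, hγ₁⟩ := F.exists_flowLine_forward (hsmall _ hNc) x hx
  obtain ⟨γ₂, h₂, hγ₂⟩ := F.exists_flowLine_forward
    (hsmall (-((N : ℝ)⁻¹ • c)) (by rwa [norm_neg])) x hx
  rw [ContinuousLinearMap.neg_comp] at hγ₂
  obtain ⟨γ, h0, hγ⟩ := F.exists_flowLine_of_forward h₁ h₂ hγ₁ hγ₂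
  refine ⟨γ (N : ℝ), (F.translate_iff).2 ⟨fun t => γ (0 + N * t), by simp [h0], by simp,
    fun t => ⟨(hγ _).1, ?_⟩⟩⟩
  have h1 := IsFlowLineAt.comp_affine (a := 0) (r := N) (t := t) (hγ (0 + N * t)).2
  convert h1 using 1
  rw [ContinuousLinearMap.smul_comp, smul_smul, mul_inv_cancel₀ hN0.ne', one_smul]
  exact exists_covector he hb β

open Classical in
/-- The translation of the point `x` by the covector `β` at its image in the base, that is, the
time-one flow. -/
noncomputable def flow (β : Cov n) (x : F.carrier) : F.carrier :=
  if h : ∃ y, F.Translate (F.proj x) β x y then h.choose else x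

variable {F} (hF : F.IsComplete)

include hF

omit [IsManifold 𝓘(ℝ, E n) ∞ B] in
lemma translate_flow (β : Cov n) (x : F.carrier) : F.Translate (F.proj x) β x (F.flow β x) := by
  have h := hF (F.proj x) β x rfl
  rw [flow, dif_pos h]
  exact h.choose_spec

/-- `t ↦ flow (t • β) x` is the flow line through `x`. -/
lemma flow_eq_of_isFlowLineAt {b : B} {β : Cov n} {γ : ℝ → F.carrier} {J : Set ℝ} (hJ : IsOpen J)
    (hJc : Convex ℝ J) (hγ : ∀ t ∈ J, F.proj (γ t) = b ∧ F.IsFlowLineAt β γ t)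
    (h0 : (0 : ℝ) ∈ J) {t : ℝ} (ht : t ∈ J) : γ t = F.flow (t • β) (γ 0) := by
  obtain ⟨γ', h1, h2, h3⟩ := (F.translate_iff).1 (translate_flow hF (t • β) (γ 0))
  let J' : Set ℝ := (fun s => 0 + t * s) ⁻¹' J
  have hJ' : IsOpen J' := hJ.preimage (by fun_prop)
  have hJc' : Convex ℝ J' := by
    intro s hs s' hs' a a' ha ha' haa
    change 0 + t * (a • s + a' • s') ∈ J
    convert hJc hs hs' ha ha' haa using 1
    simp only [smul_eq_mul]
    ring
  have heq := F.eqOn_of_isFlowLineAt (b := b) (β := t • β) (γ := fun s => γ (0 + t * s)) (γ' := γ')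
    hJ' hJc'.isPreconnected (fun s hs => ⟨(hγ _ hs).1, (hγ _ hs).2.comp_affine⟩)
    (fun s _ => ⟨(h3 s).1.trans (hγ 0 h0).1, (h3 s).2⟩) (t₀ := 0) (by simpa [J'] using h0)
    (by simp [h1])
  have h4 := heq (show (1 : ℝ) ∈ J' by simpa [J'] using ht)
  simp only [zero_add, mul_one] at h4
  rw [h4, h2]

lemma isFlowLineAt_flow (β : Cov n) (x : F.carrier) (t : ℝ) :
    F.IsFlowLineAt β (fun t => F.flow (t • β) x) t := by
  obtain ⟨γ, h1, h2, h3⟩ := (F.translate_iff).1 (translate_flow hF β x)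
  refine (h3 t).2.congr (Eventually.of_forall fun s => ?_)
  have := flow_eq_of_isFlowLineAt hF isOpen_univ convex_univ (fun t _ => h3 t) (mem_univ _)
    (mem_univ s)
  rw [this, h1]

omit [IsManifold 𝓘(ℝ, E n) ∞ B] in
lemma proj_flow (β : Cov n) (x : F.carrier) : F.proj (F.flow β x) = F.proj x := by
  obtain ⟨γ, h1, h2, h3⟩ := (F.translate_iff).1 (translate_flow hF β x)
  rw [← h2, (h3 1).1]

lemma flow_zero (x : F.carrier) : F.flow 0 x = x := by
  obtain ⟨γ, h1, h2, h3⟩ := (F.translate_iff).1 (translate_flow hF 0 x)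
  have := flow_eq_of_isFlowLineAt hF isOpen_univ convex_univ (fun t _ => h3 t) (mem_univ _)
    (mem_univ 0)
  rw [zero_smul, h1] at this
  exact this.symm

lemma translate_iff_flow {b : B} {β : Cov n} {x y : F.carrier} :
    F.Translate b β x y ↔ F.proj x = b ∧ y = F.flow β x := by
  constructor
  · intro h
    obtain ⟨γ, h1, h2, h3⟩ := (F.translate_iff).1 h
    refine ⟨by rw [← h1, (h3 0).1], ?_⟩
    have := flow_eq_of_isFlowLineAt hF isOpen_univ convex_univ (fun t _ => h3 t) (mem_univ _)
      (mem_univ 1)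
    rwa [one_smul, h1, h2] at this
  · rintro ⟨rfl, rfl⟩
    exact translate_flow hF β x

lemma flow_smul_add (β : Cov n) (x : F.carrier) (s t : ℝ) :
    F.flow (s • β) (F.flow (t • β) x) = F.flow ((t + s) • β) x := by
  have h1 : ∀ s, F.proj (F.flow ((t + 1 * s) • β) x) = F.proj x ∧
      F.IsFlowLineAt β (fun s => F.flow ((t + 1 * s) • β) x) s := by
    intro s
    refine ⟨proj_flow hF _ _, ?_⟩
    have := (isFlowLineAt_flow hF β x (t + 1 * s)).comp_affine
    rwa [one_smul] at this
  have h2 := flow_eq_of_isFlowLineAt hF isOpen_univ convex_univ (fun t _ => h1 t) (mem_univ _)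
    (mem_univ s)
  simpa using h2.symm

end LagrangianFibration

/-! ### Smoothness of the flow and the group law -/

section Derivative

variable {P V₀ V₁ V₂ : Type} [NormedAddCommGroup P] [NormedSpace ℝ P]
  [NormedAddCommGroup V₀] [NormedSpace ℝ V₀] [NormedAddCommGroup V₁] [NormedSpace ℝ V₁]
  [NormedAddCommGroup V₂] [NormedSpace ℝ V₂]
  {M₀ M₁ M₂ : Type*} [TopologicalSpace M₀] [ChartedSpace V₀ M₀] [TopologicalSpace M₁]
  [ChartedSpace V₁ M₁] [TopologicalSpace M₂] [ChartedSpace V₂ M₂]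

lemma HasVelocity.mdiff {γ : ℝ → M₁} {t : ℝ} {V : V₁} (h : HasVelocity γ t V) :
    MDifferentiableAt 𝓘(ℝ, ℝ) 𝓘(ℝ, V₁) γ t := HasMFDerivAt.mdifferentiableAt h

lemma HasVelocity.D_eq {γ : ℝ → M₁} {t : ℝ} {V : V₁} (h : HasVelocity γ t V) :
    (D γ t : ℝ →L[ℝ] V₁) 1 = V := by
  have h1 : (D γ t : ℝ →L[ℝ] V₁) = (1 : ℝ →L[ℝ] ℝ).smulRight V := HasMFDerivAt.mfderiv h
  rw [h1]
  simp

lemma hasVelocity_D {γ : ℝ → M₁} {t : ℝ} (h : MDifferentiableAt 𝓘(ℝ, ℝ) 𝓘(ℝ, V₁) γ t) :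
    HasVelocity γ t ((D γ t : ℝ →L[ℝ] V₁) 1) := by
  have h1 := h.hasMFDerivAt
  have h2 : (1 : ℝ →L[ℝ] ℝ).smulRight ((D γ t : ℝ →L[ℝ] V₁) 1) = D γ t := by
    ext; simp
  exact (congrArg (fun L : ℝ →L[ℝ] V₁ => HasMFDerivAt 𝓘(ℝ, ℝ) 𝓘(ℝ, V₁) γ t L) h2).mpr h1

/-- The chain rule for a map of two variables, one of which runs through a vector space. -/
lemma D_prod_apply {Ψ : P × M₁ → M₂} {a : M₀ → P} {g : M₀ → M₁} {x : M₀}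
    (hΨ : ContMDiffAt (𝓘(ℝ, P).prod 𝓘(ℝ, V₁)) 𝓘(ℝ, V₂) ∞ Ψ (a x, g x))
    (ha : MDifferentiableAt 𝓘(ℝ, V₀) 𝓘(ℝ, P) a x)
    (hg : MDifferentiableAt 𝓘(ℝ, V₀) 𝓘(ℝ, V₁) g x) (u : V₀) :
    (D (fun y => Ψ (a y, g y)) x : V₀ →L[ℝ] V₂) u =
      (D (fun c => Ψ (c, g x)) (a x) : P →L[ℝ] V₂) ((D a x : V₀ →L[ℝ] P) u) +
      (D (fun y => Ψ (a x, y)) (g x) : V₁ →L[ℝ] V₂) ((D g x : V₀ →L[ℝ] V₁) u) := by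
  have h1 : MDifferentiableAt (𝓘(ℝ, P).prod 𝓘(ℝ, V₁)) 𝓘(ℝ, V₂) Ψ (a x, g x) :=
    hΨ.mdifferentiableAt (by simp)
  have h2 := mfderiv_comp (I' := 𝓘(ℝ, P).prod 𝓘(ℝ, V₁)) (g := Ψ) (f := fun y => (a y, g y)) x h1
    (ha.prodMk hg)
  have h3 := mfderiv_prodMk ha hg
  have h4 := mfderiv_prod_eq_add_apply (f := Ψ) (p := (a x, g x))
    (v := ((D a x : V₀ →L[ℝ] P) u, (D g x : V₀ →L[ℝ] V₁) u)) h1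
  have h5 := congrArg (fun L : V₀ →L[ℝ] V₂ => L u) h2
  refine h5.trans (Eq.trans ?_ h4)
  exact congrArg (fun L : V₀ →L[ℝ] P × V₁ =>
    (mfderiv (𝓘(ℝ, P).prod 𝓘(ℝ, V₁)) 𝓘(ℝ, V₂) Ψ (a x, g x) : P × V₁ →L[ℝ] V₂) (L u)) h3

lemma contMDiffAt_left {Ψ : P × M₁ → M₂} {c : P} {x : M₁}
    (hΨ : ContMDiffAt (𝓘(ℝ, P).prod 𝓘(ℝ, V₁)) 𝓘(ℝ, V₂) ∞ Ψ (c, x)) :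
    SmoothAt (V₁ := P) (V₂ := V₂) (fun c => Ψ (c, x)) c :=
  ContMDiffAt.comp (g := Ψ) (f := fun c => (c, x)) c hΨ (contMDiffAt_id.prodMk contMDiffAt_const)

lemma contMDiffAt_right {Ψ : P × M₁ → M₂} {c : P} {x : M₁}
    (hΨ : ContMDiffAt (𝓘(ℝ, P).prod 𝓘(ℝ, V₁)) 𝓘(ℝ, V₂) ∞ Ψ (c, x)) :
    SmoothAt (V₁ := V₁) (V₂ := V₂) (fun x => Ψ (c, x)) x :=
  ContMDiffAt.comp (g := Ψ) (f := fun x => (c, x)) x hΨ (contMDiffAt_const.prodMk contMDiffAt_id)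

end Derivative

namespace LagrangianFibration

variable {n : ℕ} {B : Type u} [TopologicalSpace B] [ChartedSpace (E n) B]
  (F G H : LagrangianFibration.{u, v} n B)

/-- Near `x`, the map `φ` is a smooth map over `B`; it preserves the symplectic forms at `x`. -/
structure IsMorphismAt (φ : F.carrier → G.carrier) (x : F.carrier) : Prop where
  smooth : SmoothAt (V₁ := E (2 * n)) (V₂ := E (2 * n)) φ x
  proj_eq : ∀ᶠ y in 𝓝 x, G.proj (φ y) = F.proj y
  form : ∀ u w, G.ω₂ (φ x) ![(D φ x : E (2 * n) →L[ℝ] E (2 * n)) u,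
    (D φ x : E (2 * n) →L[ℝ] E (2 * n)) w] = F.ω₂ x ![u, w]

lemma isMorphismAt_id (x : F.carrier) : F.IsMorphismAt F (fun x => x) x :=
  ⟨contMDiffAt_id, Eventually.of_forall fun _ => rfl, fun u w => by rw [D_id]; rfl⟩

variable {F G H}

namespace IsMorphismAt

variable {φ : F.carrier → G.carrier} {x : F.carrier}

lemma congr {φ' : F.carrier → G.carrier} (h : F.IsMorphismAt G φ x) (h' : φ' =ᶠ[𝓝 x] φ) :
    F.IsMorphismAt G φ' x := by
  refine ⟨h.smooth.congr_of_eventuallyEq h', ?_, fun u w => ?_⟩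
  · filter_upwards [h', h.proj_eq] with y hy hy'
    rw [hy, hy']
  · rw [D_congr h', h'.self_of_nhds, h.form]

lemma comp {ψ : G.carrier → H.carrier} (hψ : G.IsMorphismAt H ψ (φ x)) (h : F.IsMorphismAt G φ x) :
    F.IsMorphismAt H (fun y => ψ (φ y)) x := by
  refine ⟨ContMDiffAt.comp (g := ψ) x hψ.smooth h.smooth, ?_, fun u w => ?_⟩
  · filter_upwards [h.proj_eq, h.smooth.continuousAt.eventually hψ.proj_eq] with y hy hy'
    rw [hy', hy]
  · rw [D_comp_apply hψ.smooth.mdiff h.smooth.mdiff, D_comp_apply hψ.smooth.mdiff h.smooth.mdiff,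
      hψ.form, h.form]

lemma D_injective (h : F.IsMorphismAt G φ x) :
    Function.Injective (D φ x : E (2 * n) →L[ℝ] E (2 * n)) := by
  rw [injective_iff_map_eq_zero]
  intro u hu
  refine F.nondegenerate (x := x) fun w => ?_
  rw [← h.form, hu, ← toBilin_apply, map_zero]
  rfl

lemma D_surjective (h : F.IsMorphismAt G φ x) :
    Function.Surjective (D φ x : E (2 * n) →L[ℝ] E (2 * n)) :=
  LinearMap.surjective_of_injective
    (f := ((D φ x : E (2 * n) →L[ℝ] E (2 * n)) : E (2 * n) →ₗ[ℝ] E (2 * n))) h.D_injective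

lemma proj_apply (h : F.IsMorphismAt G φ x) : G.proj (φ x) = F.proj x := h.proj_eq.self_of_nhds

lemma dproj_apply (h : F.IsMorphismAt G φ x) (u : E (2 * n)) :
    G.dproj (φ x) ((D φ x : E (2 * n) →L[ℝ] E (2 * n)) u) = F.dproj x u := by
  unfold dproj
  rw [← D_comp_apply (G.smoothAt_proj _).mdiff h.smooth.mdiff, D_congr h.proj_eq]

lemma mem_regularLocus_iff (h : F.IsMorphismAt G φ x) :
    φ x ∈ G.regularLocus ↔ x ∈ F.regularLocus := by
  rw [mem_regularLocus, mem_regularLocus]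
  constructor
  · intro hs v
    obtain ⟨w, hw⟩ := hs v
    obtain ⟨u, rfl⟩ := h.D_surjective w
    exact ⟨u, by rw [← h.dproj_apply, hw]⟩
  · intro hs v
    obtain ⟨u, hu⟩ := hs v
    exact ⟨_, by rw [h.dproj_apply, hu]⟩

lemma map_ham (h : F.IsMorphismAt G φ x) {β : Cov n} {V : E (2 * n)}
    (hV : ∀ w, F.ω₂ x ![V, w] = β (F.dproj x w)) (w : E (2 * n)) :
    G.ω₂ (φ x) ![(D φ x : E (2 * n) →L[ℝ] E (2 * n)) V, w] = β (G.dproj (φ x) w) := by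
  obtain ⟨u, rfl⟩ := h.D_surjective w
  rw [h.form, hV, h.dproj_apply]

/-- Symplectic maps over the base send flow lines to flow lines. -/
lemma map_flowLine {β : Cov n} {γ : ℝ → F.carrier} {t : ℝ} (h : F.IsMorphismAt G φ (γ t))
    (hγ : F.IsFlowLineAt β γ t) : G.IsFlowLineAt β (fun t => φ (γ t)) t := by
  obtain ⟨V, hV, hw⟩ := hγ
  exact ⟨_, hV.map h.smooth.mdiff, h.map_ham hw⟩

end IsMorphismAt

variable [IsManifold 𝓘(ℝ, E n) ∞ B]

/-- Symplectic maps over the base commute with translations. -/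
lemma map_flow (hF : F.IsComplete) (hG : G.IsComplete) {φ : F.carrier → G.carrier} {b : B}
    (h : ∀ x, F.proj x = b → F.IsMorphismAt G φ x) (β : Cov n) {x : F.carrier}
    (hx : F.proj x = b) : φ (F.flow β x) = G.flow β (φ x) := by
  have hp : ∀ t : ℝ, F.proj (F.flow (t • β) x) = b := fun t => (proj_flow hF _ _).trans hx
  have h1 := flow_eq_of_isFlowLineAt hG (γ := fun t : ℝ => φ (F.flow (t • β) x)) (b := b) (β := β)
    isOpen_univ convex_univ (fun t _ => ⟨(h _ (hp t)).proj_apply.trans (hp t),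
      IsMorphismAt.map_flowLine (γ := fun t : ℝ => F.flow (t • β) x) (h _ (hp t))
        (isFlowLineAt_flow hF β x t)⟩)
    (mem_univ 0) (mem_univ 1)
  simpa [flow_zero hF] using h1

variable (F)

/-- The translation by the covector that is the constant `c` in the chart `e` of the base. -/
noncomputable def chartFlow (e : OpenPartialHomeomorph B (E n)) (c : Cov n) (x : F.carrier) :
    F.carrier :=
  F.flow (c ∘L (D e (F.proj x) : E n →L[ℝ] E n)) x

variable {F} {e : OpenPartialHomeomorph B (E n)}

lemma chartFlow_zero (hF : F.IsComplete) (x : F.carrier) : F.chartFlow e 0 x = x := by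
  rw [chartFlow, ContinuousLinearMap.zero_comp, flow_zero hF]

omit [IsManifold 𝓘(ℝ, E n) ∞ B] in
lemma proj_chartFlow (hF : F.IsComplete) (c : Cov n) (x : F.carrier) :
    F.proj (F.chartFlow e c x) = F.proj x := proj_flow hF _ _

lemma chartFlow_smul_add (hF : F.IsComplete) (c : Cov n) (x : F.carrier) (s t : ℝ) :
    F.chartFlow e (s • c) (F.chartFlow e (t • c) x) = F.chartFlow e ((t + s) • c) x := by
  unfold chartFlow
  rw [proj_flow hF]
  simp only [ContinuousLinearMap.smul_comp]
  exact flow_smul_add hF _ _ _ _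

lemma IsLocalFlow.eq_chartFlow (hF : F.IsComplete) {Φ : Cov n × F.carrier → F.carrier}
    {N : Set F.carrier} {δ : ℝ} (h : F.IsLocalFlow e Φ N δ) {c : Cov n} (hc : c ∈ Metric.ball 0 δ)
    {x : F.carrier} (hx : x ∈ N) : Φ (c, x) = F.chartFlow e c x := by
  let J : Set ℝ := {t | t • c ∈ Metric.ball (0 : Cov n) δ}
  have hJ : IsOpen J := Metric.isOpen_ball.preimage (by fun_prop)
  have hJc : Convex ℝ J := (convex_ball (0 : Cov n) δ).linear_preimage
    (LinearMap.toSpanSingleton ℝ (Cov n) c)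
  have hδ : 0 < δ := (norm_nonneg c).trans_lt (mem_ball_zero_iff.1 hc)
  have h1 := flow_eq_of_isFlowLineAt hF (γ := fun t : ℝ => Φ (t • c, x)) (t := 1) hJ hJc
    (fun t ht => ⟨h.proj_eq x hx _ ht, h.flowLine x hx c t ht⟩) (by simpa [J] using hδ)
    (by simpa [J] using hc)
  simp only [one_smul, zero_smul, h.zero x hx] at h1
  exact h1

/-- The flow is smooth, and it preserves the symplectic form. Near a compact fibre this holds for all
small covectors at once; the flow of any covector `c` is an iterate of the flow of `c / k`, which is
small for large `k`. -/
theorem smooth_chartFlow (hF : F.IsProper) (he : e ∈ atlas _ B) (c : Cov n) {x : F.carrier}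
    (hx : F.proj x ∈ e.source) :
    F.JointSmoothAt (fun p => F.chartFlow e p.1 p.2) (c, x) ∧
      F.IsMorphismAt F (F.chartFlow e c) x := by
  have hC := hF.isComplete
  obtain ⟨δ, hδ, hloc⟩ := F.exists_uniform_localFlow hF he hx
  have hsmall : ∀ y, F.proj y = F.proj x → ∀ c ∈ Metric.ball (0 : Cov n) δ,
      F.JointSmoothAt (fun p => F.chartFlow e p.1 p.2) (c, y) ∧
        F.PreservesFormAt (F.chartFlow e c) y := by
    intro y hy c hc
    obtain ⟨Φ, N, hN, hyN, hΦ⟩ := hloc y hy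
    constructor
    · refine (hΦ.smooth y hyN c hc).congr_of_eventuallyEq ?_
      filter_upwards [(Metric.isOpen_ball.prod hN).mem_nhds ⟨hc, hyN⟩] with p hp
      exact (hΦ.eq_chartFlow hC hp.1 hp.2).symm
    · have h1 : F.chartFlow e c =ᶠ[𝓝 y] fun y => Φ (c, y) := by
        filter_upwards [hN.mem_nhds hyN] with z hz using (hΦ.eq_chartFlow hC hc hz).symm
      intro u w
      rw [D_congr h1, h1.self_of_nhds]
      exact hΦ.form y hyN c hc u w
  have hall : ∀ k : ℕ, ∀ c ∈ Metric.ball (0 : Cov n) δ,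
      F.JointSmoothAt (fun p => F.chartFlow e ((k : ℝ) • p.1) p.2) (c, x) ∧
        F.PreservesFormAt (F.chartFlow e ((k : ℝ) • c)) x := by
    intro k c hc
    induction k with
    | zero =>
      simp only [Nat.cast_zero, zero_smul, chartFlow_zero hC]
      refine ⟨contMDiffAt_snd, fun u w => ?_⟩
      have h1 : F.chartFlow e 0 = fun x => x := funext fun x => chartFlow_zero hC x
      rw [h1, D_id]
      rfl
    | succ k ih =>
      have hk : ∀ (c : Cov n) (y : F.carrier), F.chartFlow e (((k + 1 : ℕ) : ℝ) • c) y =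
          F.chartFlow e c (F.chartFlow e ((k : ℝ) • c) y) := by
        intro c y
        have := chartFlow_smul_add (e := e) hC c y 1 k
        rw [one_smul] at this
        rw [this, Nat.cast_succ]
      have hs := hsmall (F.chartFlow e ((k : ℝ) • c) x) (proj_chartFlow hC _ _) c hc
      have hr := contMDiffAt_right hs.1
      have hr' := contMDiffAt_right ih.1
      constructor
      · simp only [hk]
        exact ContMDiffAt.comp (g := fun p : Cov n × F.carrier => F.chartFlow e p.1 p.2)
          (f := fun p : Cov n × F.carrier => (p.1, F.chartFlow e ((k : ℝ) • p.1) p.2)) (c, x) hs.1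
          (contMDiffAt_fst.prodMk ih.1)
      · intro u w
        have h1 : F.chartFlow e (((k + 1 : ℕ) : ℝ) • c) =
            fun y => F.chartFlow e c (F.chartFlow e ((k : ℝ) • c) y) := funext fun y => hk c y
        rw [h1, D_comp_apply (g := F.chartFlow e c) hr.mdiff hr'.mdiff,
          D_comp_apply (g := F.chartFlow e c) hr.mdiff hr'.mdiff, hs.2, ih.2]
  obtain ⟨k, hk⟩ := exists_nat_gt (‖c‖ / δ)
  have hk0 : (0 : ℝ) < k := lt_of_le_of_lt (by positivity) hk
  have hkc : (k : ℝ)⁻¹ • c ∈ Metric.ball (0 : Cov n) δ := by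
    rw [mem_ball_zero_iff, norm_smul, norm_inv, Real.norm_of_nonneg hk0.le]
    rw [div_lt_iff₀ hδ] at hk
    rw [inv_mul_eq_div, div_lt_iff₀ hk0]
    linarith
  obtain ⟨h1, h2⟩ := hall k _ hkc
  rw [smul_smul, mul_inv_cancel₀ hk0.ne', one_smul] at h2
  have h3 : F.JointSmoothAt (fun p => F.chartFlow e p.1 p.2) (c, x) := by
    have h4 : ContMDiffAt (𝓘(ℝ, Cov n).prod 𝓘(ℝ, E (2 * n))) 𝓘(ℝ, Cov n) ∞
        (fun p : Cov n × F.carrier => (k : ℝ)⁻¹ • p.1) (c, x) :=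
      ContMDiffAt.comp (I' := 𝓘(ℝ, Cov n)) (g := fun c : Cov n => (k : ℝ)⁻¹ • c) (f := Prod.fst)
        (c, x) (contDiff_const_smul _).contMDiff.contMDiffAt contMDiffAt_fst
    have h5 := ContMDiffAt.comp
      (g := fun p : Cov n × F.carrier => F.chartFlow e ((k : ℝ) • p.1) p.2)
      (f := fun p : Cov n × F.carrier => ((k : ℝ)⁻¹ • p.1, p.2)) (c, x) h1
      (h4.prodMk contMDiffAt_snd)
    refine h5.congr_of_eventuallyEq (Eventually.of_forall fun p => ?_)
    simp only [Function.comp_apply]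
    rw [smul_smul, mul_inv_cancel₀ hk0.ne', one_smul]
  exact ⟨h3, contMDiffAt_right h3, Eventually.of_forall fun y => proj_chartFlow hC _ _, h2⟩

lemma exists_flow_eq_chartFlow (he : e ∈ atlas _ B) {b : B} (hb : b ∈ e.source) (β : Cov n) :
    ∃ c : Cov n, ∀ x : F.carrier, F.proj x = b → F.flow β x = F.chartFlow e c x := by
  refine ⟨β ∘L (D e.symm (e b) : E n →L[ℝ] E n), fun x hx => ?_⟩
  rw [chartFlow, hx, ← exists_covector he hb β]

lemma exists_morphism_eq_flow (hF : F.IsProper) (b : B) (β : Cov n) :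
    ∃ φ : F.carrier → F.carrier, (∀ x, F.proj x = b → F.IsMorphismAt F φ x) ∧
      ∀ x, F.proj x = b → φ x = F.flow β x := by
  obtain ⟨c, hc⟩ := exists_flow_eq_chartFlow (F := F) (chart_mem_atlas (E n) b)
    (mem_chart_source (E n) b) β
  refine ⟨F.chartFlow (chartAt (E n) b) c, fun x hx => (smooth_chartFlow hF
    (chart_mem_atlas (E n) b) c ?_).2, fun x hx => (hc x hx).symm⟩
  rw [hx]
  exact mem_chart_source (E n) b

/-- Translations commute. -/
lemma flow_comm (hF : F.IsProper) (β β' : Cov n) (x : F.carrier) :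
    F.flow β (F.flow β' x) = F.flow β' (F.flow β x) := by
  obtain ⟨φ, h1, h2⟩ := exists_morphism_eq_flow hF (F.proj x) β
  have h3 := map_flow hF.isComplete hF.isComplete h1 β' rfl
  rwa [h2 _ (proj_flow hF.isComplete _ _), h2 _ rfl] at h3

/-- The group law of the translations: as the translations commute, `t ↦ flow (t • α) (flow (t • β) x)`
is a flow line of `α + β`. -/
theorem flow_add (hF : F.IsProper) (α β : Cov n) (x : F.carrier) :
    F.flow (α + β) x = F.flow α (F.flow β x) := by
  have hC := hF.isComplete
  obtain ⟨b, hb⟩ : ∃ b, F.proj x = b := ⟨_, rfl⟩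
  let e := chartAt (E n) b
  have he : e ∈ atlas _ B := chart_mem_atlas _ _
  have hbe : b ∈ e.source := mem_chart_source _ _
  obtain ⟨c, hc⟩ : ∃ c : Cov n, α = c ∘L (D e b : E n →L[ℝ] E n) := ⟨_, exists_covector he hbe α⟩
  have hflow : ∀ (t : ℝ) (y : F.carrier), F.proj y = b →
      F.flow (t • α) y = F.chartFlow e (t • c) y := by
    intro t y hy
    rw [chartFlow, hy, hc]
    rfl
  let g : ℝ → F.carrier := fun t => F.flow (t • β) x
  have hg : ∀ t, F.proj (g t) = b := fun t => (proj_flow hC _ _).trans hb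
  have key : ∀ t, F.IsFlowLineAt (α + β) (fun t => F.chartFlow e (t • c) (g t)) t := by
    intro t
    obtain ⟨V, hV, hVw⟩ := isFlowLineAt_flow hC β x t
    obtain ⟨W, hW, hWw⟩ := isFlowLineAt_flow hC α (g t) t
    obtain ⟨hs, hm⟩ := smooth_chartFlow hF he (t • c) (x := g t) (by rw [hg]; exact hbe)
    have ha : HasVelocity (fun t : ℝ => t • c) t c :=
      hasVelocity_iff.2 (by simpa using (hasDerivAt_id t).smul_const c)
    have hd : MDifferentiableAt 𝓘(ℝ, ℝ) 𝓘(ℝ, E (2 * n)) (fun t => F.chartFlow e (t • c) (g t)) t :=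
      MDifferentiableAt.comp (I' := 𝓘(ℝ, Cov n).prod 𝓘(ℝ, E (2 * n))) t
        (g := fun p : Cov n × F.carrier => F.chartFlow e p.1 p.2) (f := fun t => (t • c, g t))
        (hs.mdifferentiableAt (by simp)) (ha.mdiff.prodMk hV.mdiff)
    have h1 := D_prod_apply (Ψ := fun p : Cov n × F.carrier => F.chartFlow e p.1 p.2)
      (a := fun t : ℝ => t • c) (g := g) (x := t) hs ha.mdiff hV.mdiff 1
    have h2 : HasVelocity (fun s : ℝ => F.chartFlow e (s • c) (g t)) t W :=
      hW.congr (Eventually.of_forall fun s => (hflow s (g t) (hg t)).symm)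
    have h3 := D_comp_apply (g := fun c => F.chartFlow e c (g t)) (f := fun t : ℝ => t • c) (x := t)
      (contMDiffAt_left hs).mdiff ha.mdiff 1
    rw [← h3, h2.D_eq, hV.D_eq] at h1
    refine ⟨_, hasVelocity_D hd, fun w => ?_⟩
    rw [h1, ← toBilin_apply, map_add, add_apply, toBilin_apply, toBilin_apply]
    have h4 := hm.map_ham (hVw) w
    have h5 := hWw w
    simp only [hflow t (g t) (hg t)] at h5
    rw [h5]
    exact congrArg (α _ + ·) h4
  have h1 := flow_eq_of_isFlowLineAt hC (γ := fun t => F.chartFlow e (t • c) (g t)) (b := b)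
    isOpen_univ convex_univ (fun t _ => ⟨(proj_chartFlow hC _ _).trans (hg t), key t⟩)
    (mem_univ 0) (mem_univ 1)
  simp only [g, one_smul, zero_smul, chartFlow_zero hC, flow_zero hC] at h1
  rw [← h1]
  have h2 := hflow 1 (F.flow β x) ((proj_flow hC _ _).trans hb)
  simp only [one_smul] at h2
  exact h2.symm

end LagrangianFibration

/-! ### Transitivity on the regular part of the fibres -/

lemma exists_continuousLinearEquiv_of_injective {V W : Type} [NormedAddCommGroup V]
    [NormedSpace ℝ V] [NormedAddCommGroup W] [NormedSpace ℝ W] [FiniteDimensional ℝ V]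
    [FiniteDimensional ℝ W] {L : V →L[ℝ] W} (hL : Function.Injective L)
    (h : Module.finrank ℝ V = Module.finrank ℝ W) : ∃ L' : V ≃L[ℝ] W, (L' : V →L[ℝ] W) = L :=
  ⟨(LinearEquiv.ofInjectiveOfFinrankEq (L : V →ₗ[ℝ] W) hL h).toContinuousLinearEquiv,
    ContinuousLinearMap.ext fun _ => rfl⟩

namespace LagrangianFibration

variable {n : ℕ} {B : Type u} [TopologicalSpace B] [ChartedSpace (E n) B]
  (F : LagrangianFibration.{u, v} n B)

/-- The map `s` is a smooth section near `b`. -/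
def IsSectionAt (s : B → F.carrier) (b : B) : Prop :=
  ∀ᶠ b' in 𝓝 b, SmoothAt (V₁ := E n) (V₂ := E (2 * n)) s b' ∧ F.proj (s b') = b'

variable {F}

lemma IsSectionAt.eventually {s : B → F.carrier} {b : B} (h : F.IsSectionAt s b) :
    ∀ᶠ b' in 𝓝 b, F.IsSectionAt s b' := eventually_eventually_nhds.2 h

lemma IsSectionAt.smooth {s : B → F.carrier} {b : B} (h : F.IsSectionAt s b) :
    SmoothAt (V₁ := E n) (V₂ := E (2 * n)) s b := h.self_of_nhds.1

lemma IsSectionAt.proj_apply {s : B → F.carrier} {b : B} (h : F.IsSectionAt s b) :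
    F.proj (s b) = b := h.self_of_nhds.2

lemma IsSectionAt.congr {s s' : B → F.carrier} {b : B} (h : F.IsSectionAt s b)
    (h' : s' =ᶠ[𝓝 b] s) : F.IsSectionAt s' b := by
  filter_upwards [h, h'.eventually_nhds] with b' hb hb'
  exact ⟨hb.1.congr_of_eventuallyEq hb', by rw [hb'.self_of_nhds]; exact hb.2⟩

lemma IsSectionAt.dproj_apply {s : B → F.carrier} {b : B} (h : F.IsSectionAt s b) (v : E n) :
    F.dproj (s b) ((D s b : E n →L[ℝ] E (2 * n)) v) = v := by
  unfold dproj
  rw [← D_comp_apply (F.smoothAt_proj _).mdiff h.smooth.mdiff]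
  exact D_id_apply (h.mono fun b' hb' => hb'.2) v

lemma IsSectionAt.mem_regularLocus {s : B → F.carrier} {b : B} (h : F.IsSectionAt s b) :
    s b ∈ F.regularLocus := fun v => ⟨_, h.dproj_apply v⟩

variable [IsManifold 𝓘(ℝ, E n) ∞ B] {e : OpenPartialHomeomorph B (E n)}

/-- Through every regular point there is a local section. -/
lemma exists_section_through {x : F.carrier} (hx : x ∈ F.regularLocus) :
    ∃ s : B → F.carrier, s (F.proj x) = x ∧ F.IsSectionAt s (F.proj x) := by
  let ε := chartAt (E (2 * n)) x
  have hε : ε ∈ atlas _ F.carrier := chart_mem_atlas _ _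
  have hs : x ∈ ε.source := mem_chart_source _ _
  let e := chartAt (E n) (F.proj x)
  have he : e ∈ atlas _ B := chart_mem_atlas _ _
  have hb : F.proj x ∈ e.source := mem_chart_source _ _
  have hmem : ε x ∈ F.chartDomain ε e :=
    ⟨ε.map_source hs, by rw [mem_preimage, ε.left_inv hs]; exact hb⟩
  have hsurj : Function.Surjective (fderiv ℝ (F.chartProj ε e) (ε x)) := by
    intro v
    obtain ⟨w, hw⟩ : ∃ w : E (2 * n), F.dproj x w =
        (D e.symm (e (F.proj x)) : E n →L[ℝ] E n) v := hx _
    refine ⟨(D ε x : E (2 * n) →L[ℝ] E (2 * n)) w, ?_⟩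
    rw [F.fderiv_chartProj hε he hmem, ε.left_inv hs, D_symm_chart hε hs, hw]
    have h2 := D_chart_symm he (e.map_source hb) v
    rwa [e.left_inv hb] at h2
  obtain ⟨A, hA⟩ := ContinuousLinearMap.exists_rightInverse_of_surjective
    (fderiv ℝ (F.chartProj ε e) (ε x)) (LinearMap.range_eq_top.2 hsurj)
  let g : E n → E (2 * n) := fun u => ε x + A u
  have hg : ContDiff ℝ ∞ g := contDiff_const.add A.contDiff
  have hO : IsOpen (g ⁻¹' F.chartDomain ε e) := F.isOpen_chartDomain.preimage hg.continuous
  have hP : ContDiffOn ℝ ∞ (fun u => F.chartProj ε e (g u)) (g ⁻¹' F.chartDomain ε e) :=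
    fun u hu => ((contMDiffAt_iff_contDiffAt.1 (F.smoothAt_chartProj hε he hu)).comp u
      hg.contDiffAt).contDiffWithinAt
  have hg0 : g 0 = ε x := by simp [g]
  have hder : HasFDerivAt (fun u => F.chartProj ε e (g u))
      ((ContinuousLinearEquiv.refl ℝ (E n) : E n ≃L[ℝ] E n) : E n →L[ℝ] E n) 0 := by
    have h1 : HasFDerivAt (F.chartProj ε e) (fderiv ℝ (F.chartProj ε e) (ε x)) (g 0) := by
      rw [hg0]
      exact ((contMDiffAt_iff_contDiffAt.1
        (F.smoothAt_chartProj hε he hmem)).differentiableAt (by simp)).hasFDerivAt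
    have h2 : HasFDerivAt g A 0 := A.hasFDerivAt.const_add _
    have h3 := h1.comp (g := F.chartProj ε e) 0 h2
    rw [hA] at h3
    exact h3
  obtain ⟨e₁, h0, hsub, hval, hsymm⟩ := exists_smooth_localInverse hO hP
    (show (0 : E n) ∈ g ⁻¹' F.chartDomain ε e by rw [mem_preimage, hg0]; exact hmem) hder
  have hv0 : e₁ 0 = e (F.proj x) := by
    rw [hval, hg0, chartProj, ε.left_inv hs]
  refine ⟨fun b => ε.symm (g (e₁.symm (e b))), ?_, ?_⟩
  · change ε.symm (g (e₁.symm (e (F.proj x)))) = x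
    rw [← hv0, e₁.left_inv h0, hg0, ε.left_inv hs]
  · filter_upwards [(e.isOpen_inter_preimage e₁.open_target).mem_nhds
      ⟨hb, by rw [mem_preimage, ← hv0]; exact e₁.map_source h0⟩] with b ⟨hb1, hb2⟩
    have hmem' : g (e₁.symm (e b)) ∈ F.chartDomain ε e := hsub (e₁.map_target hb2)
    constructor
    · have h1 : SmoothAt (V₁ := E n) (V₂ := E (2 * n)) (fun v => g (e₁.symm v)) (e b) :=
        (hg.contDiffAt.comp (e b) (hsymm.contDiffAt (e₁.open_target.mem_nhds hb2))).contMDiffAt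
      have h2 : SmoothAt (V₁ := E n) (V₂ := E (2 * n)) (fun b => g (e₁.symm (e b))) b :=
        ContMDiffAt.comp (g := fun v => g (e₁.symm v)) b h1 (smoothAt_chart he hb1)
      exact ContMDiffAt.comp (g := ε.symm) b (smoothAt_chart_symm hε hmem'.1) h2
    · refine e.injOn hmem'.2 hb1 ?_
      have h1 := hval (e₁.symm (e b))
      rw [e₁.right_inv hb2] at h1
      exact h1.symm

lemma chartFlow_add (hF : F.IsProper) (a c : Cov n) (x : F.carrier) :
    F.chartFlow e (a + c) x = F.chartFlow e a (F.chartFlow e c x) := by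
  unfold chartFlow
  rw [proj_flow hF.isComplete, ← flow_add hF, ContinuousLinearMap.add_comp]

/-- The derivative of the flow with respect to the covector. -/
lemma ham_chartFlow (hF : F.IsProper) (he : e ∈ atlas _ B) (c δ : Cov n) {x : F.carrier}
    (hx : F.proj x ∈ e.source) (w : E (2 * n)) :
    F.ω₂ (F.chartFlow e c x) ![(D (fun c => F.chartFlow e c x) c : Cov n →L[ℝ] E (2 * n)) δ, w] =
      δ ((D e (F.proj x) : E n →L[ℝ] E n) (F.dproj (F.chartFlow e c x) w)) := by
  have hC := hF.isComplete
  obtain ⟨W, hW, hWw⟩ := isFlowLineAt_flow hC (δ ∘L (D e (F.proj x) : E n →L[ℝ] E n))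
    (F.chartFlow e c x) 0
  have ha : HasVelocity (fun t : ℝ => t • δ + c) 0 δ :=
    hasVelocity_iff.2 (by simpa using ((hasDerivAt_id (0 : ℝ)).smul_const δ).add_const c)
  have hs : SmoothAt (V₁ := Cov n) (V₂ := E (2 * n)) (fun c => F.chartFlow e c x)
      ((0 : ℝ) • δ + c) := contMDiffAt_left (smooth_chartFlow hF he _ hx).1
  have h1 := ha.map (φ := fun c => F.chartFlow e c x) hs.mdiff
  have h2 : (fun t : ℝ => F.chartFlow e (t • δ + c) x) =
      fun t : ℝ => F.flow (t • (δ ∘L (D e (F.proj x) : E n →L[ℝ] E n))) (F.chartFlow e c x) := by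
    funext t
    rw [chartFlow_add hF]
    conv_lhs => rw [chartFlow, proj_chartFlow hC, ContinuousLinearMap.smul_comp]
  rw [h2] at h1
  have h3 : (D (fun c => F.chartFlow e c x) ((0 : ℝ) • δ + c) : Cov n →L[ℝ] E (2 * n)) δ = W := by
    rw [← h1.D_eq, hW.D_eq]
  rw [zero_smul, zero_add] at h3
  rw [h3]
  simp only [zero_smul, flow_zero hC] at hWw
  exact hWw w

lemma dproj_chartFlow (hF : F.IsProper) (he : e ∈ atlas _ B) (c δ : Cov n) {x : F.carrier}
    (hx : F.proj x ∈ e.source) :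
    F.dproj (F.chartFlow e c x)
      ((D (fun c => F.chartFlow e c x) c : Cov n →L[ℝ] E (2 * n)) δ) = 0 := by
  unfold dproj
  rw [← D_comp_apply (F.smoothAt_proj _).mdiff
    (contMDiffAt_left (smooth_chartFlow hF he _ hx).1).mdiff]
  simp only [proj_chartFlow hF.isComplete]
  have h : (D (fun _ : Cov n => F.proj x) c : Cov n →L[ℝ] E n) = 0 := mfderiv_const
  rw [h]
  rfl

lemma finrank_cov : Module.finrank ℝ (Cov n × E n) = Module.finrank ℝ (E (2 * n)) := by
  have h : Module.finrank ℝ (Cov n) = n := by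
    rw [← (LinearMap.toContinuousLinearMap (𝕜 := ℝ) (E := E n) (F' := ℝ)).finrank_eq,
      Module.finrank_linearMap, finrank_euclideanSpace_fin, Module.finrank_self, mul_one]
  rw [Module.finrank_prod, h, finrank_euclideanSpace_fin, finrank_euclideanSpace_fin, two_mul]

/-- Near a translate of a smooth section, the points of the total space are translates of the
section in a smooth way. -/
lemma exists_smooth_covector (hF : F.IsProper) (he : e ∈ atlas _ B) {s : B → F.carrier} {b : B}
    (hs : F.IsSectionAt s b) (hb : b ∈ e.source) (c₀ : Cov n) :
    ∃ c : F.carrier → Cov n, c (F.chartFlow e c₀ (s b)) = c₀ ∧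
      ∀ᶠ z in 𝓝 (F.chartFlow e c₀ (s b)), SmoothAt (V₁ := E (2 * n)) (V₂ := Cov n) c z ∧
        F.chartFlow e (c z) (s (F.proj z)) = z := by
  have hC := hF.isComplete
  obtain ⟨U, hUs, hUo, hbU⟩ := eventually_nhds_iff.1 (hs.and (e.open_source.mem_nhds hb))
  set y := F.chartFlow e c₀ (s b) with hy
  let ε := chartAt (E (2 * n)) y
  have hε : ε ∈ atlas _ F.carrier := chart_mem_atlas _ _
  have hyε : y ∈ ε.source := mem_chart_source _ _
  let O₁ : Set (Cov n × E n) := {p | p.2 ∈ e.target ∩ e.symm ⁻¹' U}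
  have hO₁ : IsOpen O₁ := (e.isOpen_inter_preimage_symm hUo).preimage continuous_snd
  let k : Cov n × E n → F.carrier := fun p => s (e.symm p.2)
  let K : Cov n × E n → F.carrier := fun p => F.chartFlow e p.1 (k p)
  have hk : ∀ p ∈ O₁, SmoothAt (V₁ := Cov n × E n) (V₂ := E (2 * n)) k p := by
    intro p hp
    have h1 : SmoothAt (V₁ := Cov n × E n) (V₂ := E n) (fun p => e.symm p.2) p :=
      ContMDiffAt.comp (g := e.symm) (f := Prod.snd) p (smoothAt_chart_symm he hp.1)
        contDiff_snd.contMDiff.contMDiffAt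
    exact ContMDiffAt.comp (g := s) (f := fun p : Cov n × E n => e.symm p.2) p (hUs _ hp.2).1.1 h1
  have hfst : ∀ p, SmoothAt (V₁ := Cov n × E n) (V₂ := Cov n) Prod.fst p := fun p =>
    contDiff_fst.contMDiff.contMDiffAt
  have hkp : ∀ p ∈ O₁, F.proj (k p) = e.symm p.2 := fun p hp => (hUs _ hp.2).1.2
  have hkU : ∀ p ∈ O₁, F.proj (k p) ∈ e.source := fun p hp => by
    rw [hkp p hp]; exact (hUs _ hp.2).2
  have hΨ : ∀ p ∈ O₁, F.JointSmoothAt (fun p => F.chartFlow e p.1 p.2) (p.1, k p) := fun p hp =>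
    (smooth_chartFlow hF he p.1 (hkU p hp)).1
  have hK : ∀ p ∈ O₁, SmoothAt (V₁ := Cov n × E n) (V₂ := E (2 * n)) K p := fun p hp =>
    ContMDiffAt.comp (g := fun p : Cov n × F.carrier => F.chartFlow e p.1 p.2)
      (f := fun p : Cov n × E n => (p.1, k p)) p (hΨ p hp) ((hfst p).prodMk (hk p hp))
  have hO : IsOpen (O₁ ∩ K ⁻¹' ε.source) := ContinuousOn.isOpen_inter_preimage
    (fun p hp => (hK p hp).continuousAt.continuousWithinAt) hO₁ ε.open_source
  let G : Cov n × E n → E (2 * n) := fun p => ε (K p)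
  have hGs : ∀ p ∈ O₁ ∩ K ⁻¹' ε.source, SmoothAt (V₁ := Cov n × E n) (V₂ := E (2 * n)) G p :=
    fun p hp => ContMDiffAt.comp (g := ε) p (smoothAt_chart hε hp.2) (hK p hp.1)
  have hG : ContDiffOn ℝ ∞ G (O₁ ∩ K ⁻¹' ε.source) := fun p hp =>
    (contMDiffAt_iff_contDiffAt.1 (hGs p hp)).contDiffWithinAt
  have hkb : k (c₀, e b) = s b := by simp only [k]; rw [e.left_inv hb]
  have hKb : K (c₀, e b) = y := by simp only [K]; rw [hkb]
  have hp₀ : (c₀, e b) ∈ O₁ ∩ K ⁻¹' ε.source := by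
    refine ⟨⟨e.map_source hb, ?_⟩, ?_⟩
    · change e.symm (e b) ∈ U
      rwa [e.left_inv hb]
    · rw [mem_preimage, hKb]; exact hyε
  have hsb : F.proj (s b) ∈ e.source := by rw [hs.proj_apply]; exact hb
  obtain ⟨hj, hm⟩ := smooth_chartFlow hF he c₀ hsb
  have hreg : y ∈ F.regularLocus := hm.mem_regularLocus_iff.2 hs.mem_regularLocus
  have hdk : ∀ p : Cov n × E n, (D k (c₀, e b) : Cov n × E n →L[ℝ] E (2 * n)) p =
      (D s b : E n →L[ℝ] E (2 * n)) ((D e.symm (e b) : E n →L[ℝ] E n) p.2) := by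
    intro p
    have hsnd : SmoothAt (V₁ := Cov n × E n) (V₂ := E n) Prod.snd (c₀, e b) :=
      contDiff_snd.contMDiff.contMDiffAt
    have hsy := smoothAt_chart_symm he (e.map_source hb)
    have h2 : SmoothAt (V₁ := Cov n × E n) (V₂ := E n) (fun p => e.symm p.2) (c₀, e b) :=
      ContMDiffAt.comp (g := e.symm) (f := Prod.snd) (c₀, e b) hsy hsnd
    have h3 : SmoothAt (V₁ := E n) (V₂ := E (2 * n)) s (e.symm (e b)) := by
      rw [e.left_inv hb]; exact hs.smooth
    have h4 := D_comp_apply (g := s) (f := fun p : Cov n × E n => e.symm p.2) h3.mdiff h2.mdiff p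
    have h5 := D_comp_apply (g := e.symm) (f := (Prod.snd : Cov n × E n → E n)) (x := (c₀, e b))
      hsy.mdiff hsnd.mdiff p
    have h6 : (D (Prod.snd : Cov n × E n → E n) (c₀, e b) : Cov n × E n →L[ℝ] E n) p = p.2 := by
      rw [D_eq_fderiv, fderiv_snd]; rfl
    rw [h5, h6] at h4
    simp only [e.left_inv hb] at h4
    exact h4
  have hinj : Function.Injective (fderiv ℝ G (c₀, e b)) := by
    rw [injective_iff_map_eq_zero]
    rintro ⟨δ, v⟩ h0
    have h1 := D_prod_apply (Ψ := fun p : Cov n × F.carrier => F.chartFlow e p.1 p.2)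
      (a := (Prod.fst : Cov n × E n → Cov n)) (g := k) (x := (c₀, e b)) (hΨ _ hp₀.1)
      (hfst _).mdiff (hk _ hp₀.1).mdiff (δ, v)
    have h2 : (D (Prod.fst : Cov n × E n → Cov n) (c₀, e b) : Cov n × E n →L[ℝ] Cov n) (δ, v)
        = δ := by
      rw [D_eq_fderiv, fderiv_fst]; rfl
    rw [h2, hdk] at h1
    simp only [hkb] at h1
    have h3 := D_comp_apply (g := ε) (f := K) (x := (c₀, e b)) (smoothAt_chart hε hp₀.2).mdiff
      (hK _ hp₀.1).mdiff (δ, v)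
    rw [D_eq_fderiv] at h3
    rw [show fderiv ℝ (fun y => ε (K y)) (c₀, e b) (δ, v) = 0 from h0] at h3
    have h4 : (D K (c₀, e b) : Cov n × E n →L[ℝ] E (2 * n)) (δ, v) = 0 := by
      have h5 := D_symm_chart hε hp₀.2 ((D K (c₀, e b) : Cov n × E n →L[ℝ] E (2 * n)) (δ, v))
      rw [← h3, map_zero] at h5
      exact h5.symm
    rw [show (D K (c₀, e b) : Cov n × E n →L[ℝ] E (2 * n)) (δ, v) = _ from h1] at h4
    have h5 := congrArg (F.dproj y) h4
    rw [map_add, map_zero] at h5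
    have h6 := dproj_chartFlow hF he c₀ δ hsb
    have h7 := hm.dproj_apply
      ((D s b : E n →L[ℝ] E (2 * n)) ((D e.symm (e b) : E n →L[ℝ] E n) v))
    rw [hs.dproj_apply] at h7
    rw [← hy] at h6 h7
    rw [h6, zero_add] at h5
    have h8 : (D e.symm (e b) : E n →L[ℝ] E n) v = 0 := h7.symm.trans h5
    have hv : v = 0 := by
      have h9 := D_chart_symm he (e.map_source hb) v
      rw [h8, map_zero] at h9
      exact h9.symm
    rw [h8, map_zero, map_zero, add_zero] at h4
    have hδ : δ = 0 := by
      ext q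
      obtain ⟨w, hw⟩ : ∃ w : E (2 * n), F.dproj y w =
          (D e.symm (e b) : E n →L[ℝ] E n) q := hreg _
      have h9 := ham_chartFlow hF he c₀ δ hsb w
      rw [h4, ← toBilin_apply, map_zero] at h9
      have h10 : F.dproj (F.chartFlow e c₀ (s b)) w = (D e.symm (e b) : E n →L[ℝ] E n) q := hw
      have h11 := D_chart_symm he (e.map_source hb) q
      rw [e.left_inv hb] at h11
      rw [h10, hs.proj_apply, h11] at h9
      exact h9.symm
    rw [hv, hδ]
    rfl
  obtain ⟨L, hL'⟩ := exists_continuousLinearEquiv_of_injective hinj finrank_cov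
  have hL : HasFDerivAt G (L : (Cov n × E n) →L[ℝ] E (2 * n)) (c₀, e b) := by
    rw [hL']
    exact ((contMDiffAt_iff_contDiffAt.1 (hGs _ hp₀)).differentiableAt (by simp)).hasFDerivAt
  obtain ⟨e₁, h0, hsub, hval, hsymm⟩ := exists_smooth_localInverse hO hG hp₀ hL
  have hv0 : e₁ (c₀, e b) = ε y := by rw [hval]; simp only [G, hKb]
  refine ⟨fun z => (e₁.symm (ε z)).1, ?_, ?_⟩
  · change (e₁.symm (ε y)).1 = c₀
    rw [← hv0, e₁.left_inv h0]
  · filter_upwards [(ε.isOpen_inter_preimage e₁.open_target).mem_nhds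
      ⟨hyε, by rw [mem_preimage, ← hv0]; exact e₁.map_source h0⟩] with z ⟨hz1, hz2⟩
    have hmem := hsub (e₁.map_target hz2)
    have hKz : K (e₁.symm (ε z)) = z := by
      refine ε.injOn hmem.2 hz1 ?_
      have h1 := hval (e₁.symm (ε z))
      rw [e₁.right_inv hz2] at h1
      exact h1.symm
    constructor
    · have h1 : SmoothAt (V₁ := E (2 * n)) (V₂ := Cov n) (fun v => (e₁.symm v).1) (ε z) :=
        (contDiff_fst.contDiffAt.comp (ε z)
          (hsymm.contDiffAt (e₁.open_target.mem_nhds hz2))).contMDiffAt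
      exact ContMDiffAt.comp (g := fun v => (e₁.symm v).1) z h1 (smoothAt_chart hε hz1)
    · have h1 : F.proj z = e.symm (e₁.symm (ε z)).2 := by
        rw [← hkp _ hmem.1]
        conv_lhs => rw [← hKz]
        exact proj_chartFlow hC _ _
      rw [h1]
      exact hKz

lemma flow_neg (hF : F.IsProper) (β : Cov n) (x : F.carrier) :
    F.flow (-β) (F.flow β x) = x := by
  rw [← flow_add hF, neg_add_cancel, flow_zero hF.isComplete]

lemma eventually_exists_flow_eq (hF : F.IsProper) {x : F.carrier} (hx : x ∈ F.regularLocus) :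
    ∀ᶠ z in 𝓝 x, F.proj z = F.proj x → ∃ β : Cov n, F.flow β x = z := by
  obtain ⟨s, hsx, hs⟩ := exists_section_through hx
  obtain ⟨c, -, hc⟩ := exists_smooth_covector hF (chart_mem_atlas (E n) _) hs
    (mem_chart_source (E n) _) 0
  rw [chartFlow_zero hF.isComplete, hsx] at hc
  filter_upwards [hc] with z hz hzx
  have h1 := hz.2
  rw [hzx, hsx] at h1
  exact ⟨c z ∘L (D (chartAt (E n) (F.proj x)) (F.proj x) : E n →L[ℝ] E n), h1⟩

variable (F) in
/-- The fibration is proper and the regular parts of its fibres are connected. -/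
structure IsTame : Prop where
  proper : F.IsProper
  connected : F.HasConnectedRegularFibres

/-- The covectors at a point act transitively on the regular part of the fibre. -/
theorem IsTame.exists_flow_eq (hF : F.IsTame) {x y : F.carrier} (hx : x ∈ F.regularLocus)
    (hy : y ∈ F.regularLocus) (h : F.proj x = F.proj y) : ∃ β : Cov n, F.flow β x = y := by
  refine (hF.connected (F.proj y)).isPreconnected.induction₂' (fun x y => ∃ β : Cov n, F.flow β x = y)
    ?_ ?_ ⟨h, hx⟩ ⟨rfl, hy⟩
  · rintro z ⟨hz, hzr⟩
    filter_upwards [nhdsWithin_le_nhds (eventually_exists_flow_eq hF.proper hzr),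
      self_mem_nhdsWithin] with w hw hwz
    obtain ⟨β, hβ⟩ := hw (hwz.1.trans hz.symm)
    exact ⟨⟨β, hβ⟩, ⟨-β, by rw [← hβ, flow_neg hF.proper]⟩⟩
  · rintro p q r - - - ⟨β, rfl⟩ ⟨β', rfl⟩
    exact ⟨β' + β, flow_add hF.proper _ _ _⟩

end LagrangianFibration

/-! ### Stabilizers, and translations by sections -/

namespace LagrangianFibration

variable {n : ℕ} {B : Type u} [TopologicalSpace B] [ChartedSpace (E n) B]
  {F : LagrangianFibration.{u, v} n B} [IsManifold 𝓘(ℝ, E n) ∞ B]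
  {e : OpenPartialHomeomorph B (E n)}

/-- The covector that moves one local section to another can be chosen smoothly. -/
lemma IsTame.exists_smooth_covectorField (hF : F.IsTame) (he : e ∈ atlas _ B) {s σ : B → F.carrier}
    {b : B} (hs : F.IsSectionAt s b) (hσ : F.IsSectionAt σ b) (hb : b ∈ e.source) {β : Cov n}
    (hβ : F.flow β (s b) = σ b) :
    ∃ α : B → Cov n, α b ∘L (D e b : E n →L[ℝ] E n) = β ∧ ∀ᶠ b' in 𝓝 b,
      SmoothAt (V₁ := E n) (V₂ := Cov n) α b' ∧ F.chartFlow e (α b') (s b') = σ b' := by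
  set c₀ : Cov n := β ∘L (D e.symm (e b) : E n →L[ℝ] E n) with hc₀
  have hβ' : β = c₀ ∘L (D e b : E n →L[ℝ] E n) := exists_covector he hb β
  have h0 : F.chartFlow e c₀ (s b) = σ b := by
    rw [chartFlow, hs.proj_apply, ← hβ', hβ]
  obtain ⟨c, hc0, hc⟩ := exists_smooth_covector hF.proper he hs hb c₀
  rw [h0] at hc hc0
  refine ⟨fun b => c (σ b), by simp only [hc0]; exact hβ'.symm, ?_⟩
  filter_upwards [hσ, hσ.smooth.continuousAt.eventually hc] with b' h1 h2
  refine ⟨ContMDiffAt.comp (g := c) b' h2.1 h1.1, ?_⟩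
  have h3 := h2.2
  rwa [h1.2] at h3

lemma smoothAt_translate (hF : F.IsProper) (he : e ∈ atlas _ B) {α : B → Cov n} {x : F.carrier}
    (hx : F.proj x ∈ e.source) (hα : SmoothAt (V₁ := E n) (V₂ := Cov n) α (F.proj x)) :
    SmoothAt (V₁ := E (2 * n)) (V₂ := E (2 * n)) (fun z => F.chartFlow e (α (F.proj z)) z) x :=
  ContMDiffAt.comp (g := fun p : Cov n × F.carrier => F.chartFlow e p.1 p.2)
    (f := fun z : F.carrier => (α (F.proj z), z)) x
    (smooth_chartFlow hF he _ hx).1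
    ((ContMDiffAt.comp (g := α) x hα (F.smoothAt_proj x)).prodMk contMDiffAt_id)

/-- A covector that fixes one regular point of a fibre acts trivially on the whole fibre, also on its
singular points: it extends to a smooth field of covectors fixing a local section, hence fixing a
dense set. -/
theorem IsTame.flow_eq_self (hF : F.IsTame) {x y : F.carrier} (hx : x ∈ F.regularLocus)
    {β : Cov n} (hβ : F.flow β x = x) (hy : F.proj y = F.proj x) : F.flow β y = y := by
  have hC := hF.proper.isComplete
  obtain ⟨b, hb⟩ : ∃ b, F.proj x = b := ⟨_, rfl⟩
  let e := chartAt (E n) b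
  have he : e ∈ atlas _ B := chart_mem_atlas _ _
  have hbe : b ∈ e.source := mem_chart_source _ _
  obtain ⟨s, hsx, hs⟩ := exists_section_through hx
  rw [hb] at hs hsx
  obtain ⟨α, hα0, hα⟩ := hF.exists_smooth_covectorField he hs hs hbe (by rw [hsx, hβ])
  have hfix : ∀ᶠ b' in 𝓝 b, ∀ z ∈ F.regularLocus, F.proj z = b' →
      F.chartFlow e (α (F.proj z)) z = z := by
    filter_upwards [hα, hs.eventually] with b' h1 h2 z hz hzb
    obtain ⟨γ, rfl⟩ := hF.exists_flow_eq h2.mem_regularLocus hz (h2.proj_apply.trans hzb.symm)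
    have h3 := h1.2
    rw [hzb]
    rw [proj_flow hC, h2.proj_apply] at hzb
    rw [chartFlow, h2.proj_apply] at h3
    rw [chartFlow, proj_flow hC, h2.proj_apply, flow_comm hF.proper, h3]
  have hyb : F.proj y = b := hy.trans hb
  have hcont : ContinuousAt (fun z => F.chartFlow e (α (F.proj z)) z) y :=
    (smoothAt_translate hF.proper he (by rw [hyb]; exact hbe)
      (by rw [hyb]; exact hα.self_of_nhds.1)).continuousAt
  have hyy : F.flow β y = F.chartFlow e (α (F.proj y)) y := by
    rw [chartFlow, hyb, hα0]
  rw [hyy]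
  by_contra hne
  have h1 : ∀ᶠ z in 𝓝 y, (F.chartFlow e (α (F.proj z)) z, z) ∈ (diagonal F.carrier)ᶜ :=
    (hcont.prodMk continuousAt_id).eventually (isClosed_diagonal.isOpen_compl.mem_nhds hne)
  have h2 : ∀ᶠ z in 𝓝 y, ∀ w ∈ F.regularLocus, F.proj w = F.proj z →
      F.chartFlow e (α (F.proj w)) w = w := by
    have h3 : Tendsto F.proj (𝓝 y) (𝓝 b) := by rw [← hyb]; exact F.continuous_proj.continuousAt
    exact h3.eventually hfix
  obtain ⟨U, hU, hUo, hyU⟩ := eventually_nhds_iff.1 (h1.and h2)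
  obtain ⟨z, hz, hzr⟩ := F.dense_regular.inter_open_nonempty U hUo ⟨y, hyU⟩
  exact (hU z hz).1 ((hU z hz).2 z hzr rfl)

lemma flow_sub_add (hF : F.IsProper) (β β' : Cov n) (x : F.carrier) :
    F.flow β' x = F.flow (β' - β) (F.flow β x) := by
  rw [← flow_add hF, sub_add_cancel]

lemma IsTame.flow_eq_flow (hF : F.IsTame) {x y : F.carrier} (hx : x ∈ F.regularLocus)
    {β β' : Cov n} (h : F.flow β x = F.flow β' x) (hy : F.proj y = F.proj x) :
    F.flow β y = F.flow β' y := by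
  have h1 : F.flow (β - β') x = x := by
    rw [sub_eq_add_neg, add_comm, flow_add hF.proper, h, flow_neg hF.proper]
  rw [flow_sub_add hF.proper β' β, flow_comm hF.proper, hF.flow_eq_self hx h1 hy]

variable (F) in
open Classical in
/-- The translation of the point `x` by the difference `q - p` of two points of its fibre. For
regular `p` it does not depend on the choice of a covector that takes `p` to `q`; the value is `x` if
there is none. -/
noncomputable def shift (p q x : F.carrier) : F.carrier :=
  if h : ∃ β : Cov n, F.flow β p = q then F.flow h.choose x else x

lemma IsTame.shift_eq (hF : F.IsTame) {p q x : F.carrier} (hp : p ∈ F.regularLocus) {β : Cov n}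
    (h : F.flow β p = q) (hx : F.proj x = F.proj p) : F.shift p q x = F.flow β x := by
  have h1 : ∃ β : Cov n, F.flow β p = q := ⟨β, h⟩
  rw [shift, dif_pos h1]
  exact hF.flow_eq_flow hp (h1.choose_spec.trans h.symm) hx

omit [IsManifold 𝓘(ℝ, E n) ∞ B] in
lemma proj_shift (hF : F.IsComplete) (p q x : F.carrier) : F.proj (F.shift p q x) = F.proj x := by
  unfold shift
  split_ifs
  · exact proj_flow hF _ _
  · rfl

lemma IsTame.shift_self (hF : F.IsTame) {p q : F.carrier} (hp : p ∈ F.regularLocus)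
    (hq : q ∈ F.regularLocus) (h : F.proj p = F.proj q) : F.shift p q p = q := by
  obtain ⟨β, hβ⟩ := hF.exists_flow_eq hp hq h
  rw [hF.shift_eq hp hβ rfl, hβ]

lemma IsTame.shift_trans (hF : F.IsTame) {p q r x : F.carrier} (hp : p ∈ F.regularLocus)
    (hq : q ∈ F.regularLocus) (hr : r ∈ F.regularLocus) (hpq : F.proj p = F.proj q)
    (hqr : F.proj q = F.proj r) (hx : F.proj x = F.proj p) :
    F.shift q r (F.shift p q x) = F.shift p r x := by
  obtain ⟨β, hβ⟩ := hF.exists_flow_eq hp hq hpq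
  obtain ⟨γ, hγ⟩ := hF.exists_flow_eq hq hr hqr
  have h1 : F.flow (γ + β) p = r := by rw [flow_add hF.proper, hβ, hγ]
  rw [hF.shift_eq hp h1 hx, hF.shift_eq hp hβ hx, hF.shift_eq hq hγ, flow_add hF.proper]
  rw [proj_flow hF.proper.isComplete, hx, hpq]

lemma IsTame.shift_same (hF : F.IsTame) {p x : F.carrier} (hp : p ∈ F.regularLocus)
    (hx : F.proj x = F.proj p) : F.shift p p x = x := by
  have hC := hF.proper.isComplete
  rw [hF.shift_eq hp (flow_zero hC p) hx, flow_zero hC]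

lemma IsTame.shift_comm (hF : F.IsTame) {p q p' q' x : F.carrier} (hp : p ∈ F.regularLocus)
    (hq : q ∈ F.regularLocus) (hp' : p' ∈ F.regularLocus) (hq' : q' ∈ F.regularLocus)
    (hpq : F.proj p = F.proj q) (hpp : F.proj p = F.proj p') (hpq' : F.proj p' = F.proj q')
    (hx : F.proj x = F.proj p) :
    F.shift p q (F.shift p' q' x) = F.shift p' q' (F.shift p q x) := by
  have hC := hF.proper.isComplete
  obtain ⟨β, hβ⟩ := hF.exists_flow_eq hp hq hpq
  obtain ⟨γ, hγ⟩ := hF.exists_flow_eq hp' hq' hpq'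
  rw [hF.shift_eq hp hβ hx, hF.shift_eq hp' hγ (hx.trans hpp), hF.shift_eq hp hβ,
    hF.shift_eq hp' hγ, flow_comm hF.proper]
  · rw [proj_flow hC, hx, hpp]
  · rw [proj_flow hC, hx]

lemma IsTame.shift_mem (hF : F.IsTame) {p q x : F.carrier} (hx : x ∈ F.regularLocus) :
    F.shift p q x ∈ F.regularLocus := by
  unfold shift
  split_ifs with h
  · obtain ⟨φ, h1, h2⟩ := exists_morphism_eq_flow hF.proper (F.proj x) h.choose
    rw [← h2 x rfl]
    exact (h1 x rfl).mem_regularLocus_iff.2 hx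
  · exact hx

/-- Translations are determined by the image of one regular point. -/
lemma IsTame.shift_shift (hF : F.IsTame) {p q r x : F.carrier} (hp : p ∈ F.regularLocus)
    (hq : q ∈ F.regularLocus) (hr : r ∈ F.regularLocus) (hpq : F.proj p = F.proj q)
    (hrp : F.proj r = F.proj p) (hx : F.proj x = F.proj p) :
    F.shift r (F.shift p q r) x = F.shift p q x := by
  obtain ⟨β, hβ⟩ := hF.exists_flow_eq hp hq hpq
  rw [hF.shift_eq hp hβ hx, hF.shift_eq hr (hF.shift_eq hp hβ hrp).symm (hx.trans hrp.symm)]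

/-! ### Translations by Lagrangian sections are symplectic -/

/-- The pull-back of the symplectic form under the translation by a field `α` of covectors is its sum
with the pull-back of the exterior derivative of `α`. -/
lemma form_translate (hF : F.IsProper) (he : e ∈ atlas _ B) {α : B → Cov n} {x : F.carrier}
    (hx : F.proj x ∈ e.source) (hα : SmoothAt (V₁ := E n) (V₂ := Cov n) α (F.proj x))
    (u w : E (2 * n)) :
    F.ω₂ (F.chartFlow e (α (F.proj x)) x)
      ![(D (fun z => F.chartFlow e (α (F.proj z)) z) x : E (2 * n) →L[ℝ] E (2 * n)) u,
        (D (fun z => F.chartFlow e (α (F.proj z)) z) x : E (2 * n) →L[ℝ] E (2 * n)) w] =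
    F.ω₂ x ![u, w] +
      ((D α (F.proj x) : E n →L[ℝ] Cov n) (F.dproj x u)
        ((D e (F.proj x) : E n →L[ℝ] E n) (F.dproj x w)) -
      (D α (F.proj x) : E n →L[ℝ] Cov n) (F.dproj x w)
        ((D e (F.proj x) : E n →L[ℝ] E n) (F.dproj x u))) := by
  obtain ⟨hj, hm⟩ := smooth_chartFlow hF he (α (F.proj x)) hx
  have ha : SmoothAt (V₁ := E (2 * n)) (V₂ := Cov n) (fun z => α (F.proj z)) x :=
    ContMDiffAt.comp (g := α) x hα (F.smoothAt_proj x)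
  have hD : ∀ u, (D (fun z => F.chartFlow e (α (F.proj z)) z) x : E (2 * n) →L[ℝ] E (2 * n)) u =
      (D (fun c => F.chartFlow e c x) (α (F.proj x)) : Cov n →L[ℝ] E (2 * n))
        ((D α (F.proj x) : E n →L[ℝ] Cov n) (F.dproj x u)) +
      (D (F.chartFlow e (α (F.proj x))) x : E (2 * n) →L[ℝ] E (2 * n)) u := by
    intro u
    have h1 := D_prod_apply (Ψ := fun p : Cov n × F.carrier => F.chartFlow e p.1 p.2)
      (a := fun z => α (F.proj z)) (g := fun z : F.carrier => z) (x := x) hj ha.mdiff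
      (contMDiffAt_id.mdifferentiableAt (n := ∞) (by simp)) u
    rw [D_id, D_comp_apply (g := α) hα.mdiff (F.smoothAt_proj x).mdiff] at h1
    exact h1
  rw [hD u, hD w]
  have hW := fun δ w => ham_chartFlow hF he (α (F.proj x)) δ hx w
  have hv := fun δ => dproj_chartFlow hF he (α (F.proj x)) δ hx
  have hd := hm.dproj_apply
  have hf := hm.form u w
  generalize (D α (F.proj x) : E n →L[ℝ] Cov n) (F.dproj x u) = a₁ at *
  generalize (D α (F.proj x) : E n →L[ℝ] Cov n) (F.dproj x w) = a₂ at *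
  generalize (D (fun c => F.chartFlow e c x) (α (F.proj x)) : Cov n →L[ℝ] E (2 * n)) = K at *
  have hd1 := hd u
  have hd2 := hd w
  generalize (D (F.chartFlow e (α (F.proj x))) x : E (2 * n) →L[ℝ] E (2 * n)) u = v₁ at *
  generalize (D (F.chartFlow e (α (F.proj x))) x : E (2 * n) →L[ℝ] E (2 * n)) w = v₂ at *
  have e1 := hW a₁ (K a₂)
  have e2 := hW a₁ v₂
  have e3 := hW a₂ v₁
  rw [hv, map_zero, map_zero] at e1
  rw [hd2] at e2
  rw [hd1] at e3
  rw [form_swap] at e3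
  rw [← hf, ← e2]
  simp only [← toBilin_apply] at *
  simp only [map_add, add_apply]
  rw [e1]
  linarith

/-- The map `s` is a smooth Lagrangian section near `b`. -/
def IsLagrangianAt (F : LagrangianFibration.{u, v} n B) (s : B → F.carrier) (b : B) : Prop :=
  ∀ᶠ b' in 𝓝 b, F.IsSectionAt s b' ∧ ∀ p q : E n,
    F.ω₂ (s b') ![(D s b' : E n →L[ℝ] E (2 * n)) p, (D s b' : E n →L[ℝ] E (2 * n)) q] = 0

/-- The pull-back of the symplectic form under a translated section. -/
lemma form_translate_section (hF : F.IsProper) (he : e ∈ atlas _ B) {s : B → F.carrier}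
    {α : B → Cov n} {b : B} (hb : b ∈ e.source) (hs : F.IsSectionAt s b)
    (hα : SmoothAt (V₁ := E n) (V₂ := Cov n) α b) (p q : E n) :
    F.ω₂ (F.chartFlow e (α b) (s b))
      ![(D (fun b => F.chartFlow e (α b) (s b)) b : E n →L[ℝ] E (2 * n)) p,
        (D (fun b => F.chartFlow e (α b) (s b)) b : E n →L[ℝ] E (2 * n)) q] =
    F.ω₂ (s b) ![(D s b : E n →L[ℝ] E (2 * n)) p, (D s b : E n →L[ℝ] E (2 * n)) q] +
      ((D α b : E n →L[ℝ] Cov n) p ((D e b : E n →L[ℝ] E n) q) -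
      (D α b : E n →L[ℝ] Cov n) q ((D e b : E n →L[ℝ] E n) p)) := by
  have hsb : F.proj (s b) ∈ e.source := by rw [hs.proj_apply]; exact hb
  have hα' : SmoothAt (V₁ := E n) (V₂ := Cov n) α (F.proj (s b)) := by
    rw [hs.proj_apply]; exact hα
  have h1 : (fun b => F.chartFlow e (α b) (s b)) =ᶠ[𝓝 b]
      fun b => F.chartFlow e (α (F.proj (s b))) (s b) := by
    filter_upwards [hs] with b' hb'
    rw [hb'.2]
  have h2 := fun p => D_comp_apply (g := fun z => F.chartFlow e (α (F.proj z)) z) (f := s)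
    (smoothAt_translate hF he hsb hα').mdiff hs.smooth.mdiff p
  rw [D_congr h1, h2, h2]
  have h3 := form_translate hF he hsb hα' ((D s b : E n →L[ℝ] E (2 * n)) p)
    ((D s b : E n →L[ℝ] E (2 * n)) q)
  rw [hs.dproj_apply, hs.dproj_apply, hs.proj_apply] at h3
  exact h3

lemma isSectionAt_translate (hF : F.IsProper) (he : e ∈ atlas _ B) {s : B → F.carrier}
    {α : B → Cov n} {b : B} (hb : b ∈ e.source) (hs : F.IsSectionAt s b)
    (hα : ∀ᶠ b' in 𝓝 b, SmoothAt (V₁ := E n) (V₂ := Cov n) α b') :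
    F.IsSectionAt (fun b => F.chartFlow e (α b) (s b)) b := by
  filter_upwards [hs, hα, e.open_source.mem_nhds hb] with b' h1 h2 h3
  refine ⟨?_, (proj_chartFlow hF.isComplete _ _).trans h1.2⟩
  exact ContMDiffAt.comp (g := fun p : Cov n × F.carrier => F.chartFlow e p.1 p.2)
    (f := fun b => (α b, s b)) b' (smooth_chartFlow hF he _ (by rw [h1.2]; exact h3)).1
    (h2.prodMk h1.1)

/-- The translation by the difference of two Lagrangian sections is symplectic. -/
theorem IsTame.isMorphismAt_shift (hF : F.IsTame) {s σ : B → F.carrier} {x : F.carrier}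
    (hs : F.IsLagrangianAt s (F.proj x)) (hσ : F.IsLagrangianAt σ (F.proj x)) :
    F.IsMorphismAt F (fun z => F.shift (s (F.proj z)) (σ (F.proj z)) z) x := by
  have hC := hF.proper.isComplete
  let e := chartAt (E n) (F.proj x)
  have he : e ∈ atlas _ B := chart_mem_atlas _ _
  have hb : F.proj x ∈ e.source := mem_chart_source _ _
  have hs1 := hs.self_of_nhds.1
  have hσ1 := hσ.self_of_nhds.1
  obtain ⟨β, hβ⟩ := hF.exists_flow_eq hs1.mem_regularLocus hσ1.mem_regularLocus
    (hs1.proj_apply.trans hσ1.proj_apply.symm)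
  obtain ⟨α, -, hα⟩ := hF.exists_smooth_covectorField he hs1 hσ1 hb hβ
  have h1 : (fun z => F.shift (s (F.proj z)) (σ (F.proj z)) z) =ᶠ[𝓝 x]
      fun z => F.chartFlow e (α (F.proj z)) z := by
    filter_upwards [F.continuous_proj.continuousAt.eventually (hα.and hs1.eventually)]
      with z ⟨hz1, hz2⟩
    have h2 := hz1.2
    rw [chartFlow, hz2.proj_apply] at h2
    rw [hF.shift_eq hz2.mem_regularLocus h2 hz2.proj_apply.symm]
    rfl
  refine IsMorphismAt.congr ?_ h1
  refine ⟨smoothAt_translate hF.proper he hb hα.self_of_nhds.1,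
    Eventually.of_forall fun z => proj_chartFlow hC _ _, fun u w => ?_⟩
  rw [form_translate hF.proper he hb hα.self_of_nhds.1]
  have h3 := form_translate_section hF.proper he hb hs1 hα.self_of_nhds.1 (F.dproj x u)
    (F.dproj x w)
  have h4 : (fun b => F.chartFlow e (α b) (s b)) =ᶠ[𝓝 (F.proj x)] σ := hα.mono fun b hb => hb.2
  rw [D_congr h4, hα.self_of_nhds.2, hσ.self_of_nhds.2, hs.self_of_nhds.2, zero_add] at h3
  rw [← h3, add_zero]

end LagrangianFibration

/-! ### Primitives of closed 2-forms -/

section Poincare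

variable {V W : Type} [NormedAddCommGroup V] [NormedSpace ℝ V] [NormedAddCommGroup W]
  [NormedSpace ℝ W]

/-- Multiplication of a family of vectors by the time, as a continuous linear map. -/
noncomputable def timeMul : C(TimeInterval, W) →L[ℝ] C(TimeInterval, W) :=
  evalFamily ⟨fun t : TimeInterval => (t : ℝ) • ContinuousLinearMap.id ℝ W,
    continuous_subtype_val.smul continuous_const⟩

lemma timeMul_apply (g : C(TimeInterval, W)) (t : TimeInterval) : timeMul g t = (t : ℝ) • g t := rfl

/-- The weighted mean `∫₀¹ t Θ(t y) dt` of a continuous map along the ray through `y`. -/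
noncomputable def radialMean (Θ : V → W) (y : V) : W := ∫ t in (0 : ℝ)..1, t • Θ (t • y)

/-- The weighted mean `∫₀¹ t g(t) dt` of a continuous curve. -/
noncomputable def weightedMean : C(TimeInterval, W) →L[ℝ] W :=
  (ContinuousMap.evalCLM ℝ (⟨1, by norm_num⟩ : TimeInterval)) ∘L primitive ∘L timeMul

lemma weightedMean_apply (g : C(TimeInterval, W)) (f : ℝ → W)
    (h : ∀ t (ht : t ∈ Icc (-2 : ℝ) 2), g ⟨t, ht⟩ = f t) :
    weightedMean g = ∫ t in (0 : ℝ)..1, t • f t := by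
  change (∫ t in (0 : ℝ)..1, timeMul g (clampTime t)) = _
  refine intervalIntegral.integral_congr fun t ht => ?_
  rw [uIcc_of_le zero_le_one] at ht
  have ht' : t ∈ Icc (-2 : ℝ) 2 := ⟨by linarith [ht.1], by linarith [ht.2]⟩
  simp only [timeMul_apply, clampTime_of_mem ht', h t ht']

lemma radialMean_eq {Θ : V → W} (hΘ : Continuous Θ) : radialMean Θ = fun y =>
    weightedMean ((⟨Θ, hΘ⟩ : C(V, W)).comp (timeMul (constMap y))) :=
  funext fun _ => (weightedMean_apply _ _ fun _ _ => rfl).symm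

lemma contDiff_radialMean {Θ : V → W} (hΘ : ContDiff ℝ ∞ Θ) : ContDiff ℝ ∞ (radialMean Θ) := by
  rw [radialMean_eq hΘ.continuous]
  have h1 : ContDiff ℝ ∞ fun y : V => timeMul (constMap y) :=
    (timeMul ∘L constMap : V →L[ℝ] C(TimeInterval, V)).contDiff
  have h2 := (contDiff_postcomp (K := TimeInterval) hΘ).comp h1
  exact ContDiff.comp (g := ⇑(weightedMean : C(TimeInterval, W) →L[ℝ] W))
    (ContinuousLinearMap.contDiff _) h2

lemma fderiv_radialMean {Θ : V → W} (hΘ : ContDiff ℝ ∞ Θ) (y p : V) :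
    fderiv ℝ (radialMean Θ) y p = ∫ t in (0 : ℝ)..1, t • fderiv ℝ Θ (t • y) (t • p) := by
  have h1 : HasFDerivAt (fun y : V => timeMul (constMap y))
      (timeMul ∘L constMap : V →L[ℝ] C(TimeInterval, V)) y :=
    (timeMul ∘L constMap : V →L[ℝ] C(TimeInterval, V)).hasFDerivAt
  have hΘ1 : ContDiff ℝ 1 Θ := hΘ.of_le (by exact_mod_cast le_top)
  have h2 := (hasFDerivAt_postcomp (K := TimeInterval) hΘ1 (timeMul (constMap y))).comp y h1
  have h3 := HasFDerivAt.comp (g := ⇑(weightedMean : C(TimeInterval, W) →L[ℝ] W)) y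
    (ContinuousLinearMap.hasFDerivAt _) h2
  rw [radialMean_eq hΘ.continuous]
  have h4 := h3.fderiv
  refine (congrArg (fun L : V →L[ℝ] W => L p) h4).trans ?_
  exact weightedMean_apply _ (fun t => fderiv ℝ Θ (t • y) (t • p)) fun _ _ => rfl

section Ray

variable {Θ : V → W} (hΘ : ContDiff ℝ ∞ Θ) (L : W →L[ℝ] ℝ) (y p : V)

include hΘ

lemma continuous_ray : Continuous fun t : ℝ => L (Θ (t • y)) :=
  L.continuous.comp (hΘ.continuous.comp (continuous_id.smul continuous_const))

lemma continuous_fderiv_ray : Continuous fun t : ℝ => L (fderiv ℝ Θ (t • y) p) :=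
  L.continuous.comp (((hΘ.continuous_fderiv (by simp)).comp
    (continuous_id.smul continuous_const)).clm_apply continuous_const)

lemma apply_radialMean [CompleteSpace W] :
    L (radialMean Θ y) = ∫ t in (0 : ℝ)..1, t * L (Θ (t • y)) := by
  have hc : Continuous fun t : ℝ => t • Θ (t • y) :=
    continuous_id.smul (hΘ.continuous.comp (continuous_id.smul continuous_const))
  rw [radialMean, ← ContinuousLinearMap.intervalIntegral_comp_comm _ (hc.intervalIntegrable _ _)]
  simp only [map_smul, smul_eq_mul]

lemma apply_fderiv_radialMean [CompleteSpace W] : L (fderiv ℝ (radialMean Θ) y p) =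
    ∫ t in (0 : ℝ)..1, t * (t * L (fderiv ℝ Θ (t • y) p)) := by
  have hc : Continuous fun t : ℝ => t • fderiv ℝ Θ (t • y) (t • p) :=
    continuous_id.smul (((hΘ.continuous_fderiv (by simp)).comp
      (continuous_id.smul continuous_const)).clm_apply (continuous_id.smul continuous_const))
  rw [fderiv_radialMean hΘ, ← ContinuousLinearMap.intervalIntegral_comp_comm _
    (hc.intervalIntegrable _ _)]
  simp only [map_smul, smul_eq_mul]

lemma hasDerivAt_sq_mul_ray (t : ℝ) : HasDerivAt (fun t : ℝ => t ^ 2 * L (Θ (t • y)))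
    (2 * t * L (Θ (t • y)) + t ^ 2 * L (fderiv ℝ Θ (t • y) y)) t := by
  have e1 : HasDerivAt (fun t : ℝ => t • y) y t := by
    simpa using (hasDerivAt_id t).smul_const y
  have e2 := ((hΘ.differentiable (by simp) (t • y)).hasFDerivAt).comp_hasDerivAt t e1
  have e3 := L.hasFDerivAt.comp_hasDerivAt t e2
  refine HasDerivAt.congr_deriv ((hasDerivAt_pow 2 t).mul e3) ?_
  simp

end Ray

lemma fderiv_apply_self {I : V → V →L[ℝ] W} {y : V} (hI : DifferentiableAt ℝ I y) (p : V) :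
    fderiv ℝ (fun y => I y y) y p = I y p + fderiv ℝ I y p y := by
  have h := (hI.hasFDerivAt.clm_apply (hasFDerivAt_id y)).fderiv
  exact congrArg (fun L : V →L[ℝ] W => L p) h

/-- Evaluation of a bilinear form at a pair of vectors. -/
noncomputable def evalPair (p q : V) : (V →L[ℝ] V →L[ℝ] ℝ) →L[ℝ] ℝ :=
  ContinuousLinearMap.apply ℝ ℝ q ∘L ContinuousLinearMap.apply ℝ (V →L[ℝ] ℝ) p

lemma evalPair_apply (p q : V) (L : V →L[ℝ] V →L[ℝ] ℝ) : evalPair p q L = L p q := rfl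

/-- The Poincaré lemma for smooth 2-forms that are closed on a ball: a primitive of `Θ` is
`y ↦ (∫₀¹ t Θ(t y) dt) y`. -/
lemma exists_primitive_of_closed {Θ : V → V →L[ℝ] V →L[ℝ] ℝ} (hΘ : ContDiff ℝ ∞ Θ) {r : ℝ}
    (hanti : ∀ y ∈ Metric.ball (0 : V) r, ∀ p q, Θ y p q = -Θ y q p)
    (hclosed : ∀ y ∈ Metric.ball (0 : V) r, ∀ u p q,
      fderiv ℝ Θ y p u q - fderiv ℝ Θ y q u p = fderiv ℝ Θ y u p q) :
    ∃ α : V → V →L[ℝ] ℝ, ContDiff ℝ ∞ α ∧ ∀ y ∈ Metric.ball (0 : V) r, ∀ p q,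
      fderiv ℝ α y p q - fderiv ℝ α y q p = Θ y p q := by
  have hI := contDiff_radialMean hΘ
  refine ⟨fun y => radialMean Θ y y, hI.clm_apply contDiff_id, fun y hy p q => ?_⟩
  have hD : ∀ p q, fderiv ℝ (fun y => radialMean Θ y y) y p q =
      (∫ t in (0 : ℝ)..1, t * evalPair p q (Θ (t • y))) +
        ∫ t in (0 : ℝ)..1, t * (t * evalPair y q (fderiv ℝ Θ (t • y) p)) := by
    intro p q
    rw [fderiv_apply_self (hI.differentiable (by simp) y), ← apply_radialMean hΘ,
      ← apply_fderiv_radialMean hΘ]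
    rfl
  have hi1 : ∀ p q, IntervalIntegrable (fun t : ℝ => t * evalPair p q (Θ (t • y)))
      MeasureTheory.volume 0 1 :=
    fun p q => (continuous_id.mul (continuous_ray hΘ _ _)).intervalIntegrable _ _
  have hi2 : ∀ u p q, IntervalIntegrable
      (fun t : ℝ => t * (t * evalPair u q (fderiv ℝ Θ (t • y) p))) MeasureTheory.volume 0 1 :=
    fun u p q => (continuous_id.mul (continuous_id.mul
      (continuous_fderiv_ray hΘ _ _ _))).intervalIntegrable _ _
  have hci : Continuous fun t : ℝ => 2 * t * evalPair p q (Θ (t • y)) +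
      t ^ 2 * evalPair p q (fderiv ℝ Θ (t • y) y) :=
    ((continuous_const.mul continuous_id).mul (continuous_ray hΘ _ _)).add
      ((continuous_pow 2).mul (continuous_fderiv_ray hΘ _ _ _))
  -- after the use of closedness, the integrand is the derivative of `t ↦ t² Θ(t y)(p, q)`
  have hftc := intervalIntegral.integral_eq_sub_of_hasDerivAt (a := 0) (b := 1)
    (fun t _ => hasDerivAt_sq_mul_ray hΘ (evalPair p q) y t) (hci.intervalIntegrable _ _)
  simp only [one_pow, one_smul, one_mul, ne_eq, OfNat.ofNat_ne_zero, not_false_eq_true, zero_pow,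
    zero_mul, sub_zero] at hftc
  rw [evalPair_apply] at hftc
  rw [hD, hD, ← hftc, ← intervalIntegral.integral_add (hi1 p q) (hi2 y p q),
    ← intervalIntegral.integral_add (hi1 q p) (hi2 y q p),
    ← intervalIntegral.integral_sub ((hi1 p q).add (hi2 y p q)) ((hi1 q p).add (hi2 y q p))]
  refine intervalIntegral.integral_congr fun t ht => ?_
  rw [uIcc_of_le zero_le_one] at ht
  have hty : t • y ∈ Metric.ball (0 : V) r := smul_mem_ball hy ht
  have e1 := hanti _ hty q p
  have e2 := hclosed _ hty y p q
  simp only [evalPair_apply]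
  rw [e1, ← e2]
  ring

lemma fderiv_comp_translation {f : V → W} {y x : V} (hf : DifferentiableAt ℝ f (y + x)) :
    fderiv ℝ (fun y => f (y + x)) y = fderiv ℝ f (y + x) := by
  have h := (HasFDerivAt.comp (g := f) y hf.hasFDerivAt ((hasFDerivAt_id y).add_const x)).fderiv
  exact h

/-- The Poincaré lemma for germs of closed 2-forms. -/
lemma exists_local_primitive [FiniteDimensional ℝ V] {θ : V → V [⋀^Fin 2]→L[ℝ] ℝ} {O : Set V}
    (hO : IsOpen O) (hθ : ContDiffOn ℝ ∞ (fun y => toBilin (θ y)) O)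
    (hθ' : ∀ y ∈ O, DifferentiableAt ℝ θ y) (hd : ∀ y ∈ O, extDeriv θ y = 0) {x : V}
    (hx : x ∈ O) : ∃ α : V → V →L[ℝ] ℝ, ContDiff ℝ ∞ α ∧ ∀ᶠ y in 𝓝 x, ∀ p q,
      fderiv ℝ α y p q - fderiv ℝ α y q p = θ y ![p, q] := by
  obtain ⟨g, hg, hgθ⟩ := exists_contDiff_eventuallyEq hO hθ hx
  have h1 : ∀ᶠ y in 𝓝 x, y ∈ O ∧ g =ᶠ[𝓝 y] fun y => toBilin (θ y) :=
    (hO.eventually_mem hx).and hgθ.eventually_nhds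
  obtain ⟨r, hr, hball⟩ := Metric.eventually_nhds_iff_ball.1 h1
  have hshift : ∀ y ∈ Metric.ball (0 : V) r, y + x ∈ Metric.ball x r := by
    intro y hy
    rw [mem_ball_iff_norm, add_sub_cancel_right]
    rwa [mem_ball_zero_iff] at hy
  have hgx : ContDiff ℝ ∞ fun y => g (y + x) := hg.comp (contDiff_id.add contDiff_const)
  obtain ⟨α, hα, hαd⟩ := exists_primitive_of_closed hgx (r := r)
    (fun y hy p q => by
      rw [(hball _ (hshift y hy)).2.self_of_nhds]
      exact form_swap (θ (y + x)) p q) (fun y hy u p q => by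
      obtain ⟨h2, h3⟩ := hball _ (hshift y hy)
      have hfd : ∀ p, fderiv ℝ (fun y => g (y + x)) y p = toBilin (fderiv ℝ θ (y + x) p) := by
        intro p
        rw [fderiv_comp_translation (hg.differentiable (by simp) _), h3.fderiv_eq]
        exact congrArg (fun L => L p) (hasFDerivAt_toBilin (hθ' _ h2).hasFDerivAt).fderiv
      have h5 := fderiv_closed (hθ' _ h2) (hd _ h2) p u q
      rw [hfd, hfd, hfd, toBilin_apply, toBilin_apply, toBilin_apply]
      rw [form_swap _ p u] at h5
      linarith)
  refine ⟨fun y => α (y + -x), hα.comp (contDiff_id.add contDiff_const), ?_⟩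
  filter_upwards [Metric.ball_mem_nhds x hr] with y hy p q
  have h2 : y + -x ∈ Metric.ball (0 : V) r := by
    rw [mem_ball_zero_iff, ← sub_eq_add_neg]
    rwa [mem_ball_iff_norm] at hy
  have h3 := hαd _ h2 p q
  rw [neg_add_cancel_right, (hball y hy).2.self_of_nhds, toBilin_apply] at h3
  rw [fderiv_comp_translation (hα.differentiable (by simp) _), h3]

/-- The pull-back of a smooth family of 2-forms under a smooth family of linear maps is smooth. -/
lemma contDiffAt_toBilin_pullback {U : Type} [NormedAddCommGroup U] [NormedSpace ℝ U]
    {η : U → W [⋀^Fin 2]→L[ℝ] ℝ} {A : U → V →L[ℝ] W} {y : U} (hη : ContDiffAt ℝ ∞ η y)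
    (hA : ContDiffAt ℝ ∞ A y) :
    ContDiffAt ℝ ∞ (fun y => toBilin ((η y).compContinuousLinearMap (A y))) y := by
  have h1 : (fun y => toBilin ((η y).compContinuousLinearMap (A y))) = fun y =>
      ((ContinuousLinearMap.compL ℝ V W ℝ).flip (A y)) ∘L (toBilin (η y) ∘L A y) := by
    funext y
    ext p q
    refine congrArg (η y) (funext fun i => ?_)
    fin_cases i <;> rfl
  rw [h1]
  have h2 : ContDiffAt ℝ ∞ (fun y => (ContinuousLinearMap.compL ℝ V W ℝ).flip (A y)) y :=
    ContDiffAt.comp (g := ⇑((ContinuousLinearMap.compL ℝ V W ℝ).flip)) y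
      (ContinuousLinearMap.contDiff _).contDiffAt hA
  exact h2.clm_comp ((contDiffAt_toBilin hη).clm_comp hA)

end Poincare

/-! ### Local Lagrangian sections -/

namespace LagrangianFibration

variable {n : ℕ} {B : Type u} [TopologicalSpace B] [ChartedSpace (E n) B]
  {F : LagrangianFibration.{u, v} n B} [IsManifold 𝓘(ℝ, E n) ∞ B]

/-- Every local section `s` can be translated to a Lagrangian one: in a chart of the base the
pull-back of the symplectic form under `s` is closed, hence of the form `dα`, and the translation by
`-α` subtracts `dα`. -/
theorem exists_isLagrangianAt (hF : F.IsProper) {s : B → F.carrier} {b : B}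
    (hs : F.IsSectionAt s b) : ∃ σ : B → F.carrier, F.IsLagrangianAt σ b := by
  let e := chartAt (E n) b
  have he : e ∈ atlas _ B := chart_mem_atlas _ _
  have hb : b ∈ e.source := mem_chart_source _ _
  let ε := chartAt (E (2 * n)) (s b)
  have hε : ε ∈ atlas _ F.carrier := chart_mem_atlas _ _
  have hsε : s b ∈ ε.source := mem_chart_source _ _
  have hev : ∀ᶠ b' in 𝓝 b, F.IsSectionAt s b' ∧ s b' ∈ ε.source :=
    hs.eventually.and (hs.smooth.continuousAt.eventually (ε.open_source.mem_nhds hsε))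
  obtain ⟨U, hU, hUo, hbU⟩ := eventually_nhds_iff.1 hev
  let O : Set (E n) := e.target ∩ e.symm ⁻¹' U
  have hO : IsOpen O := e.isOpen_inter_preimage_symm hUo
  let g : E n → E (2 * n) := fun y => ε (s (e.symm y))
  have hgs : ∀ y ∈ O, SmoothAt (V₁ := E n) (V₂ := E (2 * n)) (fun y => s (e.symm y)) y := fun y hy =>
    ContMDiffAt.comp (g := s) y (hU _ hy.2).1.smooth (smoothAt_chart_symm he hy.1)
  have hg : ∀ y ∈ O, SmoothAt (V₁ := E n) (V₂ := E (2 * n)) g y := fun y hy =>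
    ContMDiffAt.comp (g := ε) (f := fun y => s (e.symm y)) y
      (smoothAt_chart hε (hU _ hy.2).2) (hgs y hy)
  have hgc : ∀ y ∈ O, ContDiffAt ℝ ∞ g y := fun y hy => contMDiffAt_iff_contDiffAt.1 (hg y hy)
  have hgt : ∀ y ∈ O, g y ∈ ε.target := fun y hy => ε.map_source (hU _ hy.2).2
  let θ : E n → (E n) [⋀^Fin 2]→L[ℝ] ℝ := fun y =>
    (chartForm F.form ε (g y)).compContinuousLinearMap (fderiv ℝ g y)
  have hη : ∀ y ∈ O, ContDiffAt ℝ ∞ (chartForm F.form ε) (g y) := fun y hy =>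
    (F.symplectic.smooth ε hε).contDiffAt (ε.open_target.mem_nhds (hgt y hy))
  have hθ : ContDiffOn ℝ ∞ (fun y => toBilin (θ y)) O := by
    intro y hy
    have h1 : ContDiffAt ℝ ∞ (fun y => chartForm F.form ε (g y)) y := (hη y hy).comp y (hgc y hy)
    have h2 : ContDiffAt ℝ ∞ (fderiv ℝ g) y := (hgc y hy).fderiv_right (by simp)
    exact (contDiffAt_toBilin_pullback h1 h2).contDiffWithinAt
  have hθ' : ∀ y ∈ O, DifferentiableAt ℝ θ y := by
    intro y hy
    have h1 : ContDiffAt ℝ ∞ (fun y => chartForm F.form ε (g y)) y := (hη y hy).comp y (hgc y hy)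
    have h2 : ContDiffAt ℝ ∞ (fderiv ℝ g) y := (hgc y hy).fderiv_right (by simp)
    exact ((h1.differentiableAt (by simp)).hasFDerivAt.continuousAlternatingMapCompContinuousLinearMap
      (h2.differentiableAt (by simp)).hasFDerivAt).differentiableAt
  have hd : ∀ y ∈ O, extDeriv θ y = 0 := by
    intro y hy
    have h1 := extDeriv_pullback ((hη y hy).differentiableAt (by simp)) (hgc y hy)
      minSmoothness_le_infty
    refine h1.trans ?_
    rw [F.symplectic.closed ε hε _ (hgt y hy)]
    rfl
  have hx : e b ∈ O := ⟨e.map_source hb, by rw [mem_preimage, e.left_inv hb]; exact hbU⟩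
  obtain ⟨α, hα, hαd⟩ := exists_local_primitive hO hθ hθ' hd hx
  have hαs : ∀ b' ∈ e.source, SmoothAt (V₁ := E n) (V₂ := Cov n) (fun b => -α (e b)) b' := by
    intro b' hb'
    exact ContMDiffAt.comp (g := fun y => -α y) b' hα.neg.contMDiff.contMDiffAt
      (smoothAt_chart he hb')
  have hαe : ∀ᶠ b' in 𝓝 b, SmoothAt (V₁ := E n) (V₂ := Cov n) (fun b => -α (e b)) b' := by
    filter_upwards [e.open_source.mem_nhds hb] with b' hb' using hαs b' hb'
  refine ⟨fun b => F.chartFlow e (-α (e b)) (s b), ?_⟩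
  have hc : Tendsto e (𝓝 b) (𝓝 (e b)) := e.continuousAt hb
  filter_upwards [e.open_source.mem_nhds hb, hUo.mem_nhds hbU, hc.eventually hαd,
    hαe.eventually_nhds] with b' hb' hbU' hαb' hαe'
  have hsb' := (hU b' hbU').1
  refine ⟨isSectionAt_translate hF he hb' hsb' hαe', fun p q => ?_⟩
  rw [form_translate_section hF he hb' hsb' (hαs b' hb')]
  have hyO : e b' ∈ O := ⟨e.map_source hb', by rw [mem_preimage, e.left_inv hb']; exact hbU'⟩
  have hDα : ∀ p, (D (fun b => -α (e b)) b' : E n →L[ℝ] Cov n) p =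
      -fderiv ℝ α (e b') ((D e b' : E n →L[ℝ] E n) p) := by
    intro p
    have h1 : SmoothAt (V₁ := E n) (V₂ := Cov n) (fun y => -α y) (e b') :=
      hα.neg.contMDiff.contMDiffAt
    rw [D_comp_apply (g := fun y => -α y) h1.mdiff (smoothAt_chart he hb').mdiff, D_eq_fderiv,
      fderiv_fun_neg]
    rfl
  have hDg : ∀ p, fderiv ℝ g (e b') ((D e b' : E n →L[ℝ] E n) p) =
      (D ε (s b') : E (2 * n) →L[ℝ] E (2 * n)) ((D s b' : E n →L[ℝ] E (2 * n)) p) := by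
    intro p
    rw [← D_eq_fderiv, ← D_comp_apply (hg _ hyO).mdiff (smoothAt_chart he hb').mdiff,
      ← D_comp_apply (smoothAt_chart hε (hU _ hbU').2).mdiff hsb'.smooth.mdiff]
    refine congrArg (fun L : E n →L[ℝ] E (2 * n) => L p) (D_congr ?_)
    filter_upwards [e.open_source.mem_nhds hb'] with z hz
    simp only [g]
    rw [e.left_inv hz]
  have h1 := hαb' ((D e b' : E n →L[ℝ] E n) p) ((D e b' : E n →L[ℝ] E n) q)
  have h2 : θ (e b') ![(D e b' : E n →L[ℝ] E n) p, (D e b' : E n →L[ℝ] E n) q] =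
      F.ω₂ (s b') ![(D s b' : E n →L[ℝ] E (2 * n)) p, (D s b' : E n →L[ℝ] E (2 * n)) q] := by
    have h3 : θ (e b') ![(D e b' : E n →L[ℝ] E n) p, (D e b' : E n →L[ℝ] E n) q] =
        chartForm F.form ε (g (e b')) ![fderiv ℝ g (e b') ((D e b' : E n →L[ℝ] E n) p),
          fderiv ℝ g (e b') ((D e b' : E n →L[ℝ] E n) q)] := by
      refine congrArg (chartForm F.form ε (g (e b'))) (funext fun i => ?_)
      fin_cases i <;> rfl
    have h4 : g (e b') = ε (s b') := by simp only [g]; rw [e.left_inv hb']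
    rw [h3, hDg, hDg, h4, chartForm_apply, D_symm_chart hε (hU _ hbU').2,
      D_symm_chart hε (hU _ hbU').2, ε.left_inv (hU _ hbU').2]
  rw [hDα, hDα, ← h2, ← h1]
  simp only [neg_apply]
  ring

end LagrangianFibration

/-! ### Isomorphisms over open sets -/

namespace LagrangianFibration

variable {n : ℕ} {B : Type u} [TopologicalSpace B] [ChartedSpace (E n) B]

/-- The maps `f` and `g` are mutually inverse symplectic maps over `U`. -/
structure IsIsoOn (F G : LagrangianFibration.{u, v} n B) (U : Set B) (f : F.carrier → G.carrier)
    (g : G.carrier → F.carrier) : Prop where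
  map : ∀ x, F.proj x ∈ U → F.IsMorphismAt G f x
  inv : ∀ y, G.proj y ∈ U → G.IsMorphismAt F g y
  left : ∀ x, F.proj x ∈ U → g (f x) = x
  right : ∀ y, G.proj y ∈ U → f (g y) = y

variable {F G H : LagrangianFibration.{u, v} n B} {U : Set B} {f : F.carrier → G.carrier}
  {g : G.carrier → F.carrier}

namespace IsIsoOn

lemma symm (h : F.IsIsoOn G U f g) : G.IsIsoOn F U g f := ⟨h.inv, h.map, h.right, h.left⟩

lemma mono (h : F.IsIsoOn G U f g) {V : Set B} (hV : V ⊆ U) : F.IsIsoOn G V f g :=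
  ⟨fun x hx => h.map x (hV hx), fun x hx => h.inv x (hV hx), fun x hx => h.left x (hV hx),
    fun x hx => h.right x (hV hx)⟩

lemma proj_map (h : F.IsIsoOn G U f g) {x : F.carrier} (hx : F.proj x ∈ U) :
    G.proj (f x) = F.proj x := (h.map x hx).proj_apply

lemma proj_inv (h : F.IsIsoOn G U f g) {y : G.carrier} (hy : G.proj y ∈ U) :
    F.proj (g y) = G.proj y := (h.inv y hy).proj_apply

lemma comp {f' : G.carrier → H.carrier} {g' : H.carrier → G.carrier} (h' : G.IsIsoOn H U f' g')
    (h : F.IsIsoOn G U f g) : F.IsIsoOn H U (fun x => f' (f x)) (fun y => g (g' y)) := by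
  refine ⟨fun x hx => (h'.map _ ?_).comp (h.map x hx), fun y hy => (h.inv _ ?_).comp (h'.inv y hy),
    fun x hx => ?_, fun y hy => ?_⟩
  · rwa [h.proj_map hx]
  · rwa [h'.proj_inv hy]
  · rw [h'.left _ (by rwa [h.proj_map hx]), h.left x hx]
  · rw [h.right _ (by rwa [h'.proj_inv hy]), h'.right y hy]

/-- Being an isomorphism over an open set is a local property. -/
lemma of_local (h : ∀ b ∈ U, ∃ V : Set B, IsOpen V ∧ b ∈ V ∧ ∃ f' g', F.IsIsoOn G V f' g' ∧
    (∀ x, F.proj x ∈ V → f x = f' x) ∧ ∀ y, G.proj y ∈ V → g y = g' y) : F.IsIsoOn G U f g := by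
  have hx : ∀ x, F.proj x ∈ U → F.IsMorphismAt G f x ∧ g (f x) = x := by
    intro x hx
    obtain ⟨V, hVo, hxV, f', g', h1, h2, h3⟩ := h _ hx
    refine ⟨(h1.map x hxV).congr ?_, ?_⟩
    · filter_upwards [(hVo.preimage F.continuous_proj).mem_nhds hxV] with z hz using h2 z hz
    · rw [h2 x hxV, h3 _ (by rwa [h1.proj_map hxV]), h1.left x hxV]
  have hy : ∀ y, G.proj y ∈ U → G.IsMorphismAt F g y ∧ f (g y) = y := by
    intro y hy
    obtain ⟨V, hVo, hyV, f', g', h1, h2, h3⟩ := h _ hy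
    refine ⟨(h1.inv y hyV).congr ?_, ?_⟩
    · filter_upwards [(hVo.preimage G.continuous_proj).mem_nhds hyV] with z hz using h3 z hz
    · rw [h3 y hyV, h2 _ (by rwa [h1.proj_inv hyV]), h1.right y hyV]
  exact ⟨fun x h => (hx x h).1, fun y h => (hy y h).1, fun x h => (hx x h).2, fun y h => (hy y h).2⟩

/-- The isomorphism over an open set that is given by two mutually inverse maps. -/
noncomputable def isoOver {U : Opens B} (h : F.IsIsoOn G U f g) : F.IsoOver G U where
  map :=
    { toFun := f
      invFun := g
      source := F.proj ⁻¹' U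
      target := G.proj ⁻¹' U
      map_source' := fun x hx => by rw [mem_preimage, h.proj_map hx]; exact hx
      map_target' := fun y hy => by rw [mem_preimage, h.proj_inv hy]; exact hy
      left_inv' := fun x hx => h.left x hx
      right_inv' := fun y hy => h.right y hy
      open_source := U.isOpen.preimage F.continuous_proj
      open_target := U.isOpen.preimage G.continuous_proj
      contMDiffOn_toFun := fun x hx => (h.map x hx).smooth.contMDiffWithinAt
      contMDiffOn_invFun := fun y hy => (h.inv y hy).smooth.contMDiffWithinAt }
  source_eq := rfl
  target_eq := rfl
  proj_map := fun x hx => h.proj_map hx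
  form_map := fun x hx a c => (h.map x hx).form a c

end IsIsoOn

/-- The isomorphisms over an open set are given by mutually inverse maps. -/
lemma IsoOver.isIsoOn {U : Opens B} (φ : F.IsoOver G U) :
    F.IsIsoOn G U φ.map φ.map.invFun := by
  have hs : ∀ x, F.proj x ∈ U → x ∈ φ.map.source := fun x hx => by rw [φ.source_eq]; exact hx
  have ht : ∀ y, G.proj y ∈ U → y ∈ φ.map.target := fun y hy => by rw [φ.target_eq]; exact hy
  have hto : IsOpen (G.proj ⁻¹' (U : Set B)) := U.isOpen.preimage G.continuous_proj
  have hmap : ∀ x, F.proj x ∈ U → F.IsMorphismAt G φ.map x := by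
    intro x hx
    refine ⟨φ.map.contMDiffOn_toFun.contMDiffAt (φ.map.open_source.mem_nhds (hs x hx)), ?_,
      φ.form_map x hx⟩
    filter_upwards [φ.map.open_source.mem_nhds (hs x hx)] with y hy
    exact φ.proj_map y (by rw [← φ.source_eq]; exact hy)
  have hproj : ∀ y, G.proj y ∈ U → F.proj (φ.map.invFun y) = G.proj y := by
    intro y hy
    have h1 : φ.map.invFun y ∈ F.proj ⁻¹' (U : Set B) := by
      rw [← φ.source_eq]; exact φ.map.map_target' (ht y hy)
    rw [← φ.proj_map _ h1]
    exact congrArg G.proj (φ.map.right_inv' (ht y hy))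
  refine ⟨hmap, fun y hy => ?_, fun x hx => φ.map.left_inv' (hs x hx),
    fun y hy => φ.map.right_inv' (ht y hy)⟩
  have hsm : SmoothAt (V₁ := E (2 * n)) (V₂ := E (2 * n)) φ.map.invFun y :=
    φ.map.contMDiffOn_invFun.contMDiffAt (φ.map.open_target.mem_nhds (ht y hy))
  have hinv : ∀ᶠ z in 𝓝 y, φ.map (φ.map.invFun z) = z := by
    filter_upwards [hto.mem_nhds hy] with z hz using φ.map.right_inv' (ht z hz)
  refine ⟨hsm, ?_, fun u w => ?_⟩
  · filter_upwards [hto.mem_nhds hy] with z hz using hproj z hz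
  · have hm := hmap (φ.map.invFun y) (by rw [hproj y hy]; exact hy)
    rw [← hm.form, ← D_comp_apply hm.smooth.mdiff hsm.mdiff,
      ← D_comp_apply hm.smooth.mdiff hsm.mdiff, D_id_apply hinv, D_id_apply hinv,
      hinv.self_of_nhds]

lemma isomorphic_iff : F.Isomorphic G ↔ ∃ f g, F.IsIsoOn G univ f g := by
  constructor
  · rintro ⟨φ⟩
    exact ⟨_, _, φ.isIsoOn⟩
  · rintro ⟨f, g, h⟩
    exact ⟨IsIsoOn.isoOver (U := ⊤) (by exact h)⟩

lemma locallyIsomorphic_iff : F.LocallyIsomorphic G ↔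
    ∀ b, ∃ U : Opens B, b ∈ U ∧ ∃ f g, F.IsIsoOn G U f g := by
  constructor
  · intro h b
    obtain ⟨U, hb, ⟨φ⟩⟩ := h b
    exact ⟨U, hb, _, _, φ.isIsoOn⟩
  · intro h b
    obtain ⟨U, hb, f, g, hfg⟩ := h b
    exact ⟨U, hb, ⟨hfg.isoOver⟩⟩

lemma LocallyIsomorphic.symm (h : F.LocallyIsomorphic G) : G.LocallyIsomorphic F := by
  rw [locallyIsomorphic_iff] at h ⊢
  intro b
  obtain ⟨U, hb, f, g, hfg⟩ := h b
  exact ⟨U, hb, g, f, hfg.symm⟩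

lemma LocallyIsomorphic.trans (h : F.LocallyIsomorphic G) (h' : G.LocallyIsomorphic H) :
    F.LocallyIsomorphic H := by
  rw [locallyIsomorphic_iff] at h h' ⊢
  intro b
  obtain ⟨U, hb, f, g, hfg⟩ := h b
  obtain ⟨U', hb', f', g', hfg'⟩ := h' b
  exact ⟨U ⊓ U', ⟨hb, hb'⟩, _, _,
    (hfg'.mono (V := (U ⊓ U' : Opens B)) inter_subset_right).comp (hfg.mono inter_subset_left)⟩

lemma Isomorphic.refl (F : LagrangianFibration.{u, v} n B) : F.Isomorphic F :=
  isomorphic_iff.2 ⟨id, id, fun x _ => isMorphismAt_id F x, fun x _ => isMorphismAt_id F x,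
    fun _ _ => rfl, fun _ _ => rfl⟩

lemma Isomorphic.symm (h : F.Isomorphic G) : G.Isomorphic F := by
  obtain ⟨f, g, hfg⟩ := isomorphic_iff.1 h
  exact isomorphic_iff.2 ⟨g, f, hfg.symm⟩

lemma Isomorphic.trans (h : F.Isomorphic G) (h' : G.Isomorphic H) : F.Isomorphic H := by
  obtain ⟨f, g, hfg⟩ := isomorphic_iff.1 h
  obtain ⟨f', g', hfg'⟩ := isomorphic_iff.1 h'
  exact isomorphic_iff.2 ⟨_, _, hfg'.comp hfg⟩

/-- Isomorphisms over the members of an open covering that agree on the overlaps fit together. -/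
lemma isomorphic_of_cover {ι : Type*} (U : ι → Opens B) (hU : ∀ b, ∃ i, b ∈ U i)
    (f : ι → F.carrier → G.carrier) (g : ι → G.carrier → F.carrier)
    (h : ∀ i, F.IsIsoOn G (U i) (f i) (g i))
    (hf : ∀ i j x, F.proj x ∈ U i → F.proj x ∈ U j → f i x = f j x) : F.Isomorphic G := by
  choose k hk using hU
  refine isomorphic_iff.2 ⟨fun x => f (k (F.proj x)) x, fun y => g (k (G.proj y)) y,
    IsIsoOn.of_local fun b _ => ⟨U (k b), (U (k b)).isOpen, hk b, f (k b), g (k b), h (k b),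
      fun x hx => hf _ _ x (hk _) hx, fun y hy => ?_⟩⟩
  have h1 : F.proj (g (k b) y) = G.proj y := (h (k b)).proj_inv hy
  have h2 := hf (k (G.proj y)) (k b) (g (k b) y) (by rw [h1]; exact hk _) (by rw [h1]; exact hy)
  rw [(h (k b)).right y hy] at h2
  have h3 := (h (k (G.proj y))).left (g (k b) y) (by rw [h1]; exact hk _)
  rw [h2] at h3
  exact h3

/-! ### Properties that pass to locally isomorphic fibrations -/

lemma IsProper.of_locallyIsomorphic (hF : F.IsProper) (h : F.LocallyIsomorphic G) :
    G.IsProper := by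
  rw [locallyIsomorphic_iff] at h
  unfold IsProper at hF ⊢
  rw [isProperMap_iff_ultrafilter] at hF ⊢
  refine ⟨G.continuous_proj, fun 𝒰 b hb => ?_⟩
  obtain ⟨U, hbU, f, g, hfg⟩ := h b
  have hev : ∀ᶠ y in (𝒰 : Filter G.carrier), G.proj y ∈ U := hb.eventually (U.isOpen.mem_nhds hbU)
  have h1 : Tendsto F.proj (𝒰.map g : Ultrafilter F.carrier) (𝓝 b) := by
    rw [Ultrafilter.coe_map, tendsto_map'_iff]
    refine hb.congr' ?_
    filter_upwards [hev] with y hy using (hfg.proj_inv hy).symm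
  obtain ⟨x, hx, hxU⟩ := hF.2 h1
  have hxU' : F.proj x ∈ (U : Set B) := by rw [hx]; exact hbU
  refine ⟨f x, by rw [hfg.proj_map hxU', hx], ?_⟩
  have h2 : Tendsto f (𝒰.map g : Ultrafilter F.carrier) (𝓝 (f x)) :=
    Tendsto.mono_left (hfg.map x hxU').smooth.continuousAt hxU
  rw [Ultrafilter.coe_map, tendsto_map'_iff] at h2
  have h3 : Tendsto (fun y : G.carrier => y) 𝒰 (𝓝 (f x)) := by
    refine h2.congr' ?_
    filter_upwards [hev] with y hy using hfg.right y hy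
  exact h3

lemma IsTame.of_locallyIsomorphic (hF : F.IsTame) (h : F.LocallyIsomorphic G) : G.IsTame := by
  refine ⟨hF.proper.of_locallyIsomorphic h, fun b => ?_⟩
  obtain ⟨U, hbU, f, g, hfg⟩ := locallyIsomorphic_iff.1 h b
  have h1 : f '' (F.proj ⁻¹' {b} ∩ F.regularLocus) = G.proj ⁻¹' {b} ∩ G.regularLocus := by
    ext y
    constructor
    · rintro ⟨x, ⟨rfl, hx⟩, rfl⟩
      exact ⟨hfg.proj_map hbU, (hfg.map x hbU).mem_regularLocus_iff.2 hx⟩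
    · rintro ⟨rfl, hy⟩
      exact ⟨g y, ⟨hfg.proj_inv hbU, (hfg.inv y hbU).mem_regularLocus_iff.2 hy⟩, hfg.right y hbU⟩
  rw [← h1]
  refine (hF.connected b).image f fun x hx => ?_
  refine (hfg.map x ?_).smooth.continuousAt.continuousWithinAt
  rw [show F.proj x = b from hx.1]
  exact hbU

lemma IsMorphismAt.isLagrangianAt {φ : F.carrier → G.carrier} {s : B → F.carrier} {b : B}
    (hs : F.IsLagrangianAt s b) (h : ∀ᶠ b' in 𝓝 b, F.IsMorphismAt G φ (s b')) :
    G.IsLagrangianAt (fun b => φ (s b)) b := by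
  filter_upwards [hs, h.eventually_nhds] with b' h1 h2
  refine ⟨?_, fun p q => ?_⟩
  · filter_upwards [h1.1, h2] with c h3 h4
    exact ⟨ContMDiffAt.comp (g := φ) c h4.smooth h3.1, h4.proj_apply.trans h3.2⟩
  · have hm := h2.self_of_nhds
    rw [D_comp_apply hm.smooth.mdiff h1.1.smooth.mdiff, D_comp_apply hm.smooth.mdiff
      h1.1.smooth.mdiff, hm.form, h1.2]

end LagrangianFibration

/-! ### Regluing -/

namespace LagrangianFibration

variable {n : ℕ} {B : Type u} [TopologicalSpace B] [ChartedSpace (E n) B]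

/-- Data for regluing the parts of `F` over the members of an open covering: bijections `φ i` of the
part over `U i`, with inverses `ψ i`, whose transitions `ψ i ∘ φ j` are symplectic. The bijections
themselves need not be continuous. The reglued fibration has the same points as `F`, and the smooth
structure over `U i` that makes `φ i` an isomorphism. -/
structure GluingData (F : LagrangianFibration.{u, v} n B) where
  ι : Type u
  U : ι → Opens B
  idx : B → ι
  mem_idx : ∀ b, b ∈ U (idx b)
  φ : ι → F.carrier → F.carrier
  ψ : ι → F.carrier → F.carrier
  proj_φ : ∀ i x, F.proj x ∈ U i → F.proj (φ i x) = F.proj x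
  proj_ψ : ∀ i x, F.proj x ∈ U i → F.proj (ψ i x) = F.proj x
  left : ∀ i x, F.proj x ∈ U i → ψ i (φ i x) = x
  right : ∀ i x, F.proj x ∈ U i → φ i (ψ i x) = x
  morphism : ∀ i j x, F.proj x ∈ U i → F.proj x ∈ U j → F.IsMorphismAt F (fun y => ψ i (φ j y)) x

namespace GluingData

variable {F : LagrangianFibration.{u, v} n B}

/-- The points of the reglued fibration. -/
structure Space (g : F.GluingData) where
  pt : F.carrier

variable (g : F.GluingData)

/-- The projection of the reglued fibration. -/
def proj (z : g.Space) : B := F.proj z.pt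

/-- The isomorphism of the part of `F` over `U i` with the part of the reglued fibration. -/
def glue (i : g.ι) (x : F.carrier) : g.Space := ⟨g.φ i x⟩

/-- The inverse of `glue`. -/
def unglue (i : g.ι) (z : g.Space) : F.carrier := g.ψ i z.pt

lemma proj_glue {i : g.ι} {x : F.carrier} (hx : F.proj x ∈ g.U i) :
    g.proj (g.glue i x) = F.proj x := g.proj_φ i x hx

lemma proj_unglue {i : g.ι} {z : g.Space} (hz : g.proj z ∈ g.U i) :
    F.proj (g.unglue i z) = g.proj z := g.proj_ψ i z.pt hz

lemma unglue_glue {i : g.ι} {x : F.carrier} (hx : F.proj x ∈ g.U i) :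
    g.unglue i (g.glue i x) = x := g.left i x hx

lemma glue_unglue {i : g.ι} {z : g.Space} (hz : g.proj z ∈ g.U i) :
    g.glue i (g.unglue i z) = z := by
  cases z
  exact congrArg Space.mk (g.right i _ hz)

instance : TopologicalSpace g.Space :=
  ⨆ i, TopologicalSpace.coinduced (fun x : F.proj ⁻¹' (g.U i : Set B) => g.glue i x) inferInstance

lemma isOpen_over (i : g.ι) : IsOpen (F.proj ⁻¹' (g.U i : Set B)) :=
  (g.U i).isOpen.preimage F.continuous_proj

lemma isOpen_iff {s : Set g.Space} :
    IsOpen s ↔ ∀ i, IsOpen (F.proj ⁻¹' (g.U i : Set B) ∩ g.glue i ⁻¹' s) := by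
  rw [isOpen_iSup_iff]
  refine forall_congr' fun i => ?_
  rw [isOpen_coinduced, ← Subtype.image_preimage_coe]
  exact (g.isOpen_over i).isOpenEmbedding_subtypeVal.isOpen_iff_image_isOpen

lemma continuous_proj : Continuous g.proj := by
  refine ⟨fun s hs => g.isOpen_iff.2 fun i => ?_⟩
  have h : F.proj ⁻¹' (g.U i : Set B) ∩ g.glue i ⁻¹' (g.proj ⁻¹' s) =
      F.proj ⁻¹' (g.U i : Set B) ∩ F.proj ⁻¹' s := by
    ext x
    refine and_congr_right fun hx => ?_
    simp only [mem_preimage]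
    rw [g.proj_glue hx]
  rw [h]
  exact (g.isOpen_over i).inter (hs.preimage F.continuous_proj)

/-- The map `glue i` as a homeomorphism. -/
def homeo (i : g.ι) : OpenPartialHomeomorph F.carrier g.Space where
  toFun := g.glue i
  invFun := g.unglue i
  source := F.proj ⁻¹' (g.U i : Set B)
  target := g.proj ⁻¹' (g.U i : Set B)
  map_source' := fun x hx => by rw [mem_preimage, g.proj_glue hx]; exact hx
  map_target' := fun z hz => by rw [mem_preimage, g.proj_unglue hz]; exact hz
  left_inv' := fun x hx => g.unglue_glue hx
  right_inv' := fun z hz => g.glue_unglue hz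
  open_source := g.isOpen_over i
  open_target := (g.U i).isOpen.preimage g.continuous_proj
  continuousOn_toFun := (continuousOn_open_iff (g.isOpen_over i)).2 fun s hs => g.isOpen_iff.1 hs i
  continuousOn_invFun := by
    refine (continuousOn_open_iff ((g.U i).isOpen.preimage g.continuous_proj)).2 fun s hs => ?_
    refine g.isOpen_iff.2 fun j => ?_
    have h : F.proj ⁻¹' (g.U j : Set B) ∩ g.glue j ⁻¹' (g.proj ⁻¹' (g.U i : Set B) ∩
        g.unglue i ⁻¹' s) = (F.proj ⁻¹' (g.U j : Set B) ∩ F.proj ⁻¹' (g.U i : Set B)) ∩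
        (fun y => g.ψ i (g.φ j y)) ⁻¹' s := by
      ext x
      simp only [mem_inter_iff, mem_preimage, and_assoc]
      refine and_congr_right fun hx => ?_
      rw [g.proj_glue hx]
      rfl
    rw [h]
    exact ContinuousOn.isOpen_inter_preimage (fun x hx =>
      (g.morphism i j x hx.2 hx.1).smooth.continuousAt.continuousWithinAt)
      ((g.isOpen_over j).inter (g.isOpen_over i)) hs

instance : ChartedSpace (E (2 * n)) g.Space where
  atlas := {e | ∃ i, ∃ ε ∈ atlas (E (2 * n)) F.carrier, e = (g.homeo i).symm ≫ₕ ε}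
  chartAt := fun z => (g.homeo (g.idx (g.proj z))).symm ≫ₕ
    chartAt (E (2 * n)) (g.unglue (g.idx (g.proj z)) z)
  mem_chart_source := fun _ => ⟨g.mem_idx _, mem_chart_source (E (2 * n)) _⟩
  chart_mem_atlas := fun _ => ⟨_, _, chart_mem_atlas (E (2 * n)) _, rfl⟩

instance : IsManifold 𝓘(ℝ, E (2 * n)) ∞ g.Space := by
  refine isManifold_of_contDiffOn _ _ _ ?_
  rintro _ _ ⟨i, ε, hε, rfl⟩ ⟨j, ε', hε', rfl⟩
  simp only [modelWithCornersSelf_coe, modelWithCornersSelf_coe_symm, Function.id_comp,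
    Function.comp_id, preimage_id, range_id, inter_univ]
  rintro y hy
  simp only [OpenPartialHomeomorph.trans_source, OpenPartialHomeomorph.symm_source,
    OpenPartialHomeomorph.trans_symm_eq_symm_trans_symm, OpenPartialHomeomorph.symm_symm,
    OpenPartialHomeomorph.coe_trans, mem_inter_iff, mem_preimage, Function.comp_apply] at hy
  obtain ⟨⟨hy1, hy2⟩, hy3, hy4⟩ := hy
  have hi : F.proj (ε.symm y) ∈ g.U i := hy2
  have hj : F.proj (ε.symm y) ∈ g.U j := by
    have h1 : g.proj (g.glue i (ε.symm y)) ∈ g.U j := hy3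
    rwa [g.proj_glue hi] at h1
  have h1 : SmoothAt (V₁ := E (2 * n)) (V₂ := E (2 * n)) (fun y => g.ψ j (g.φ i (ε.symm y))) y :=
    ContMDiffAt.comp (g := fun x => g.ψ j (g.φ i x)) y (g.morphism j i _ hj hi).smooth
      (smoothAt_chart_symm hε hy1)
  have h2 : SmoothAt (V₁ := E (2 * n)) (V₂ := E (2 * n)) (fun y => ε' (g.ψ j (g.φ i (ε.symm y)))) y :=
    ContMDiffAt.comp (g := ε') (f := fun y => g.ψ j (g.φ i (ε.symm y))) y (smoothAt_chart hε' hy4) h1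
  exact (contMDiffAt_iff_contDiffAt.1 h2).contDiffWithinAt

lemma exists_chart {i : g.ι} {x : F.carrier} (hx : F.proj x ∈ g.U i) :
    ∃ ε ∈ atlas (E (2 * n)) F.carrier, x ∈ ε.source ∧
      (g.homeo i).symm ≫ₕ ε ∈ atlas (E (2 * n)) g.Space ∧
      g.glue i x ∈ ((g.homeo i).symm ≫ₕ ε).source := by
  refine ⟨chartAt (E (2 * n)) x, chart_mem_atlas _ _, mem_chart_source _ _,
    ⟨i, _, chart_mem_atlas _ _, rfl⟩, ?_, ?_⟩
  · change g.proj (g.glue i x) ∈ g.U i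
    rwa [g.proj_glue hx]
  · change g.unglue i (g.glue i x) ∈ (chartAt (E (2 * n)) x).source
    rw [g.unglue_glue hx]
    exact mem_chart_source _ _

lemma smoothAt_glue {i : g.ι} {x : F.carrier} (hx : F.proj x ∈ g.U i) :
    SmoothAt (V₁ := E (2 * n)) (V₂ := E (2 * n)) (g.glue i) x := by
  obtain ⟨ε, hε, hxε, he, hxe⟩ := g.exists_chart hx
  have h1 := smoothAt_chart_symm he (((g.homeo i).symm ≫ₕ ε).map_source hxe)
  have h2 : ((g.homeo i).symm ≫ₕ ε) (g.glue i x) = ε x := congrArg ε (g.unglue_glue hx)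
  rw [h2] at h1
  have h3 := ContMDiffAt.comp (g := ((g.homeo i).symm ≫ₕ ε).symm) x h1 (smoothAt_chart hε hxε)
  refine h3.congr_of_eventuallyEq ?_
  filter_upwards [ε.open_source.mem_nhds hxε] with y hy
  exact congrArg (g.glue i) (ε.left_inv hy).symm

lemma smoothAt_unglue {i : g.ι} {z : g.Space} (hz : g.proj z ∈ g.U i) :
    SmoothAt (V₁ := E (2 * n)) (V₂ := E (2 * n)) (g.unglue i) z := by
  have hx : F.proj (g.unglue i z) ∈ g.U i := by rwa [g.proj_unglue hz]
  obtain ⟨ε, hε, hxε, he, hxe⟩ := g.exists_chart hx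
  rw [g.glue_unglue hz] at hxe
  have h1 := smoothAt_chart he hxe
  have h3 : SmoothAt (V₁ := E (2 * n)) (V₂ := E (2 * n))
      (fun z => ε.symm (((g.homeo i).symm ≫ₕ ε) z)) z :=
    ContMDiffAt.comp (g := ε.symm) z (smoothAt_chart_symm hε (ε.map_source hxε)) h1
  refine h3.congr_of_eventuallyEq ?_
  filter_upwards [((g.homeo i).symm ≫ₕ ε).open_source.mem_nhds hxe] with y hy
  exact (ε.left_inv hy.2).symm

/-- The symplectic form of the reglued fibration. -/
noncomputable def form (z : g.Space) : (TangentSpace 𝓘(ℝ, E (2 * n)) z) [⋀^Fin 2]→L[ℝ] ℝ :=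
  (F.ω₂ (g.unglue (g.idx (g.proj z)) z)).compContinuousLinearMap
    (D (g.unglue (g.idx (g.proj z))) z : E (2 * n) →L[ℝ] E (2 * n))

/-- The symplectic form at a point, as a form on the model space. -/
noncomputable def form₂ (z : g.Space) : (E (2 * n)) [⋀^Fin 2]→L[ℝ] ℝ := g.form z

lemma isOpen_proj_mem (i : g.ι) : IsOpen (g.proj ⁻¹' (g.U i : Set B)) :=
  (g.U i).isOpen.preimage g.continuous_proj

lemma form_apply {i : g.ι} {z : g.Space} (hz : g.proj z ∈ g.U i) (a b : E (2 * n)) :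
    g.form₂ z ![a, b] = F.ω₂ (g.unglue i z)
      ![(D (g.unglue i) z : E (2 * n) →L[ℝ] E (2 * n)) a,
        (D (g.unglue i) z : E (2 * n) →L[ℝ] E (2 * n)) b] := by
  set j := g.idx (g.proj z) with hj
  have hzj : g.proj z ∈ g.U j := g.mem_idx _
  have hm := g.morphism j i (g.unglue i z) (by rwa [g.proj_unglue hz]) (by rwa [g.proj_unglue hz])
  have h1 : g.unglue j =ᶠ[𝓝 z] fun z => g.ψ j (g.φ i (g.unglue i z)) := by
    filter_upwards [(g.isOpen_proj_mem i).mem_nhds hz] with w hw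
    exact congrArg (g.unglue j) (g.glue_unglue hw).symm
  have h2 : g.form₂ z ![a, b] = F.ω₂ (g.unglue j z)
      ![(D (g.unglue j) z : E (2 * n) →L[ℝ] E (2 * n)) a,
        (D (g.unglue j) z : E (2 * n) →L[ℝ] E (2 * n)) b] := by
    refine congrArg (F.ω₂ (g.unglue j z)) (funext fun k => ?_)
    fin_cases k <;> rfl
  rw [h2, D_congr h1, D_comp_apply (g := fun x => g.ψ j (g.φ i x)) hm.smooth.mdiff
    (g.smoothAt_unglue hz).mdiff, D_comp_apply (g := fun x => g.ψ j (g.φ i x)) hm.smooth.mdiff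
    (g.smoothAt_unglue hz).mdiff, h1.self_of_nhds, hm.form]

lemma D_unglue_glue {i : g.ι} {x : F.carrier} (hx : F.proj x ∈ g.U i) (a : E (2 * n)) :
    (D (g.unglue i) (g.glue i x) : E (2 * n) →L[ℝ] E (2 * n))
      ((D (g.glue i) x : E (2 * n) →L[ℝ] E (2 * n)) a) = a := by
  rw [← D_comp_apply (g.smoothAt_unglue (by rwa [g.proj_glue hx])).mdiff (g.smoothAt_glue hx).mdiff]
  refine D_id_apply ?_ a
  filter_upwards [(g.isOpen_over i).mem_nhds hx] with y hy using g.unglue_glue hy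

lemma D_glue_unglue {i : g.ι} {z : g.Space} (hz : g.proj z ∈ g.U i) (a : E (2 * n)) :
    (D (g.glue i) (g.unglue i z) : E (2 * n) →L[ℝ] E (2 * n))
      ((D (g.unglue i) z : E (2 * n) →L[ℝ] E (2 * n)) a) = a := by
  rw [← D_comp_apply (g.smoothAt_glue (by rwa [g.proj_unglue hz])).mdiff (g.smoothAt_unglue hz).mdiff]
  refine D_id_apply ?_ a
  filter_upwards [(g.isOpen_proj_mem i).mem_nhds hz] with y hy using g.glue_unglue hy

lemma form_glue {i : g.ι} {x : F.carrier} (hx : F.proj x ∈ g.U i) (a b : E (2 * n)) :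
    g.form₂ (g.glue i x) ![(D (g.glue i) x : E (2 * n) →L[ℝ] E (2 * n)) a,
      (D (g.glue i) x : E (2 * n) →L[ℝ] E (2 * n)) b] = F.ω₂ x ![a, b] := by
  rw [g.form_apply (i := i) (by rwa [g.proj_glue hx]), g.D_unglue_glue hx, g.D_unglue_glue hx,
    g.unglue_glue hx]

lemma chartForm_eq (i : g.ι) {ε : OpenPartialHomeomorph F.carrier (E (2 * n))}
    (hε : ε ∈ atlas (E (2 * n)) F.carrier) {y : E (2 * n)}
    (hy : y ∈ ((g.homeo i).symm ≫ₕ ε).target) :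
    chartForm g.form ((g.homeo i).symm ≫ₕ ε) y = chartForm F.form ε y := by
  have hx : F.proj (ε.symm y) ∈ g.U i := hy.2
  have h1 : ∀ a, (D ((g.homeo i).symm ≫ₕ ε).symm y : E (2 * n) →L[ℝ] E (2 * n)) a =
      (D (g.glue i) (ε.symm y) : E (2 * n) →L[ℝ] E (2 * n))
        ((D ε.symm y : E (2 * n) →L[ℝ] E (2 * n)) a) := fun a =>
    D_comp_apply (g := g.glue i) (f := ε.symm) (g.smoothAt_glue hx).mdiff
      (smoothAt_chart_symm hε hy.1).mdiff a
  ext w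
  obtain ⟨a, b, rfl⟩ : ∃ a b, w = ![a, b] := ⟨w 0, w 1, by ext k; fin_cases k <;> rfl⟩
  rw [F.chartForm_apply, ← g.form_glue hx]
  refine congrArg (g.form₂ (g.glue i (ε.symm y))) (funext fun k => ?_)
  fin_cases k
  · exact h1 a
  · exact h1 b

lemma form_nondegenerate {z : g.Space} {a : E (2 * n)} (ha : ∀ b, g.form₂ z ![a, b] = 0) :
    a = 0 := by
  have hz := g.mem_idx (g.proj z)
  set i := g.idx (g.proj z)
  have h1 : (D (g.unglue i) z : E (2 * n) →L[ℝ] E (2 * n)) a = 0 := by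
    refine F.nondegenerate (x := g.unglue i z) fun b => ?_
    have h2 := ha ((D (g.glue i) (g.unglue i z) : E (2 * n) →L[ℝ] E (2 * n)) b)
    have h3 := g.D_unglue_glue (i := i) (x := g.unglue i z) (by rwa [g.proj_unglue hz]) b
    rw [g.glue_unglue hz] at h3
    rwa [g.form_apply hz, h3] at h2
  rw [← g.D_glue_unglue hz a, h1, map_zero]

lemma isSymplectic : IsSymplectic g.form := by
  refine ⟨?_, ?_, ?_⟩
  · rintro _ ⟨i, ε, hε, rfl⟩
    exact ((F.symplectic.smooth ε hε).mono fun y hy => hy.1).congr fun y hy => g.chartForm_eq i hε hy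
  · rintro _ ⟨i, ε, hε, rfl⟩ y hy
    have h1 : chartForm g.form ((g.homeo i).symm ≫ₕ ε) =ᶠ[𝓝 y] chartForm F.form ε := by
      filter_upwards [((g.homeo i).symm ≫ₕ ε).open_target.mem_nhds hy] with w hw
        using g.chartForm_eq i hε hw
    rw [h1.extDeriv.self_of_nhds]
    exact F.symplectic.closed ε hε y hy.1
  · exact fun z a ha => g.form_nondegenerate ha

lemma proj_eventuallyEq {i : g.ι} {z : g.Space} (hz : g.proj z ∈ g.U i) :
    g.proj =ᶠ[𝓝 z] fun w => F.proj (g.unglue i w) := by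
  filter_upwards [(g.isOpen_proj_mem i).mem_nhds hz] with w hw using (g.proj_unglue hw).symm

lemma D_proj_apply {i : g.ι} {z : g.Space} (hz : g.proj z ∈ g.U i) (a : E (2 * n)) :
    (D g.proj z : E (2 * n) →L[ℝ] E n) a =
      F.dproj (g.unglue i z) ((D (g.unglue i) z : E (2 * n) →L[ℝ] E (2 * n)) a) := by
  rw [D_congr (g.proj_eventuallyEq hz)]
  exact D_comp_apply (F.smoothAt_proj _).mdiff (g.smoothAt_unglue hz).mdiff a

lemma surjective_D_proj_iff {i : g.ι} {z : g.Space} (hz : g.proj z ∈ g.U i) :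
    Function.Surjective (D g.proj z : E (2 * n) →L[ℝ] E n) ↔
      g.unglue i z ∈ F.regularLocus := by
  rw [mem_regularLocus]
  constructor
  · intro h v
    obtain ⟨a, ha⟩ := h v
    exact ⟨_, by rw [← g.D_proj_apply hz, ha]⟩
  · intro h v
    obtain ⟨a, ha⟩ := h v
    refine ⟨(D (g.glue i) (g.unglue i z) : E (2 * n) →L[ℝ] E (2 * n)) a, ?_⟩
    have h3 := g.D_unglue_glue (i := i) (x := g.unglue i z) (by rwa [g.proj_unglue hz]) a
    rw [g.glue_unglue hz] at h3
    rw [g.D_proj_apply hz, h3, ha]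

instance [T2Space B] : T2Space g.Space := by
  refine t2_iff_ultrafilter.2 fun {x y} 𝒰 hx hy => ?_
  have hxy : g.proj x = g.proj y := tendsto_nhds_unique (f := g.proj) (l := (𝒰 : Filter g.Space))
    (g.continuous_proj.continuousAt.mono_left hx) (g.continuous_proj.continuousAt.mono_left hy)
  have hi := g.mem_idx (g.proj x)
  set i := g.idx (g.proj x)
  have hi' : g.proj y ∈ g.U i := by rwa [← hxy]
  have h1 : g.unglue i x = g.unglue i y := tendsto_nhds_unique (l := (𝒰 : Filter g.Space))
    ((g.smoothAt_unglue hi).continuousAt.mono_left hx)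
    ((g.smoothAt_unglue hi').continuousAt.mono_left hy)
  rw [← g.glue_unglue hi, h1, g.glue_unglue hi']

instance [SecondCountableTopology B] : SecondCountableTopology g.Space := by
  obtain ⟨T, hT, hTU⟩ := isOpen_iUnion_countable (fun i => (g.U i : Set B)) fun i => (g.U i).isOpen
  have : Countable T := hT.to_subtype
  have h1 : ∀ i : T, SecondCountableTopology (g.homeo i).target := fun i =>
    ((g.homeo i).toHomeomorphSourceTarget).symm.secondCountableTopology
  refine secondCountableTopology_of_countable_cover (U := fun i : T => (g.homeo i).target)
    (fun i => (g.homeo i).open_target) ?_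
  refine eq_univ_of_forall fun z => ?_
  have h2 : g.proj z ∈ ⋃ i, (g.U i : Set B) := mem_iUnion.2 ⟨_, g.mem_idx _⟩
  rw [← hTU] at h2
  obtain ⟨i, hi, hz⟩ := mem_iUnion₂.1 h2
  exact mem_iUnion.2 ⟨⟨i, hi⟩, hz⟩

variable [T2Space B] [SecondCountableTopology B]

/-- The reglued fibration. -/
noncomputable def total : LagrangianFibration.{u, v} n B where
  carrier := g.Space
  form := g.form
  symplectic := g.isSymplectic
  proj := g.proj
  smooth_proj := fun z => ContMDiffAt.congr_of_eventuallyEq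
    (ContMDiffAt.comp (g := F.proj) z (F.smoothAt_proj _) (g.smoothAt_unglue (g.mem_idx (g.proj z))))
    (g.proj_eventuallyEq (g.mem_idx (g.proj z)))
  dense_regular := by
    rw [dense_iff_inter_open]
    rintro V hV ⟨z, hz⟩
    have hi := g.mem_idx (g.proj z)
    set i := g.idx (g.proj z)
    obtain ⟨x, ⟨hx1, hx2⟩, hx3⟩ := F.dense_regular.inter_open_nonempty _ (g.isOpen_iff.1 hV i)
      ⟨g.unglue i z, by rw [mem_preimage, g.proj_unglue hi]; exact hi, by
        rw [mem_preimage, g.glue_unglue hi]; exact hz⟩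
    refine ⟨g.glue i x, hx2, (g.surjective_D_proj_iff (i := i) (by rwa [g.proj_glue hx1])).2 ?_⟩
    rwa [g.unglue_glue hx1]
  lagrangian := by
    intro z hz a b ha hb
    have hi := g.mem_idx (g.proj z)
    set i := g.idx (g.proj z)
    refine (g.form_apply hi a b).trans ?_
    exact F.lagrangian _ ((g.surjective_D_proj_iff hi).1 hz) _ _
      ((g.D_proj_apply hi a).symm.trans ha) ((g.D_proj_apply hi b).symm.trans hb)

/-- Over `U i`, the reglued fibration is isomorphic to the original one. -/
theorem isIsoOn (i : g.ι) : F.IsIsoOn g.total (g.U i) (g.glue i) (g.unglue i) := by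
  refine ⟨fun x hx => ⟨g.smoothAt_glue hx, ?_, fun u w => g.form_glue hx u w⟩,
    fun z hz => ⟨g.smoothAt_unglue hz, ?_, fun u w => (g.form_apply hz u w).symm⟩,
    fun x hx => g.unglue_glue hx, fun z hz => g.glue_unglue hz⟩
  · filter_upwards [(g.isOpen_over i).mem_nhds hx] with y hy using g.proj_glue hy
  · have hz' : g.proj z ∈ g.U i := hz
    filter_upwards [(g.isOpen_proj_mem i).mem_nhds hz'] with y hy using g.proj_unglue hy

lemma locallyIsomorphic : F.LocallyIsomorphic g.total :=
  locallyIsomorphic_iff.2 fun b => ⟨g.U (g.idx b), g.mem_idx b, _, _, g.isIsoOn _⟩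

end GluingData

end LagrangianFibration

/-! ### Sections over open sets -/

namespace LagrangianFibration

variable {n : ℕ} {B : Type u} [TopologicalSpace B] [ChartedSpace (E n) B]
  {F G : LagrangianFibration.{u, v} n B} {U : Opens B}

lemma LocalSection.smoothAt (σ : F.LocalSection U) {σ' : B → F.carrier}
    (h : ∀ b (hb : b ∈ U), σ' b = σ.toFun ⟨b, hb⟩) {b : B} (hb : b ∈ U) :
    SmoothAt (V₁ := E n) (V₂ := E (2 * n)) σ' b := by
  have h1 : (fun x : U => σ' x) = σ.toFun := funext fun x => h x x.2
  have h2 := σ.smooth ⟨b, hb⟩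
  rw [← h1] at h2
  exact contMDiffAt_subtype_iff.1 h2

lemma LocalSection.isSectionAt (σ : F.LocalSection U) {σ' : B → F.carrier}
    (h : ∀ b (hb : b ∈ U), σ' b = σ.toFun ⟨b, hb⟩) {b : B} (hb : b ∈ U) : F.IsSectionAt σ' b := by
  filter_upwards [U.isOpen.mem_nhds hb] with b' hb'
  exact ⟨σ.smoothAt h hb', by rw [h b' hb', σ.proj_eq]⟩

/-- The inclusion of an open set has an invertible derivative. -/
lemma surjective_D_val (x : U) :
    Function.Surjective (D (Subtype.val : U → B) x : E n →L[ℝ] E n) := by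
  classical
  let r : B → U := fun b => if h : b ∈ U then ⟨b, h⟩ else x
  have hr : (fun y : U => r y) = id := funext fun y => by simp [r]
  have h1 : SmoothAt (V₁ := E n) (V₂ := E n) r (x : B) := by
    refine contMDiffAt_subtype_iff.1 ?_
    rw [hr]
    exact contMDiffAt_id
  have hrx : r x = x := congrFun hr x
  have h2 : SmoothAt (V₁ := E n) (V₂ := E n) (Subtype.val : U → B) (r x) :=
    contMDiff_subtype_val (r x)
  intro v
  refine ⟨(D r (x : B) : E n →L[ℝ] E n) v, ?_⟩
  have h3 := D_comp_apply (g := (Subtype.val : U → B)) (f := r) h2.mdiff h1.mdiff v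
  rw [hrx] at h3
  rw [← h3]
  refine D_id_apply ?_ v
  filter_upwards [U.isOpen.mem_nhds x.2] with b hb
  have hb' : b ∈ U := hb
  simp [r, hb']

lemma LagrangianSection.isLagrangianAt (σ : F.LagrangianSection U) {σ' : B → F.carrier}
    (h : ∀ b (hb : b ∈ U), σ' b = σ ⟨b, hb⟩) {b : B} (hb : b ∈ U) : F.IsLagrangianAt σ' b := by
  filter_upwards [U.isOpen.mem_nhds hb] with b' hb'
  refine ⟨σ.toLocalSection.isSectionAt h hb', fun p q => ?_⟩
  obtain ⟨p', rfl⟩ := surjective_D_val (⟨b', hb'⟩ : U) p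
  obtain ⟨q', rfl⟩ := surjective_D_val (⟨b', hb'⟩ : U) q
  have h1 : (fun x : U => σ' x) = σ.toFun := funext fun x => h x x.2
  have h2 : SmoothAt (V₁ := E n) (V₂ := E n) (Subtype.val : U → B) ⟨b', hb'⟩ :=
    contMDiff_subtype_val _
  have h3 : SmoothAt (V₁ := E n) (V₂ := E (2 * n)) σ' b' := σ.toLocalSection.smoothAt h hb'
  have h4 : ∀ p : E n, (D σ' b' : E n →L[ℝ] E (2 * n))
      ((D (Subtype.val : U → B) ⟨b', hb'⟩ : E n →L[ℝ] E n) p) =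
      (D σ.toFun ⟨b', hb'⟩ : E n →L[ℝ] E (2 * n)) p := by
    intro p
    rw [← h1]
    exact (D_comp_apply (g := σ') (f := (Subtype.val : U → B)) (x := ⟨b', hb'⟩) h3.mdiff
      h2.mdiff p).symm
  rw [h4, h4, h b' hb']
  exact σ.isotropic ⟨b', hb'⟩ p' q'

lemma IsLagrangianAt.isSectionAt {s : B → F.carrier} {b : B} (h : F.IsLagrangianAt s b) :
    F.IsSectionAt s b := h.self_of_nhds.1

lemma IsLagrangianAt.congr {s s' : B → F.carrier} {b : B} (h : F.IsLagrangianAt s b)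
    (h' : s' =ᶠ[𝓝 b] s) : F.IsLagrangianAt s' b := by
  filter_upwards [h, h'.eventually_nhds] with b' h1 h2
  refine ⟨h1.1.congr h2, ?_⟩
  rw [D_congr h2, h2.self_of_nhds]
  exact h1.2

lemma isotropic_restrict {σ : B → F.carrier} (h : ∀ b ∈ U, F.IsLagrangianAt σ b) (b : U)
    (p q : E n) : F.ω₂ (σ b) ![(D (fun b : U => σ b) b : E n →L[ℝ] E (2 * n)) p,
      (D (fun b : U => σ b) b : E n →L[ℝ] E (2 * n)) q] = 0 := by
  have h2 : SmoothAt (V₁ := E n) (V₂ := E n) (Subtype.val : U → B) b := contMDiff_subtype_val _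
  have h4 : ∀ p : E n, (D (fun b : U => σ b) b : E n →L[ℝ] E (2 * n)) p =
      (D σ (b : B) : E n →L[ℝ] E (2 * n)) ((D (Subtype.val : U → B) b : E n →L[ℝ] E n) p) :=
    fun p => D_comp_apply (g := σ) (f := (Subtype.val : U → B)) (x := b)
      (h b b.2).isSectionAt.smooth.mdiff h2.mdiff p
  rw [h4, h4]
  exact (h b b.2).self_of_nhds.2 _ _

/-- The Lagrangian section over `U` that is given by a map on the base. -/
def LagrangianSection.mk' (U : Opens B) (σ : B → F.carrier) (h : ∀ b ∈ U, F.IsLagrangianAt σ b) :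
    F.LagrangianSection U where
  toFun := fun b => σ b
  smooth := fun b => contMDiffAt_subtype_iff.2 (h b b.2).isSectionAt.smooth
  proj_eq := fun b => (h b b.2).isSectionAt.proj_apply
  mem_regularLocus := fun b => (h b b.2).isSectionAt.mem_regularLocus
  isotropic := fun b p q => isotropic_restrict h b p q

lemma LagrangianSection.ext {σ τ : F.LagrangianSection U} (h : ∀ b, σ b = τ b) : σ = τ := by
  obtain ⟨⟨f, h1, h2⟩, h3, h4⟩ := σ
  obtain ⟨⟨f', h1', h2'⟩, h3', h4'⟩ := τ
  obtain rfl : f = f' := funext h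
  rfl

open Classical in
/-- The extension of a section over `U` to a map on the whole base, with the values of `d` outside
`U`. -/
noncomputable def LagrangianSection.extend (σ : F.LagrangianSection U) (d : B → F.carrier) (b : B) :
    F.carrier := if h : b ∈ U then σ ⟨b, h⟩ else d b

lemma LagrangianSection.extend_apply (σ : F.LagrangianSection U) (d : B → F.carrier) {b : B}
    (hb : b ∈ U) : σ.extend d b = σ ⟨b, hb⟩ := dif_pos hb

lemma LagrangianSection.isLagrangianAt_extend (σ : F.LagrangianSection U) (d : B → F.carrier) {b : B}
    (hb : b ∈ U) : F.IsLagrangianAt (σ.extend d) b :=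
  σ.isLagrangianAt (fun _ hb => σ.extend_apply d hb) hb

variable (s : F.LagrangianSection ⊤)

/-- The values of a global section. -/
def LagrangianSection.onBase (s : F.LagrangianSection ⊤) (b : B) : F.carrier := s ⟨b, trivial⟩

lemma LagrangianSection.isLagrangianAt_onBase (b : B) : F.IsLagrangianAt s.onBase b :=
  s.isLagrangianAt (fun _ _ => rfl) trivial

lemma LagrangianSection.proj_onBase (b : B) : F.proj (s.onBase b) = b := s.proj_eq ⟨b, trivial⟩

lemma LagrangianSection.onBase_mem (b : B) : s.onBase b ∈ F.regularLocus :=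
  s.mem_regularLocus ⟨b, trivial⟩

/-- The restriction of the global section `s`. -/
def LagrangianSection.restrict (U : Opens B) : F.LagrangianSection U :=
  LagrangianSection.mk' U s.onBase fun b _ => s.isLagrangianAt_onBase b

lemma LagrangianSection.restrict_apply (b : U) : s.restrict U b = s.onBase b := rfl

variable [IsManifold 𝓘(ℝ, E n) ∞ B]

/-! ### The group of Lagrangian sections -/

lemma IsTame.isLagrangianAt_shift (hF : F.IsTame) {s σ τ : B → F.carrier} {b : B}
    (hs : F.IsLagrangianAt s b) (hσ : F.IsLagrangianAt σ b) (hτ : F.IsLagrangianAt τ b) :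
    F.IsLagrangianAt (fun b => F.shift (s b) (σ b) (τ b)) b := by
  have h1 : ∀ᶠ b' in 𝓝 b, F.IsMorphismAt F (fun z => F.shift (s (F.proj z)) (σ (F.proj z)) z)
      (τ b') := by
    filter_upwards [eventually_eventually_nhds.2 hs, eventually_eventually_nhds.2 hσ, hτ]
      with b' h1 h2 h3
    exact hF.isMorphismAt_shift (by rw [h3.1.proj_apply]; exact h1)
      (by rw [h3.1.proj_apply]; exact h2)
  refine (IsMorphismAt.isLagrangianAt hτ h1).congr ?_
  filter_upwards [hτ] with b' h3
  rw [h3.1.proj_apply]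

/-- Addition of the points `x` and `y` of a fibre, with zero `p`, is commutative. -/
lemma IsTame.shift_symm (hF : F.IsTame) {p x y : F.carrier} (hp : p ∈ F.regularLocus)
    (hx : x ∈ F.regularLocus) (hy : y ∈ F.regularLocus) (hpx : F.proj p = F.proj x)
    (hpy : F.proj p = F.proj y) : F.shift p x y = F.shift p y x := by
  conv_lhs => rw [← hF.shift_self hp hy hpy]
  rw [hF.shift_comm hp hx hp hy hpx rfl hpy rfl, hF.shift_self hp hx hpx]

lemma IsTame.shift_assoc (hF : F.IsTame) {p x y z : F.carrier} (hp : p ∈ F.regularLocus)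
    (hy : y ∈ F.regularLocus) (hz : z ∈ F.regularLocus) (hpy : F.proj p = F.proj y)
    (hpz : F.proj p = F.proj z) (hx : F.proj x = F.proj p) :
    F.shift p (F.shift p z y) x = F.shift p z (F.shift p y x) := by
  have hC := hF.proper.isComplete
  rw [← hF.shift_trans hp hy (hF.shift_mem hy) hpy (proj_shift hC _ _ _).symm hx,
    hF.shift_shift hp hz hy hpz hpy.symm]
  rw [proj_shift hC, hx]

variable (hF : F.IsTame)

include hF

lemma IsTame.fibreAdd_iff {b : B} {x y z : F.carrier} (hy : y ∈ F.regularLocus)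
    (hyb : F.proj y = b) (hxb : F.proj x = b) :
    F.FibreAdd s b x y z ↔ z = F.shift (s.onBase b) y x := by
  have hC := hF.proper.isComplete
  constructor
  · rintro ⟨β, h1, h2⟩
    obtain ⟨-, h3⟩ := (translate_iff_flow hC).1 h1
    obtain ⟨-, h4⟩ := (translate_iff_flow hC).1 h2
    rw [h4]
    exact (hF.shift_eq (s.onBase_mem b) h3.symm (hxb.trans (s.proj_onBase b).symm)).symm
  · intro h
    obtain ⟨β, hβ⟩ := hF.exists_flow_eq (s.onBase_mem b) hy ((s.proj_onBase b).trans hyb.symm)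
    refine ⟨β, (translate_iff_flow hC).2 ⟨s.proj_onBase b, hβ.symm⟩,
      (translate_iff_flow hC).2 ⟨hxb, ?_⟩⟩
    rw [h, hF.shift_eq (s.onBase_mem b) hβ (hxb.trans (s.proj_onBase b).symm)]

/-- The fibrewise sum of two Lagrangian sections. -/
noncomputable def IsTame.addSection (σ τ : F.LagrangianSection U) : F.LagrangianSection U :=
  LagrangianSection.mk' U
    (fun b => F.shift (s.onBase b) (τ.extend s.onBase b) (σ.extend s.onBase b)) fun _ hb =>
      hF.isLagrangianAt_shift (s.isLagrangianAt_onBase _) (τ.isLagrangianAt_extend _ hb)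
        (σ.isLagrangianAt_extend _ hb)

/-- The fibrewise inverse of a Lagrangian section. -/
noncomputable def IsTame.negSection (σ : F.LagrangianSection U) : F.LagrangianSection U :=
  LagrangianSection.mk' U
    (fun b => F.shift (σ.extend s.onBase b) (s.onBase b) (s.onBase b)) fun _ hb =>
      hF.isLagrangianAt_shift (σ.isLagrangianAt_extend _ hb) (s.isLagrangianAt_onBase _)
        (s.isLagrangianAt_onBase _)

lemma IsTame.addSection_apply (σ τ : F.LagrangianSection U) (b : U) :
    hF.addSection s σ τ b = F.shift (s.onBase b) (τ b) (σ b) := by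
  rw [← τ.extend_apply s.onBase b.2, ← σ.extend_apply s.onBase b.2]
  rfl

lemma IsTame.negSection_apply (σ : F.LagrangianSection U) (b : U) :
    hF.negSection s σ b = F.shift (σ b) (s.onBase b) (s.onBase b) := by
  rw [← σ.extend_apply s.onBase b.2]
  rfl

/-- The group of Lagrangian sections over `U`, with zero section `s`. -/
@[reducible]
noncomputable def IsTame.addCommGroup (U : Opens B) : AddCommGroup (F.LagrangianSection U) :=
  letI : Add (F.LagrangianSection U) := ⟨hF.addSection s⟩
  letI : Zero (F.LagrangianSection U) := ⟨s.restrict U⟩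
  letI : Neg (F.LagrangianSection U) := ⟨hF.negSection s⟩
  have h0 : ∀ (σ : F.LagrangianSection U) (b : U), F.proj (s.onBase b) = F.proj (σ b) :=
    fun σ b => (s.proj_onBase b).trans (σ.proj_eq b).symm
  { add_assoc := fun σ τ ρ => LagrangianSection.ext fun b => by
      change hF.addSection s (hF.addSection s σ τ) ρ b = hF.addSection s σ (hF.addSection s τ ρ) b
      simp only [hF.addSection_apply s]
      exact (hF.shift_assoc (s.onBase_mem b) (τ.mem_regularLocus b) (ρ.mem_regularLocus b)
        (h0 τ b) (h0 ρ b) (h0 σ b).symm).symm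
    zero_add := fun σ => LagrangianSection.ext fun b => by
      change hF.addSection s (s.restrict U) σ b = σ b
      rw [hF.addSection_apply s, s.restrict_apply]
      exact hF.shift_self (s.onBase_mem b) (σ.mem_regularLocus b) (h0 σ b)
    add_zero := fun σ => LagrangianSection.ext fun b => by
      change hF.addSection s σ (s.restrict U) b = σ b
      rw [hF.addSection_apply s, s.restrict_apply]
      exact hF.shift_same (s.onBase_mem b) (h0 σ b).symm
    nsmul := nsmulRec
    zsmul := zsmulRec
    neg_add_cancel := fun σ => LagrangianSection.ext fun b => by
      change hF.addSection s (hF.negSection s σ) σ b = s.onBase b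
      rw [hF.addSection_apply s, hF.negSection_apply s]
      rw [hF.shift_trans (σ.mem_regularLocus b) (s.onBase_mem b) (σ.mem_regularLocus b)
        (h0 σ b).symm (h0 σ b) (h0 σ b), hF.shift_same (σ.mem_regularLocus b) (h0 σ b)]
    add_comm := fun σ τ => LagrangianSection.ext fun b => by
      change hF.addSection s σ τ b = hF.addSection s τ σ b
      rw [hF.addSection_apply s, hF.addSection_apply s]
      exact hF.shift_symm (s.onBase_mem b) (τ.mem_regularLocus b) (σ.mem_regularLocus b)
        (h0 τ b) (h0 σ b) }

theorem IsTame.exists_addCommGroup (U : Opens B) :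
    ∃ _ : AddCommGroup (F.LagrangianSection U),
      (∀ b : U, (0 : F.LagrangianSection U) b = s ⟨b, trivial⟩) ∧
      ∀ σ τ ρ : F.LagrangianSection U, σ + τ = ρ ↔ ∀ b : U, F.FibreAdd s b (σ b) (τ b) (ρ b) := by
  refine ⟨hF.addCommGroup s U, fun b => rfl, fun σ τ ρ => ?_⟩
  have h2 : ∀ b : U, F.FibreAdd s b (σ b) (τ b) (ρ b) ↔ ρ b = F.shift (s.onBase b) (τ b) (σ b) :=
    fun b => hF.fibreAdd_iff s (τ.mem_regularLocus b) (τ.proj_eq b) (σ.proj_eq b)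
  simp only [h2]
  change hF.addSection s σ τ = ρ ↔ _
  constructor
  · rintro rfl b
    exact hF.addSection_apply s σ τ b
  · intro h
    exact LagrangianSection.ext fun b => (hF.addSection_apply s σ τ b).trans (h b).symm

end LagrangianFibration

namespace LagrangianFibration

variable {n : ℕ} {B : Type u} [TopologicalSpace B] [ChartedSpace (E n) B]
  {F G : LagrangianFibration.{u, v} n B}

/-! ### Isomorphisms and sections -/

lemma IsLagrangianAt.exists_opens {s : B → F.carrier} {b : B} (h : F.IsLagrangianAt s b) :
    ∃ U : Opens B, b ∈ U ∧ ∀ b' ∈ U, F.IsLagrangianAt s b' := by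
  obtain ⟨V, hV, hVo, hbV⟩ := eventually_nhds_iff.1 (eventually_eventually_nhds.2 h)
  exact ⟨⟨V, hVo⟩, hbV, hV⟩

lemma IsIsoOn.isLagrangianAt {U : Set B} (hU : IsOpen U) {f : F.carrier → G.carrier}
    {g : G.carrier → F.carrier} (h : F.IsIsoOn G U f g) {s : B → F.carrier} {b : B} (hb : b ∈ U)
    (hs : F.IsLagrangianAt s b) : G.IsLagrangianAt (fun b => f (s b)) b := by
  refine IsMorphismAt.isLagrangianAt hs ?_
  filter_upwards [hs, hU.mem_nhds hb] with b' h1 h2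
  exact h.map _ (by rw [h1.1.proj_apply]; exact h2)

variable [IsManifold 𝓘(ℝ, E n) ∞ B]

/-- Symplectic maps over an open set `U` that agree on a section of the regular locus agree over `U`:
both commute with the action of the covectors, which is transitive on the regular points of the
fibres, and the regular points are dense. -/
lemma IsTame.eq_of_eq_section (hF : F.IsTame) (hG : G.IsTame) {U : Set B} (hU : IsOpen U)
    {f f' : F.carrier → G.carrier} (h : ∀ x, F.proj x ∈ U → F.IsMorphismAt G f x)
    (h' : ∀ x, F.proj x ∈ U → F.IsMorphismAt G f' x) {s : B → F.carrier}
    (hs : ∀ b ∈ U, s b ∈ F.regularLocus) (hsb : ∀ b ∈ U, F.proj (s b) = b)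
    (hfs : ∀ b ∈ U, f (s b) = f' (s b)) {x : F.carrier} (hx : F.proj x ∈ U) : f x = f' x := by
  by_contra hne
  have h1 : ∀ᶠ z in 𝓝 x, f z ≠ f' z :=
    ((h x hx).smooth.continuousAt.prodMk_nhds (h' x hx).smooth.continuousAt).eventually
      (isClosed_diagonal.isOpen_compl.mem_nhds hne)
  obtain ⟨z, hz, hz', hzU⟩ := ((mem_closure_iff_frequently.1 (F.dense_regular x)).and_eventually
    (h1.and ((hU.preimage F.continuous_proj).mem_nhds hx))).exists
  have hzU' : F.proj z ∈ U := hzU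
  obtain ⟨β, hβ⟩ := hF.exists_flow_eq (hs _ hzU') hz (hsb _ hzU')
  refine hz' ?_
  rw [← hβ, map_flow hF.proper.isComplete hG.proper.isComplete (b := F.proj z)
    (fun y hy => h y (by rw [hy]; exact hzU')) β (hsb _ hzU'),
    map_flow hF.proper.isComplete hG.proper.isComplete (b := F.proj z)
    (fun y hy => h' y (by rw [hy]; exact hzU')) β (hsb _ hzU'), hfs _ hzU']

/-- A symplectic map of a fibre neighbourhood to itself commutes with the translations. -/
lemma IsTame.map_shift_self (hF : F.IsTame) {t : F.carrier → F.carrier} {b : B}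
    (h : ∀ x, F.proj x = b → F.IsMorphismAt F t x) {p q x : F.carrier} (hp : p ∈ F.regularLocus)
    (hq : q ∈ F.regularLocus) (hpb : F.proj p = b) (hqb : F.proj q = b) (hxb : F.proj x = b) :
    t (F.shift p q x) = F.shift p q (t x) := by
  obtain ⟨β, hβ⟩ := hF.exists_flow_eq hp hq (hpb.trans hqb.symm)
  rw [hF.shift_eq hp hβ (hxb.trans hpb.symm), hF.shift_eq hp hβ
    ((h x hxb).proj_apply.trans (hxb.trans hpb.symm)),
    map_flow hF.proper.isComplete hF.proper.isComplete h β hxb]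

/-- The translation that moves one Lagrangian section to another one is an isomorphism. -/
lemma IsTame.isIsoOn_shift (hF : F.IsTame) {U : Set B} {s σ : B → F.carrier}
    (hs : ∀ b ∈ U, F.IsLagrangianAt s b) (hσ : ∀ b ∈ U, F.IsLagrangianAt σ b) :
    F.IsIsoOn F U (fun z => F.shift (s (F.proj z)) (σ (F.proj z)) z)
      (fun z => F.shift (σ (F.proj z)) (s (F.proj z)) z) := by
  have hC := hF.proper.isComplete
  have key : ∀ {s σ : B → F.carrier}, (∀ b ∈ U, F.IsLagrangianAt s b) →
      (∀ b ∈ U, F.IsLagrangianAt σ b) → ∀ x, F.proj x ∈ U →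
      F.shift (σ (F.proj (F.shift (s (F.proj x)) (σ (F.proj x)) x)))
        (s (F.proj (F.shift (s (F.proj x)) (σ (F.proj x)) x)))
        (F.shift (s (F.proj x)) (σ (F.proj x)) x) = x := by
    intro s σ hs hσ x hx
    have h1 := (hs _ hx).isSectionAt
    have h2 := (hσ _ hx).isSectionAt
    rw [proj_shift hC, hF.shift_trans h1.mem_regularLocus h2.mem_regularLocus h1.mem_regularLocus
      (h1.proj_apply.trans h2.proj_apply.symm) (h2.proj_apply.trans h1.proj_apply.symm)
      h1.proj_apply.symm, hF.shift_same h1.mem_regularLocus h1.proj_apply.symm]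
  exact ⟨fun x hx => hF.isMorphismAt_shift (hs _ hx) (hσ _ hx),
    fun x hx => hF.isMorphismAt_shift (hσ _ hx) (hs _ hx), key hs hσ, key hσ hs⟩

/-- An isomorphism over an open set can be changed so that it takes a given Lagrangian section to
another one. -/
lemma IsTame.exists_isIsoOn (hF : F.IsTame) {U : Set B} (hU : IsOpen U)
    {f : F.carrier → G.carrier} {g : G.carrier → F.carrier} (h : F.IsIsoOn G U f g)
    {s : B → F.carrier} {σ : B → G.carrier} (hs : ∀ b ∈ U, F.IsLagrangianAt s b)
    (hσ : ∀ b ∈ U, G.IsLagrangianAt σ b) :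
    ∃ f' g', F.IsIsoOn G U f' g' ∧ ∀ b ∈ U, f' (s b) = σ b := by
  have hτ : ∀ b ∈ U, F.IsLagrangianAt (fun b => g (σ b)) b :=
    fun b hb => h.symm.isLagrangianAt hU hb (hσ b hb)
  refine ⟨_, _, h.comp (hF.isIsoOn_shift hs hτ), fun b hb => ?_⟩
  have h1 := (hs b hb).isSectionAt
  have h2 := (hτ b hb).isSectionAt
  have h3 := (hσ b hb).isSectionAt.proj_apply
  simp only [h1.proj_apply]
  rw [hF.shift_self h1.mem_regularLocus h2.mem_regularLocus
    (h1.proj_apply.trans h2.proj_apply.symm), h.right _ (by rw [h3]; exact hb)]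

/-- Locally isomorphic fibrations with global Lagrangian sections are isomorphic: the local
isomorphisms that respect the sections are unique, and so fit together. -/
theorem IsTame.isomorphic_of_sections (hF : F.IsTame) (h : F.LocallyIsomorphic G)
    (s : F.LagrangianSection ⊤) (σ : G.LagrangianSection ⊤) : F.Isomorphic G := by
  have hG := hF.of_locallyIsomorphic h
  have h1 : ∀ b, ∃ U : Opens B, b ∈ U ∧ ∃ f g, F.IsIsoOn G U f g ∧
      ∀ b ∈ U, f (s.onBase b) = σ.onBase b := by
    intro b
    obtain ⟨U, hb, f, g, hfg⟩ := locallyIsomorphic_iff.1 h b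
    exact ⟨U, hb, hF.exists_isIsoOn U.isOpen hfg (fun b _ => s.isLagrangianAt_onBase b)
      fun b _ => σ.isLagrangianAt_onBase b⟩
  choose U hU f g hfg hs using h1
  refine isomorphic_of_cover U (fun b => ⟨b, hU b⟩) f g hfg fun i j x hi hj => ?_
  exact hF.eq_of_eq_section hG ((U i).isOpen.inter (U j).isOpen) (fun x hx => (hfg i).map x hx.1)
    (fun x hx => (hfg j).map x hx.2) (fun b _ => s.onBase_mem b) (fun b _ => s.proj_onBase b)
    (fun b hb => (hs i b hb.1).trans (hs j b hb.2).symm) ⟨hi, hj⟩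

lemma HasLocalSections.exists_isLagrangianAt (h : F.HasLocalSections) (hF : F.IsProper) (b : B) :
    ∃ σ : B → F.carrier, F.IsLagrangianAt σ b := by
  classical
  obtain ⟨U, hb, ⟨σ⟩⟩ := h b
  exact LagrangianFibration.exists_isLagrangianAt hF (σ.isSectionAt
    (σ' := fun b' => if h : b' ∈ U then σ.toFun ⟨b', h⟩ else σ.toFun ⟨b, hb⟩)
    (fun b' hb' => dif_pos hb') hb)

/-! ### The Jacobian -/

variable [T2Space B] [SecondCountableTopology B]

/-- The Jacobian is obtained by regluing: over the neighbourhood `U i` of `i`, a Lagrangian section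
`s i` is moved to a section that does not depend on `i`. -/
theorem IsTame.exists_jacobian (hF : F.IsTame) (hsec : F.HasLocalSections) :
    ∃ J : LagrangianFibration.{u, v} n B, F.LocallyIsomorphic J ∧
      Nonempty (J.LagrangianSection ⊤) := by
  have hC := hF.proper.isComplete
  have h1 : ∀ b : B, ∃ U : Opens B, b ∈ U ∧ ∃ σ : B → F.carrier, ∀ b' ∈ U, F.IsLagrangianAt σ b' := by
    intro b
    obtain ⟨σ, hσ⟩ := hsec.exists_isLagrangianAt hF.proper b
    obtain ⟨U, hb, hU⟩ := hσ.exists_opens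
    exact ⟨U, hb, σ, hU⟩
  choose U hU s hs using h1
  have hr : ∀ {i b}, b ∈ U i → s i b ∈ F.regularLocus :=
    fun hb => (hs _ _ hb).isSectionAt.mem_regularLocus
  have hp : ∀ {i b}, b ∈ U i → F.proj (s i b) = b :=
    fun hb => (hs _ _ hb).isSectionAt.proj_apply
  -- on the fibre over `b`, the chosen point is `s b b`
  let g : F.GluingData :=
    { ι := B
      U := U
      idx := id
      mem_idx := hU
      φ := fun i x => F.shift (s i (F.proj x)) (s (F.proj x) (F.proj x)) x
      ψ := fun i x => F.shift (s (F.proj x) (F.proj x)) (s i (F.proj x)) x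
      proj_φ := fun i x _ => proj_shift hC _ _ _
      proj_ψ := fun i x _ => proj_shift hC _ _ _
      left := fun i x hx => by
        rw [proj_shift hC, hF.shift_trans (hr hx) (hr (hU _)) (hr hx) ((hp hx).trans (hp (hU _)).symm)
          ((hp (hU _)).trans (hp hx).symm) (hp hx).symm, hF.shift_same (hr hx) (hp hx).symm]
      right := fun i x hx => by
        rw [proj_shift hC, hF.shift_trans (hr (hU _)) (hr hx) (hr (hU _))
          ((hp (hU _)).trans (hp hx).symm) ((hp hx).trans (hp (hU _)).symm) (hp (hU _)).symm,
          hF.shift_same (hr (hU _)) (hp (hU _)).symm]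
      morphism := fun i j x hi hj => by
        refine (hF.isMorphismAt_shift (hs j _ hj) (hs i _ hi)).congr ?_
        filter_upwards [((U i).isOpen.preimage F.continuous_proj).mem_nhds hi,
          ((U j).isOpen.preimage F.continuous_proj).mem_nhds hj] with z hzi hzj
        rw [proj_shift hC, hF.shift_trans (hr hzj) (hr (hU _)) (hr hzi)
          ((hp hzj).trans (hp (hU _)).symm) ((hp (hU _)).trans (hp hzi).symm) (hp hzj).symm] }
  refine ⟨g.total, g.locallyIsomorphic,
    ⟨LagrangianSection.mk' ⊤ (fun b => (⟨s b b⟩ : g.Space)) fun b _ => ?_⟩⟩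
  refine IsLagrangianAt.congr ((g.isIsoOn b).isLagrangianAt (U b).isOpen (hU b) (hs b b (hU b))) ?_
  filter_upwards [(U b).isOpen.mem_nhds (hU b)] with b' hb'
  have h2 : F.shift (s b (F.proj (s b b'))) (s (F.proj (s b b')) (F.proj (s b b'))) (s b b') =
      s b' b' := by
    rw [hp hb', hF.shift_self (hr hb') (hr (hU _)) ((hp hb').trans (hp (hU _)).symm)]
  exact congrArg GluingData.Space.mk h2.symm

end LagrangianFibration

namespace LagrangianFibration

variable {n : ℕ} {B : Type u} [TopologicalSpace B] [ChartedSpace (E n) B]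
  {J Y Y' : LagrangianFibration.{u, v} n B} {s : J.LagrangianSection ⊤}

/-! ### Cocycles and regluing -/

/-- The sections of a cocycle as maps on the base, with the values of the zero section outside the
domain of definition. -/
noncomputable def OneCocycle.val (c : J.OneCocycle s) (i j : c.ι) (b : B) : J.carrier :=
  (c.sec i j).extend s.onBase b

lemma OneCocycle.val_apply (c : J.OneCocycle s) {i j : c.ι} {b : B} (hi : b ∈ c.U i)
    (hj : b ∈ c.U j) : c.val i j b = c.sec i j ⟨b, hi, hj⟩ :=
  (c.sec i j).extend_apply s.onBase (b := b) ⟨hi, hj⟩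

lemma LagrangianSection.extend_mem (s : J.LagrangianSection ⊤) {U : Opens B} (σ : J.LagrangianSection U) (b : B) :
    σ.extend s.onBase b ∈ J.regularLocus := by
  unfold LagrangianSection.extend
  split_ifs with h
  · exact σ.mem_regularLocus ⟨b, h⟩
  · exact s.onBase_mem b

lemma LagrangianSection.proj_extend (s : J.LagrangianSection ⊤) {U : Opens B} (σ : J.LagrangianSection U) (b : B) :
    J.proj (σ.extend s.onBase b) = b := by
  unfold LagrangianSection.extend
  split_ifs with h
  · exact σ.proj_eq ⟨b, h⟩
  · exact s.proj_onBase b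

lemma OneCocycle.val_mem (c : J.OneCocycle s) (i j : c.ι) (b : B) : c.val i j b ∈ J.regularLocus :=
  s.extend_mem (c.sec i j) b

lemma OneCocycle.proj_val (c : J.OneCocycle s) (i j : c.ι) (b : B) : J.proj (c.val i j b) = b :=
  s.proj_extend (c.sec i j) b

lemma OneCocycle.isLagrangianAt_val (c : J.OneCocycle s) {i j : c.ι} {b : B} (hi : b ∈ c.U i)
    (hj : b ∈ c.U j) : J.IsLagrangianAt (c.val i j) b :=
  (c.sec i j).isLagrangianAt_extend s.onBase ⟨hi, hj⟩

/-- The maps `f i` with the inverses `g i` are isomorphisms of the parts of `J` and `Y` over the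
members of the covering of the cocycle `c`, and they differ on the zero section by `c`. -/
structure IsRegluedBy (c : J.OneCocycle s) (Y : LagrangianFibration.{u, v} n B)
    (f : c.ι → J.carrier → Y.carrier) (g : c.ι → Y.carrier → J.carrier) : Prop where
  iso : ∀ i, J.IsIsoOn Y (c.U i) (f i) (g i)
  agree : ∀ i j b, b ∈ c.U i → b ∈ c.U j → f j (s.onBase b) = f i (c.val i j b)

lemma isomorphic_of_mk_eq {Y Y' : J.WithJacobian}
    (h : (Quot.mk _ Y : J.ClassesWithJacobian) = Quot.mk _ Y') : Y.1.Isomorphic Y'.1 := by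
  have hr : Equivalence fun Y Y' : J.WithJacobian => Y.1.Isomorphic Y'.1 :=
    ⟨fun Y => .refl Y.1, .symm, .trans⟩
  exact hr.eqvGen_iff.1 (Quot.eqvGen_exact h)

variable [IsManifold 𝓘(ℝ, E n) ∞ B]

lemma OneCocycle.val_trans (hJ : J.IsTame) (c : J.OneCocycle s) {i j k : c.ι} {b : B}
    (hi : b ∈ c.U i) (hj : b ∈ c.U j) (hk : b ∈ c.U k) :
    c.val i k b = J.shift (s.onBase b) (c.val j k b) (c.val i j b) := by
  rw [c.val_apply hi hk, c.val_apply hj hk, c.val_apply hi hj]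
  exact (hJ.fibreAdd_iff s ((c.sec j k).mem_regularLocus ⟨b, hj, hk⟩)
    ((c.sec j k).proj_eq ⟨b, hj, hk⟩) ((c.sec i j).proj_eq ⟨b, hi, hj⟩)).1 (c.cocycle i j k b hi hj hk)

/-- The isomorphisms of a regluing differ by the translations along the cocycle everywhere. -/
lemma IsRegluedBy.apply (hJ : J.IsTame) (hY : Y.IsTame) {c : J.OneCocycle s}
    {f : c.ι → J.carrier → Y.carrier} {g : c.ι → Y.carrier → J.carrier} (h : IsRegluedBy c Y f g)
    {i j : c.ι} {b : B} (hi : b ∈ c.U i) (hj : b ∈ c.U j) {x : J.carrier} (hx : J.proj x = b) :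
    f j x = f i (J.shift (s.onBase b) (c.val i j b) x) := by
  have hC := hJ.proper.isComplete
  subst hx
  have h1 := hJ.eq_of_eq_section hY ((c.U i).isOpen.inter (c.U j).isOpen) (f := f j)
    (f' := fun z => f i (J.shift (s.onBase (J.proj z)) (c.val i j (J.proj z)) z))
    (fun x hx => (h.iso j).map x hx.2)
    (fun x hx => ((h.iso i).map _ (by rw [proj_shift hC]; exact hx.1)).comp
      (hJ.isMorphismAt_shift (s.isLagrangianAt_onBase _) (c.isLagrangianAt_val hx.1 hx.2)))
    (fun b _ => s.onBase_mem b) (fun b _ => s.proj_onBase b) (fun b hb => ?_) (x := x) ⟨hi, hj⟩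
  · exact h1
  · simp only [s.proj_onBase]
    rw [hJ.shift_self (s.onBase_mem b) (c.val_mem i j b)
      ((s.proj_onBase b).trans (c.proj_val i j b).symm), h.agree i j b hb.1 hb.2]

lemma isRegluing_iff (hJ : J.IsTame) (hY : Y.IsTame) {c : J.OneCocycle s} :
    J.IsRegluing s c Y ↔ ∃ f g, IsRegluedBy c Y f g := by
  have hadd : ∀ {i j b x y} (hi : b ∈ c.U i) (hj : b ∈ c.U j), J.proj x = b →
      (J.FibreAdd s b x (c.sec i j ⟨b, hi, hj⟩) y ↔
        y = J.shift (s.onBase b) (c.val i j b) x) := by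
    intro i j b x y hi hj hx
    rw [c.val_apply hi hj]
    exact hJ.fibreAdd_iff s ((c.sec i j).mem_regularLocus _) ((c.sec i j).proj_eq _) hx
  constructor
  · rintro ⟨φ, hφ⟩
    refine ⟨fun i => (φ i).map, fun i => (φ i).map.invFun, fun i => (φ i).isIsoOn,
      fun i j b hi hj => ?_⟩
    obtain ⟨y, hy, h⟩ := hφ i j b hi hj (s.onBase b) (s.proj_onBase b)
    rw [hadd hi hj (s.proj_onBase b), hJ.shift_self (s.onBase_mem b) (c.val_mem i j b)
      ((s.proj_onBase b).trans (c.proj_val i j b).symm)] at hy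
    rw [h, hy]
  · rintro ⟨f, g, h⟩
    exact ⟨fun i => (h.iso i).isoOver, fun i j b hi hj x hx =>
      ⟨_, (hadd hi hj hx).2 rfl, h.apply hJ hY hi hj hx⟩⟩

lemma IsRegluing.of_isomorphic (hJ : J.IsTame) (hY : Y.IsTame) (hY' : Y'.IsTame)
    {c : J.OneCocycle s} (h : J.IsRegluing s c Y) (hYY : Y.Isomorphic Y') :
    J.IsRegluing s c Y' := by
  obtain ⟨f, g, hfg⟩ := (isRegluing_iff hJ hY).1 h
  obtain ⟨k, l, hkl⟩ := isomorphic_iff.1 hYY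
  exact (isRegluing_iff hJ hY').2 ⟨_, _, fun i => (hkl.mono (subset_univ _)).comp (hfg.iso i),
    fun i j b hi hj => congrArg k (hfg.agree i j b hi hj)⟩

/-- Every fibration with Jacobian `J` and with local sections is a regluing of `J`: local Lagrangian
sections give local isomorphisms with `J` that take them to the zero section. -/
theorem exists_isRegluing (hJ : J.IsTame) (hY : Y.HasLocalSections) (h : J.LocallyIsomorphic Y) :
    ∃ c : J.OneCocycle s, J.IsRegluing s c Y := by
  have hYt := hJ.of_locallyIsomorphic h
  have h1 : ∀ b, ∃ U : Opens B, b ∈ U ∧ ∃ σ : B → Y.carrier, ∃ f g, J.IsIsoOn Y U f g ∧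
      ∀ b' ∈ U, Y.IsLagrangianAt σ b' ∧ f (s.onBase b') = σ b' := by
    intro b
    obtain ⟨σ, hσ⟩ := hY.exists_isLagrangianAt hYt.proper b
    obtain ⟨U, hb, hU⟩ := hσ.exists_opens
    obtain ⟨V, hbV, f, g, hfg⟩ := locallyIsomorphic_iff.1 h b
    obtain ⟨f', g', hfg', hs⟩ := hJ.exists_isIsoOn (U ⊓ V).isOpen
      (hfg.mono (V := (U ⊓ V : Opens B)) inter_subset_right)
      (fun b _ => s.isLagrangianAt_onBase b) (fun b hb => hU b hb.1)
    exact ⟨U ⊓ V, ⟨hb, hbV⟩, σ, f', g', hfg', fun b' hb' => ⟨hU b' hb'.1, hs b' hb'⟩⟩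
  choose U hU σ f g hfg hs using h1
  have hL : ∀ i j, ∀ b ∈ U i ⊓ U j, J.IsLagrangianAt (fun b => g i (f j (s.onBase b))) b :=
    fun i j b hb => (hfg i).symm.isLagrangianAt (U i).isOpen hb.1
      ((hfg j).isLagrangianAt (U j).isOpen hb.2 (s.isLagrangianAt_onBase b))
  have ht : ∀ i j b, b ∈ U i → b ∈ U j → ∀ x, J.proj x = b →
      J.IsMorphismAt J (fun x => g i (f j x)) x := by
    rintro i j b hi hj x rfl
    exact ((hfg i).inv _ (by rw [(hfg j).proj_map hj]; exact hi)).comp ((hfg j).map x hj)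
  let c : J.OneCocycle s :=
    { ι := B
      U := U
      covers := fun b => ⟨b, hU b⟩
      sec := fun i j => LagrangianSection.mk' (U i ⊓ U j) _ (hL i j)
      cocycle := by
        intro i j k b hi hj hk
        have h1 := (hL j k b ⟨hj, hk⟩).isSectionAt
        have h2 := (hL i j b ⟨hi, hj⟩).isSectionAt
        refine (hJ.fibreAdd_iff s h1.mem_regularLocus h1.proj_apply h2.proj_apply).2 ?_
        have h3 := hJ.map_shift_self (ht i j b hi hj) (s.onBase_mem b) h1.mem_regularLocus
          (s.proj_onBase b) h1.proj_apply (s.proj_onBase b)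
        rw [hJ.shift_self (s.onBase_mem b) h1.mem_regularLocus
          ((s.proj_onBase b).trans h1.proj_apply.symm)] at h3
        refine Eq.trans ?_ h3
        have h4 : Y.proj (f k (s.onBase b)) = b :=
          ((hfg k).proj_map (by rw [s.proj_onBase]; exact hk)).trans (s.proj_onBase b)
        change g i (f k (s.onBase b)) = g i (f j (g j (f k (s.onBase b))))
        rw [(hfg j).right _ (by rw [h4]; exact hj)] }
  refine ⟨c, (isRegluing_iff hJ hYt).2 ⟨f, g, hfg, fun i j b hi hj => ?_⟩⟩
  have h4 : Y.proj (f j (s.onBase b)) = b :=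
    ((hfg j).proj_map (by rw [s.proj_onBase]; exact hj)).trans (s.proj_onBase b)
  rw [c.val_apply hi hj]
  exact ((hfg i).right _ (by rw [h4]; exact hi)).symm

/-- Regluings along cohomologous cocycles are isomorphic. -/
theorem isomorphic_of_cohomologous (hJ : J.IsTame) (hY : Y.IsTame) (hY' : Y'.IsTame)
    {c c' : J.OneCocycle s} (hcc : J.Cohomologous s c c') (h : J.IsRegluing s c Y)
    (h' : J.IsRegluing s c' Y') : Y.Isomorphic Y' := by
  obtain ⟨f, g, hfg⟩ := (isRegluing_iff hJ hY).1 h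
  obtain ⟨f', g', hfg'⟩ := (isRegluing_iff hJ hY').1 h'
  obtain ⟨κ, V, hV, r, r', hr, hr', τ, hτ⟩ := hcc
  let t : κ → B → J.carrier := fun k => (τ k).extend s.onBase
  have ht : ∀ k b, t k b ∈ J.regularLocus := fun k => s.extend_mem (τ k)
  have htp : ∀ k b, J.proj (t k b) = b := fun k => s.proj_extend (τ k)
  have hst : ∀ k b, J.proj (s.onBase b) = J.proj (t k b) :=
    fun k b => (s.proj_onBase b).trans (htp k b).symm
  have hLt : ∀ k, ∀ b ∈ (V k : Set B), J.IsLagrangianAt (t k) b :=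
    fun k b hb => (τ k).isLagrangianAt_extend _ hb
  have hiso : ∀ k, Y.IsIsoOn Y' (V k) _ _ := fun k => ((hfg'.iso (r' k)).mono (hr' k)).comp
    ((hJ.isIsoOn_shift (hLt k) fun b _ => s.isLagrangianAt_onBase b).comp
      ((hfg.iso (r k)).symm.mono (hr k)))
  have hval : ∀ k l b, b ∈ V k → b ∈ V l → J.shift (s.onBase b) (t l b) (c.val (r k) (r l) b) =
      J.shift (s.onBase b) (c'.val (r' k) (r' l) b) (t k b) := by
    intro k l b hk hl
    obtain ⟨z, h1, h2⟩ := hτ k l b hk hl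
    replace h1 := (hJ.fibreAdd_iff s ((τ l).mem_regularLocus ⟨b, hl⟩) ((τ l).proj_eq ⟨b, hl⟩)
      ((c.sec (r k) (r l)).proj_eq ⟨b, hr k hk, hr l hl⟩)).1 h1
    replace h2 := (hJ.fibreAdd_iff s ((c'.sec (r' k) (r' l)).mem_regularLocus
      ⟨b, hr' k hk, hr' l hl⟩) ((c'.sec (r' k) (r' l)).proj_eq ⟨b, hr' k hk, hr' l hl⟩)
      ((τ k).proj_eq ⟨b, hk⟩)).1 h2
    rw [c.val_apply (hr k hk) (hr l hl), c'.val_apply (hr' k hk) (hr' l hl)]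
    simp only [t]
    rw [(τ l).extend_apply _ hl, (τ k).extend_apply _ hk]
    exact h1.symm.trans h2
  have hF : ∀ k b, b ∈ V k → Y.proj (f (r k) (t k b)) = b := fun k b hk =>
    ((hfg.iso (r k)).proj_map (by rw [htp]; exact hr k hk)).trans (htp k b)
  refine isomorphic_of_cover V hV _ _ hiso fun k l x hk hl => ?_
  refine hY.eq_of_eq_section hY' ((V k).isOpen.inter (V l).isOpen)
    (fun x hx => (hiso k).map x hx.1) (fun x hx => (hiso l).map x hx.2)
    (s := fun b => f (r l) (t l b)) (fun b hb => ?_) (fun b hb => hF l b hb.2)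
    (fun b hb => ?_) ⟨hk, hl⟩
  · exact ((hfg.iso (r l)).map _
      (by rw [htp]; exact hr l hb.2)).mem_regularLocus_iff.2 (ht l b)
  · -- both maps take the section `f (r l) ∘ t l` of `Y` to `f' (r' l) ∘ s`
    have hbk := hr k hb.1
    have hbl := hr l hb.2
    have hsv := (s.proj_onBase b).trans (c.proj_val (r k) (r l) b).symm
    have hsv' := (s.proj_onBase b).trans (c'.proj_val (r' k) (r' l) b).symm
    have h1 : g (r l) (f (r l) (t l b)) = t l b :=
      (hfg.iso (r l)).left _ (by rw [htp]; exact hbl)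
    have h2 : g (r k) (f (r l) (t l b)) =
        J.shift (s.onBase b) (t k b) (c'.val (r' k) (r' l) b) := by
      rw [hfg.apply hJ hY hbk hbl (htp l b), (hfg.iso (r k)).left _
        (by rw [proj_shift hJ.proper.isComplete, htp]; exact hbk),
        hJ.shift_symm (s.onBase_mem b) (c.val_mem _ _ _) (ht l b) hsv (hst l b),
        hval k l b hb.1 hb.2, hJ.shift_symm (s.onBase_mem b) (c'.val_mem _ _ _) (ht k b) hsv'
        (hst k b)]
    simp only [h1, h2, proj_shift hJ.proper.isComplete, htp, c'.proj_val]
    rw [hJ.shift_trans (s.onBase_mem b) (ht k b) (s.onBase_mem b) (hst k b) (hst k b).symm hsv'.symm,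
      hJ.shift_same (s.onBase_mem b) hsv'.symm,
      hJ.shift_self (ht l b) (s.onBase_mem b) (hst l b).symm]
    exact (hfg'.agree _ _ b (hr' k hb.1) (hr' l hb.2)).symm

/-- The cocycles of two presentations of a fibration as a regluing are cohomologous. -/
theorem cohomologous_of_isRegluing (hJ : J.IsTame) (hY : Y.IsTame) {c c' : J.OneCocycle s}
    (h : J.IsRegluing s c Y) (h' : J.IsRegluing s c' Y) : J.Cohomologous s c c' := by
  obtain ⟨f, g, hfg⟩ := (isRegluing_iff hJ hY).1 h
  obtain ⟨f', g', hfg'⟩ := (isRegluing_iff hJ hY).1 h'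
  let V : c.ι × c'.ι → Opens B := fun k => c.U k.1 ⊓ c'.U k.2
  have hL : ∀ k, ∀ b ∈ V k, J.IsLagrangianAt (fun b => g k.1 (f' k.2 (s.onBase b))) b :=
    fun k b hb => (hfg.iso k.1).symm.isLagrangianAt (c.U k.1).isOpen hb.1
      ((hfg'.iso k.2).isLagrangianAt (c'.U k.2).isOpen hb.2 (s.isLagrangianAt_onBase b))
  refine ⟨c.ι × c'.ι, V, fun b => ?_, Prod.fst, Prod.snd, fun k b hb => hb.1, fun k b hb => hb.2,
    fun k => LagrangianSection.mk' (V k) _ (hL k), fun k l b hk hl => ?_⟩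
  · obtain ⟨i, hi⟩ := c.covers b
    obtain ⟨j, hj⟩ := c'.covers b
    exact ⟨(i, j), hi, hj⟩
  have h1 := (hL k b hk).isSectionAt
  have h2 := (hL l b hl).isSectionAt
  have hs := s.onBase_mem b
  have hsp := s.proj_onBase b
  refine ⟨_, (hJ.fibreAdd_iff s h2.mem_regularLocus h2.proj_apply ((c.sec _ _).proj_eq _)).2 rfl,
    (hJ.fibreAdd_iff s ((c'.sec k.2 l.2).mem_regularLocus ⟨b, hk.2, hl.2⟩)
      ((c'.sec k.2 l.2).proj_eq ⟨b, hk.2, hl.2⟩) h1.proj_apply).2 ?_⟩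
  rw [← c.val_apply hk.1 hl.1, ← c'.val_apply hk.2 hl.2]
  change J.shift (s.onBase b) (g l.1 (f' l.2 (s.onBase b))) (c.val k.1 l.1 b) =
    J.shift (s.onBase b) (c'.val k.2 l.2 b) (g k.1 (f' k.2 (s.onBase b)))
  -- the map `g k.1 ∘ f' k.2` takes the zero section to the `k`-th section of the cochain
  have ht : ∀ x, J.proj x = b → J.IsMorphismAt J (fun x => g k.1 (f' k.2 x)) x := by
    rintro x rfl
    exact ((hfg.iso k.1).inv _ (by rw [(hfg'.iso k.2).proj_map hk.2]; exact hk.1)).comp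
      ((hfg'.iso k.2).map x hk.2)
  have h3 := hJ.map_shift_self ht hs (c'.val_mem k.2 l.2 b) hsp (c'.proj_val k.2 l.2 b) hsp
  rw [hJ.shift_self hs (c'.val_mem k.2 l.2 b) (hsp.trans (c'.proj_val k.2 l.2 b).symm),
    ← hfg'.agree k.2 l.2 b hk.2 hl.2] at h3
  rw [← h3, hJ.shift_symm hs h2.mem_regularLocus (c.val_mem _ _ _) (hsp.trans h2.proj_apply.symm)
    (hsp.trans (c.proj_val _ _ _).symm)]
  have h4 := hfg.apply hJ hY hk.1 hl.1 h2.proj_apply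
  have h5 : Y.proj (f' l.2 (s.onBase b)) = b :=
    ((hfg'.iso l.2).proj_map (by rw [hsp]; exact hl.2)).trans hsp
  rw [(hfg.iso l.1).right _ (by rw [h5]; exact hl.1)] at h4
  have h6 := congrArg (g k.1) h4
  rw [(hfg.iso k.1).left _ (by
    rw [proj_shift hJ.proper.isComplete, h2.proj_apply]; exact hk.1)] at h6
  exact h6.symm

variable [T2Space B] [SecondCountableTopology B]

/-- Along every cocycle `J` can be reglued: on the fibre over `b`, the isomorphism with index `i` is
the translation by `c.val (m b) i b`, for a choice of an index `m b` with `b ∈ c.U (m b)`. -/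
theorem exists_regluing (hJ : J.IsTame) (c : J.OneCocycle s) :
    ∃ Y : LagrangianFibration.{u, v} n B, Y.HasLocalSections ∧ J.LocallyIsomorphic Y ∧
      J.IsRegluing s c Y := by
  have hC := hJ.proper.isComplete
  choose m hm using c.covers
  let a : c.ι → B → J.carrier := fun i b => c.val (m b) i b
  have ha : ∀ i b, a i b ∈ J.regularLocus := fun i b => c.val_mem _ _ _
  have hap : ∀ i b, J.proj (a i b) = b := fun i b => c.proj_val _ _ _
  have hs := s.onBase_mem
  have hsp := s.proj_onBase
  have hsa : ∀ i b, J.proj (s.onBase b) = J.proj (a i b) := fun i b => (hsp b).trans (hap i b).symm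
  have hat : ∀ i j b, b ∈ c.U i → b ∈ c.U j → a j b = J.shift (s.onBase b) (c.val i j b) (a i b) :=
    fun i j b hi hj => c.val_trans hJ (hm b) hi hj
  let G : J.GluingData :=
    { ι := c.ι
      U := c.U
      idx := m
      mem_idx := hm
      φ := fun i x => J.shift (s.onBase (J.proj x)) (a i (J.proj x)) x
      ψ := fun i x => J.shift (a i (J.proj x)) (s.onBase (J.proj x)) x
      proj_φ := fun i x _ => proj_shift hC _ _ _
      proj_ψ := fun i x _ => proj_shift hC _ _ _
      left := fun i x _ => by
        rw [proj_shift hC, hJ.shift_trans (hs _) (ha i _) (hs _) (hsa i _) (hsa i _).symm (hsp _).symm,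
          hJ.shift_same (hs _) (hsp _).symm]
      right := fun i x _ => by
        rw [proj_shift hC, hJ.shift_trans (ha i _) (hs _) (ha i _) (hsa i _).symm (hsa i _)
          (hap i _).symm, hJ.shift_same (ha i _) (hap i _).symm]
      morphism := fun i j x hi hj => by
        refine (hJ.isMorphismAt_shift (s.isLagrangianAt_onBase _) (c.isLagrangianAt_val hi hj)).congr ?_
        filter_upwards [((c.U i).isOpen.preimage J.continuous_proj).mem_nhds hi,
          ((c.U j).isOpen.preimage J.continuous_proj).mem_nhds hj] with z hzi hzj
        have hij : J.proj (a i (J.proj z)) = J.proj (a j (J.proj z)) :=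
          (hap i _).trans (hap j _).symm
        have h1 : J.shift (a i (J.proj z)) (s.onBase (J.proj z))
            (J.shift (s.onBase (J.proj z)) (a j (J.proj z)) z) =
            J.shift (a i (J.proj z)) (a j (J.proj z)) z := by
          rw [hJ.shift_comm (ha i _) (hs _) (hs _) (ha j _) (hsa i _).symm (hsa i _).symm
            (hsa j _) (hap i _).symm, hJ.shift_trans (ha i _) (hs _) (ha j _) (hsa i _).symm
            (hsa j _) (hap i _).symm]
        rw [proj_shift hC, h1, hat i j _ hzi hzj, hJ.shift_shift (hs _) (c.val_mem _ _ _) (ha i _)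
          ((hsp _).trans (c.proj_val _ _ _).symm) (hsa i _).symm (hsp _).symm] }
  have hGt := hJ.of_locallyIsomorphic G.locallyIsomorphic
  refine ⟨G.total, fun b => ⟨c.U (m b), hm b, ⟨(LagrangianSection.mk' (c.U (m b))
    (fun b' => G.glue (m b) (s.onBase b')) fun b' hb' => (G.isIsoOn (m b)).isLagrangianAt
      (c.U (m b)).isOpen hb' (s.isLagrangianAt_onBase b')).toLocalSection⟩⟩, G.locallyIsomorphic,
    (isRegluing_iff hJ hGt).2 ⟨G.glue, G.unglue, G.isIsoOn, fun i j b hi hj => ?_⟩⟩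
  have h1 : J.shift (s.onBase (J.proj (s.onBase b))) (a j (J.proj (s.onBase b))) (s.onBase b) =
      J.shift (s.onBase (J.proj (c.val i j b))) (a i (J.proj (c.val i j b))) (c.val i j b) := by
    rw [hsp, c.proj_val, hJ.shift_self (hs b) (ha j b) (hsa j b), hat i j b hi hj,
      hJ.shift_symm (hs b) (c.val_mem i j b) (ha i b) ((hsp b).trans (c.proj_val i j b).symm)
        (hsa i b)]
  exact congrArg GluingData.Space.mk h1

/-! ### The classification -/

/-- The class of a fibration is that of any cocycle along which it is a regluing of `J`; the map is
bijective because every cocycle has a regluing, which its class determines up to isomorphism. -/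
theorem exists_classification (hJ : J.IsTame) (s : J.LagrangianSection ⊤) :
    ∃ Φ : J.ClassesWithJacobian → J.H1 s, Function.Bijective Φ ∧
      ∀ (Y : J.WithJacobian) (c : J.OneCocycle s),
        Φ (Quot.mk _ Y) = Quot.mk _ c ↔ J.IsRegluing s c Y.1 := by
  have ht : ∀ Y : J.WithJacobian, Y.1.IsTame := fun Y => hJ.of_locallyIsomorphic Y.2.2.1
  have h1 : ∀ Y : J.WithJacobian, ∃ c : J.OneCocycle s, J.IsRegluing s c Y.1 :=
    fun Y => exists_isRegluing hJ Y.2.1 Y.2.2.1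
  have h2 : ∀ c : J.OneCocycle s, ∃ Y : J.WithJacobian, J.IsRegluing s c Y.1 := by
    intro c
    obtain ⟨Y, hY1, hY2, hY3⟩ := exists_regluing hJ c
    exact ⟨⟨Y, hY1, hY2, ⟨s⟩⟩, hY3⟩
  choose γ hγ using h1
  choose R hR using h2
  let Φ : J.ClassesWithJacobian → J.H1 s := Quot.lift (fun Y => Quot.mk _ (γ Y)) fun Y Y' h =>
    Quot.sound (cohomologous_of_isRegluing hJ (ht Y')
      ((hγ Y).of_isomorphic hJ (ht Y) (ht Y') h) (hγ Y'))
  let Ψ : J.H1 s → J.ClassesWithJacobian := Quot.lift (fun c => Quot.mk _ (R c)) fun c c' h =>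
    Quot.sound (isomorphic_of_cohomologous hJ (ht _) (ht _) h (hR c) (hR c'))
  -- every cocycle is cohomologous to itself, because it belongs to a regluing
  have hrefl : ∀ c, J.Cohomologous s c c :=
    fun c => cohomologous_of_isRegluing hJ (ht _) (hR c) (hR c)
  have hΨΦ : ∀ q, Ψ (Φ q) = q := by
    rintro ⟨Y⟩
    exact Quot.sound (isomorphic_of_cohomologous hJ (ht _) (ht _) (hrefl (γ Y)) (hR (γ Y)) (hγ Y))
  have hΦΨ : ∀ q, Φ (Ψ q) = q := by
    rintro ⟨c⟩
    exact Quot.sound (cohomologous_of_isRegluing hJ (ht _) (hγ (R c)) (hR c))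
  refine ⟨Φ, ⟨Function.LeftInverse.injective hΨΦ, Function.RightInverse.surjective hΦΨ⟩,
    fun Y c => ⟨fun h => ?_, fun h => ?_⟩⟩
  · have h3 : (Quot.mk _ (R c) : J.ClassesWithJacobian) = Quot.mk _ Y := by
      rw [← hΨΦ (Quot.mk _ Y), h]
    exact (hR c).of_isomorphic hJ (ht _) (ht _) (isomorphic_of_mk_eq h3)
  · exact Quot.sound (cohomologous_of_isRegluing hJ (ht _) (hγ Y) h)

end LagrangianFibration

end LagrangianFib

theorem theorem2p6 {n : ℕ} {B : Type u} [TopologicalSpace B] [T2Space B]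
    [SecondCountableTopology B] [ChartedSpace (LagrangianFib.E n) B]
    [IsManifold 𝓘(ℝ, LagrangianFib.E n) ∞ B]
    (F : LagrangianFib.LagrangianFibration.{u, v} n B)
    (hproper : F.IsProper) (hconn : F.HasConnectedFibres)
    (hreg : F.HasConnectedRegularFibres) (hsec : F.HasLocalSections) :
    -- the Jacobian exists, and is proper
    (∃ J : LagrangianFib.LagrangianFibration.{u, v} n B, J.IsProper ∧ J.IsJacobianOf F) ∧
    -- it is unique up to isomorphism over `B`
    (∀ J J' : LagrangianFib.LagrangianFibration.{u, v} n B,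
      J.IsJacobianOf F → J'.IsJacobianOf F → J.Isomorphic J') ∧
    ∀ J : LagrangianFib.LagrangianFibration.{u, v} n B, J.IsJacobianOf F →
      ∀ s : J.LagrangianSection ⊤,
        -- the Lagrangian sections form abelian groups under fibrewise addition
        (∀ U : TopologicalSpace.Opens B, ∃ _ : AddCommGroup (J.LagrangianSection U),
          (∀ b : U, (0 : J.LagrangianSection U) b = s ⟨b, trivial⟩) ∧
          ∀ σ τ ρ : J.LagrangianSection U,
            σ + τ = ρ ↔ ∀ b : U, J.FibreAdd s b (σ b) (τ b) (ρ b)) ∧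
        -- the one-to-one correspondence, given by regluing
        ∃ Φ : J.ClassesWithJacobian → J.H1 s, Function.Bijective Φ ∧
          ∀ (Y : J.WithJacobian) (c : J.OneCocycle s),
            Φ (Quot.mk _ Y) = Quot.mk _ c ↔ J.IsRegluing s c Y.1 := by
  have hF : F.IsTame := ⟨hproper, hreg⟩
  refine ⟨?_, fun J J' hJ hJ' => ?_, fun J hJ s => ?_⟩
  · obtain ⟨J, h, hs⟩ := hF.exists_jacobian hsec
    exact ⟨J, hproper.of_locallyIsomorphic h, h.symm, hs⟩
  · obtain ⟨h, ⟨s⟩⟩ := hJ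
    obtain ⟨h', ⟨s'⟩⟩ := hJ'
    exact (hF.of_locallyIsomorphic h.symm).isomorphic_of_sections (h.trans h'.symm) s s'
  · have hJt := hF.of_locallyIsomorphic hJ.1.symm
    exact ⟨hJt.exists_addCommGroup s, LagrangianFib.LagrangianFibration.exists_classification hJt s⟩
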